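/- **Setting.** All groups are discrete. Fix a group $\Gamma$, an associative unital ring $\Lambda$ and a class of groups $\mathcal{C}$ closed under isomorphisms, taking subgroups and taking quotients; for a group $G$ let $\mathcal{C}(G)$ be the family of subgroups of $G$ that belong to $\mathcal{C}$. A *group over $\Gamma$* is a group $G$ with a homomorphism $\xi\colon G\to\Gamma$; a morphism $(H,\xi)\to(G,\mu)$ is a homomorphism $\alpha\colon H\to G$ with $\mu\circ\alpha=\xi$. For an $H$-space $X$, $\alpha_*X$ is the quotient of $G\times X$ by the right $H$-action $(g,x)\cdot h=(g\alpha(h),h^{-1}x)$. A *$G$-homology theory* $\mathcal{H}^G_*$ with values in $\Lambda$-modules consists of functors $\mathcal{H}^G_n$ ($n\in\mathbb{Z}$) from $G$-CW-pairs (with all $G$-maps of pairs) to $\Lambda$-modules and natural transformations $\partial^G_n\colon\mathcal{H}^G_n(X,A)\to\mathcal{H}^G_{n-1}(A)$ that satisfy $G$-homotopy invariance, the long exact sequence of a pair, excision (for a $G$-CW-pair $(X,A)$ and a cellular $G$-map $f\colon A\to B$, the map $(X,A)\to(X\cup_fB,B)$ induces isomorphisms) and the disjoint union axiom ($\bigoplus_i\mathcal{H}^G_n(X_i)\cong\mathcal{H}^G_n(\coprod_iX_i)$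 for arbitrary families). An *equivariant homology theory $\mathcal{H}^?_*$ over $\Gamma$* assigns to each group $(G,\xi)$ over $\Gamma$ a $G$-homology theory $\mathcal{H}^G_*$ with values in $\Lambda$-modules, together with homomorphisms $\mathrm{ind}_\alpha\colon\mathcal{H}^H_n(X,A)\to\mathcal{H}^G_n(\alpha_*(X,A))$, for each morphism $\alpha\colon(H,\xi)\to(G,\mu)$ of groups over $\Gamma$ and each $n$, natural in the $H$-CW-pair $(X,A)$, such that: (a) $\partial^G_n\circ\mathrm{ind}_\alpha=\mathrm{ind}_\alpha\circ\partial^H_n$; (b) $\mathrm{ind}_{\beta\circ\alpha}=\mathcal{H}^K_n(f_1)\circ\mathrm{ind}_\beta\circ\mathrm{ind}_\alpha$ for every further morphism $\beta\colon(G,\mu)\to(K,\nu)$, where $f_1\colon\beta_*\alpha_*(X,A)\to(\beta\circ\alpha)_*(X,A)$, $(k,g,x)\mapsto(k\beta(g),x)$; (c) for $g\in G$ with $\xi(g)=1$ and the conjugation $c(g)\colon G\to G$, $h\mapsto ghg^{-1}$, the map $\mathrm{ind}_{c(g)}$ is $\mathcal{H}^G_n(f_2)$, where $f_2\colon(X,A)\to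 c(g)_*(X,A)$, $x\mapsto(1,g^{-1}x)$; (d) if $\alpha$ is injective, then $\mathrm{ind}_\alpha\colon\mathcal{H}^H_n(\{\bullet\})\to\mathcal{H}^G_n(\alpha_*\{\bullet\})$ is bijective for all $n$. For a directed system of groups $(G_i)_{i\in I}$ with $G=\operatorname{colim}_{i\in I}G_i$ and structure maps $\psi_i\colon G_i\to G$, and for $\xi\colon G\to\Gamma$, regard $G_i$ as a group over $\Gamma$ by $\xi\circ\psi_i$ and let $$t^G_n(\{\bullet\})\colon\operatorname{colim}_{i\in I}\mathcal{H}^{G_i}_n(\{\bullet\})\to\mathcal{H}^G_n(\{\bullet\})$$ be the map induced by the composites $\mathcal{H}^{G_i}_n(\{\bullet\})\xrightarrow{\mathrm{ind}_{\psi_i}}\mathcal{H}^G_n((\psi_i)_*\{\bullet\})\to\mathcal{H}^G_n(\{\bullet\})$, where the second map is induced by the projection; the structure maps of the colimit are defined in the same way. The theory $\mathcal{H}^?_*$ is *strongly continuous* if $t^G_n(\{\bullet\})$ is an isomorphism for every group $(G,\xi)$ over $\Gamma$, every directed system of groups with colimit $G$ and every $n$; it is *continuous* if this holds whenever $G=\bigcup_{i\in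 I}G_i$ is the directed union of subgroups $G_i$, with the inclusions as structure maps. A *family* $\mathcal{F}$ of subgroups of $G$ is a set of subgroups closed under conjugation and taking subgroups. Let $E_{\mathcal{F}}(G)$ be its classifying space, the $G$-CW-complex, unique up to $G$-homotopy equivalence, whose $H$-fixed point set is contractible for $H\in\mathcal{F}$ and empty for $H\notin\mathcal{F}$. The pair $(G,\xi)$, $\mathcal{F}$ satisfies the *Isomorphism Conjecture* for $\mathcal{H}^?_*$ if the projection $E_{\mathcal{F}}(G)\to\{\bullet\}$ induces isomorphisms $\mathcal{H}^G_n(E_{\mathcal{F}}(G))\to\mathcal{H}^G_n(\{\bullet\})$ for all $n\in\mathbb{Z}$. It satisfies the *Fibered Isomorphism Conjecture* if for every group homomorphism $\phi\colon K\to G$ the group $(K,\xi\circ\phi)$ satisfies the Isomorphism Conjecture for the family $\phi^*\mathcal{F}=\{H\le K\mid\phi(H)\in\mathcal{F}\}$. **Theorem.** Let $\mathcal{H}^?_*$ be an equivariant homology theory with values in $\Lambda$-modules over $\Gamma$ and let $(G,\xi)$ be a group over $\Gamma$. 1. Let $G=\bigcup_{i\in I}G_i$ be the directed union of subgroups $G_i$.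 Suppose that $\mathcal{H}^?_*$ is continuous and that the Fibered Isomorphism Conjecture is true for $(G_i,\xi|_{G_i})$ and $\mathcal{C}(G_i)$ for all $i\in I$. Then the Fibered Isomorphism Conjecture is true for $(G,\xi)$ and $\mathcal{C}(G)$. 2. Let $(G_i)_{i\in I}$ be a directed system of groups (with not necessarily injective structure maps), $G=\operatorname{colim}_{i\in I}G_i$, with structure maps $\psi_i\colon G_i\to G$. Suppose that $\mathcal{H}^?_*$ is strongly continuous and that the Fibered Isomorphism Conjecture is true for $(G_i,\xi\circ\psi_i)$ and $\mathcal{C}(G_i)$ for all $i\in I$. Then the Fibered Isomorphism Conjecture is true for $(G,\xi)$ and $\mathcal{C}(G)$. -/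

import Mathlib

open CategoryTheory

universe u v w

namespace EquivHomology

/-! ### `G`-CW-complexes (for a discrete group `G`) -/

section GCW

/-- A `G`-CW-structure on a `G`-space `X`, for a discrete group `G`.

The (equivariant) `n`-cells are indexed by a discrete `G`-set `cell n`; decomposing it into orbits,
`cell n × Dⁿ` is `∐ᵢ G/Hᵢ × Dⁿ`, with `G` acting trivially on `Dⁿ`. As in Mathlib's `CWComplex`, the
disc `Dⁿ` is the closed unit ball of `Fin n → ℝ` for the sup norm; characteristic maps are total
functions, only their restrictions to the closed ball matter.

The last four fields say that `X` is the union of the subspaces `Xₙ` (spanned by the cells of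
dimension at most `n`), that `Xₙ` is obtained from `Xₙ₋₁` by a (`G`-)pushout along
`cell n × Sⁿ⁻¹ → cell n × Dⁿ`, and that `X` carries the colimit topology. -/
structure GCWStructure (G X : Type u) [Group G] [TopologicalSpace X] [MulAction G X] where
  /-- the indexing `G`-set of the `n`-cells -/
  cell : ℕ → Type u
  /-- the action of `G` on the set of `n`-cells -/
  [cellAct : ∀ n, MulAction G (cell n)]
  /-- the characteristic maps -/
  map : ∀ n, cell n → (Fin n → ℝ) → X
  continuousOn : ∀ n e, ContinuousOn (map n e) (Metric.closedBall 0 1)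
  map_smul : ∀ n (g : G) e, ∀ x ∈ Metric.closedBall (0 : Fin n → ℝ) 1,
    map n (g • e) x = g • map n e x
  /-- the boundary of an `n`-cell is attached to cells of dimension `< n` -/
  boundary : ∀ n e, ∀ x ∈ Metric.sphere (0 : Fin n → ℝ) 1,
    ∃ m < n, ∃ e' : cell m, ∃ y ∈ Metric.closedBall (0 : Fin m → ℝ) 1, map m e' y = map n e x
  /-- `X` is the disjoint union of the open cells -/
  bijective : Function.Bijective
    (fun p : (Σ n, cell n × Metric.ball (0 : Fin n → ℝ) 1) => map p.1 p.2.1 p.2.2)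
  /-- the topology of `Xₙ₋₁` is the one of the iterated pushout, and `Xₙ₋₁` is closed in `X` -/
  isClosed_of_subset : ∀ (n : ℕ) (C : Set X),
    (∀ c ∈ C, ∃ m < n, ∃ e : cell m, ∃ y ∈ Metric.closedBall (0 : Fin m → ℝ) 1, map m e y = c) →
    (∀ m < n, ∀ e : cell m, IsClosed (Metric.closedBall 0 1 ∩ map m e ⁻¹' C)) → IsClosed C
  /-- `X` carries the colimit topology -/
  isClosed_of_inter : ∀ C : Set X,
    (∀ n : ℕ, IsClosed (C ∩ {c | ∃ m < n, ∃ e : cell m,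
      ∃ y ∈ Metric.closedBall (0 : Fin m → ℝ) 1, map m e y = c})) → IsClosed C

attribute [instance] GCWStructure.cellAct

namespace GCWStructure

variable {G X : Type u} [Group G] [TopologicalSpace X] [MulAction G X]

/-- `S.skelLT n` is the `(n-1)`-skeleton: the union of the closed cells of dimension `< n`. -/
def skelLT (S : GCWStructure G X) (n : ℕ) : Set X :=
  {c | ∃ m < n, ∃ e : S.cell m, ∃ y ∈ Metric.closedBall (0 : Fin m → ℝ) 1, S.map m e y = c}

/-- A `G`-subcomplex: a `G`-invariant subset which is a union of open cells and contains, with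
each open cell, the closed cell. -/
def IsSubcomplex (S : GCWStructure G X) (A : Set X) : Prop :=
  (∀ (g : G), ∀ a ∈ A, g • a ∈ A) ∧
  ∀ n (e : S.cell n), (∀ x ∈ Metric.closedBall (0 : Fin n → ℝ) 1, S.map n e x ∈ A) ∨
    (∀ x ∈ Metric.ball (0 : Fin n → ℝ) 1, S.map n e x ∉ A)

end GCWStructure

/-- A `G`-CW-complex: a `G`-space that admits a `G`-CW-structure. -/
structure GCWComplex (G : Type u) [Group G] where
  carrier : Type u
  [top : TopologicalSpace carrier]
  [act : MulAction G carrier]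
  [cont : ContinuousConstSMul G carrier]
  exists_structure : Nonempty (GCWStructure G carrier)

attribute [instance] GCWComplex.top GCWComplex.act GCWComplex.cont

/-- A `G`-CW-pair `(X, A)`: a `G`-CW-complex `X` with a `G`-subcomplex `A`. -/
structure GCWPair (G : Type u) [Group G] where
  X : GCWComplex G
  A : Set X.carrier
  isSub : ∃ S : GCWStructure G X.carrier, S.IsSubcomplex A

/-- Morphisms of `G`-CW-pairs are all (continuous) `G`-maps of pairs. -/
@[ext] structure GCWPair.Hom {G : Type u} [Group G] (P Q : GCWPair G) where
  toFun : P.X.carrier → Q.X.carrier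
  continuous : Continuous toFun
  equivariant : ∀ (g : G) x, toFun (g • x) = g • toFun x
  mapsTo : ∀ x ∈ P.A, toFun x ∈ Q.A

instance {G : Type u} [Group G] : Category.{u} (GCWPair.{u} G) where
  Hom P Q := GCWPair.Hom P Q
  id P := ⟨id, continuous_id, fun _ _ => rfl, fun _ h => h⟩
  comp f g := ⟨g.toFun ∘ f.toFun, g.continuous.comp f.continuous,
    fun a x => by simp [f.equivariant, g.equivariant], fun x hx => g.mapsTo _ (f.mapsTo x hx)⟩

@[ext] theorem GCWPair.hom_ext {G : Type u} [Group G] {P Q : GCWPair G} {f g : P ⟶ Q}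
    (h : ∀ x, f.toFun x = g.toFun x) : f = g :=
  GCWPair.Hom.ext (funext h)

variable {G : Type u} [Group G]

/-- A `G`-CW-complex `X` as the pair `(X, ∅)`. -/
abbrev GCWComplex.toPair (X : GCWComplex G) : GCWPair G where
  X := X
  A := ∅
  isSub := ⟨X.exists_structure.some, by simp [GCWStructure.IsSubcomplex]⟩

/-- The one-point space `{•}` as a `G`-CW-complex. -/
def pointComplex (G : Type u) [Group G] : GCWComplex G where
  carrier := PUnit.{u + 1}
  cont := ⟨fun _ => continuous_const⟩
  exists_structure := ⟨
    { cell := fun n => ULift.{u} (PLift (n = 0))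
      cellAct := fun n =>
        { smul := fun _ e => e, one_smul := fun _ => rfl, mul_smul := fun _ _ _ => rfl }
      map := fun _ _ _ => PUnit.unit
      continuousOn := fun _ _ => continuousOn_const
      map_smul := fun _ _ _ _ _ => rfl
      boundary := by
        rintro n ⟨⟨rfl⟩⟩ x hx
        rw [Subsingleton.elim x 0, mem_sphere_iff_norm] at hx
        simp only [sub_self, norm_zero] at hx
        exact absurd hx zero_ne_one
      bijective := by
        refine ⟨?_, fun _ => ⟨⟨0, ⟨⟨rfl⟩⟩, ⟨0, by simp⟩⟩, rfl⟩⟩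
        rintro ⟨n, ⟨⟨rfl⟩⟩, x⟩ ⟨m, ⟨⟨rfl⟩⟩, y⟩ _
        have : x = y := Subsingleton.elim _ _
        rw [this]
      isClosed_of_subset := fun _ _ _ _ => isClosed_discrete _
      isClosed_of_inter := fun _ _ => isClosed_discrete _ }⟩

/-- The pair `({•}, ∅)`. -/
abbrev point (G : Type u) [Group G] : GCWPair G := (pointComplex G).toPair

/-- The projection `X → {•}`. -/
def toPoint (P : GCWPair G) (hP : P.A = ∅) : P ⟶ point G where
  toFun _ := PUnit.unit
  continuous := continuous_const
  equivariant _ _ := rfl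
  mapsTo x hx := by rw [hP] at hx; exact hx.elim

/-- The projection `X → {•}` for a `G`-CW-complex `X`. -/
def GCWComplex.pr (X : GCWComplex G) : X.toPair ⟶ point G := toPoint X.toPair rfl

/-- The subcomplex `A` of a pair `(X, A)`, with the subspace topology, is a `G`-CW-complex. -/
def GCWPair.sub (P : GCWPair G) : GCWComplex G :=
  letI : MulAction G P.A :=
    { smul := fun g a => ⟨g • a.1, P.isSub.choose_spec.1 g a.1 a.2⟩
      one_smul := fun a => Subtype.ext (one_smul G a.1)
      mul_smul := fun g h a => Subtype.ext (mul_smul g h a.1) }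
  { carrier := P.A
    cont := ⟨fun g => ((continuous_const_smul g).comp continuous_subtype_val).subtype_mk _⟩
    exists_structure := by
      classical
      obtain ⟨S, hS, hA⟩ := P.isSub
      have key : ∀ n (e : S.cell n) x, x ∈ Metric.ball (0 : Fin n → ℝ) 1 → S.map n e x ∈ P.A →
          ∀ y ∈ Metric.closedBall (0 : Fin n → ℝ) 1, S.map n e y ∈ P.A := by
        intro n e x hx hxA
        rcases hA n e with h | h
        · exact h
        · exact (h x hx hxA).elim
      let E : ℕ → Type u := fun n =>
        {e : S.cell n // ∀ y ∈ Metric.closedBall (0 : Fin n → ℝ) 1, S.map n e y ∈ P.A}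
      have open_cell : ∀ a ∈ P.A, ∀ n, a ∈ S.skelLT n →
          ∃ m < n, ∃ e : E m, ∃ y ∈ Metric.ball (0 : Fin m → ℝ) 1, S.map m e.1 y = a := by
        intro a ha n
        induction n using Nat.strong_induction_on with
        | _ n ih =>
          rintro ⟨m, hm, e, y, hy, rfl⟩
          by_cases hy' : y ∈ Metric.ball (0 : Fin m → ℝ) 1
          · exact ⟨m, hm, ⟨e, key m e y hy' ha⟩, y, hy', rfl⟩
          · have hy2 : y ∈ Metric.sphere (0 : Fin m → ℝ) 1 :=
              le_antisymm (Metric.mem_closedBall.1 hy)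
                (not_lt.1 fun hb => hy' (Metric.mem_ball.2 hb))
            obtain ⟨k, hk, e', z, hz, hzy⟩ := S.boundary m e y hy2
            obtain ⟨k', hk', r⟩ := ih m hm ⟨k, hk, e', z, hz, hzy⟩
            exact ⟨k', hk'.trans hm, r⟩
      have hclosed : ∀ (n : ℕ) (C : Set P.A),
          (∀ c ∈ C, (c : P.X.carrier) ∈ S.skelLT n) →
          (∀ m < n, ∀ e : E m, IsClosed (Metric.closedBall 0 1 ∩
            S.map m e.1 ⁻¹' (Subtype.val '' C))) →
          IsClosed (Subtype.val '' C : Set P.X.carrier) := by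
        intro n
        induction n with
        | zero =>
          intro C hC _
          have : C = ∅ := by
            ext c
            simp only [Set.mem_empty_iff_false, iff_false]
            intro hc
            obtain ⟨m, hm, _⟩ := hC c hc
            omega
          simp [this]
        | succ n ih =>
          intro C hC h
          have h1 := ih (C ∩ {c | (c : P.X.carrier) ∈ S.skelLT n}) (fun c hc => hc.2) (by
            intro m hm e
            have := h m (by omega) e
            convert this using 1
            ext x
            simp only [Set.mem_inter_iff, Set.mem_preimage, Set.mem_image, Set.mem_ofPred_eq,
              Subtype.exists, exists_and_right, exists_eq_right]
            constructor
            · rintro ⟨hx, ⟨hxA, hxC⟩, _⟩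
              exact ⟨hx, hxA, hxC⟩
            · rintro ⟨hx, hxA, hxC⟩
              exact ⟨hx, ⟨hxA, hxC⟩, m, hm, e.1, x, hx, rfl⟩)
          refine S.isClosed_of_subset (n + 1) _ ?_ ?_
          · rintro _ ⟨c, hc, rfl⟩
            exact hC c hc
          · intro m hm e
            rcases hA m e with he | he
            · exact h m hm ⟨e, he⟩
            · have := (S.continuousOn m e).preimage_isClosed_of_isClosed
                Metric.isClosed_closedBall h1
              convert this using 1
              ext x
              simp only [Set.mem_inter_iff, Set.mem_preimage, Set.mem_image, Set.mem_ofPred_eq,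
                Subtype.exists, exists_and_right, exists_eq_right]
              constructor
              · rintro ⟨hx, hxA, hxC⟩
                refine ⟨hx, ⟨hxA, hxC⟩, ?_⟩
                have hx' : x ∈ Metric.sphere (0 : Fin m → ℝ) 1 :=
                  le_antisymm (Metric.mem_closedBall.1 hx)
                    (not_lt.1 fun hb => he x (Metric.mem_ball.2 hb) hxA)
                obtain ⟨k, hk, r⟩ := S.boundary m e x hx'
                exact ⟨k, by omega, r⟩
              · rintro ⟨hx, ⟨hxA, hxC⟩, _⟩
                exact ⟨hx, hxA, hxC⟩
      have hsmul : ∀ (g : G) n (e : E n), ∀ y ∈ Metric.closedBall (0 : Fin n → ℝ) 1,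
          S.map n (g • e.1) y ∈ P.A := by
        intro g n e y hy
        rw [S.map_smul n g e.1 y hy]
        exact hS g _ (e.2 y hy)
      let mp : ∀ n, E n → (Fin n → ℝ) → P.A := fun n e x =>
        if hx : x ∈ Metric.closedBall (0 : Fin n → ℝ) 1 then ⟨S.map n e.1 x, e.2 x hx⟩
        else ⟨S.map n e.1 0, e.2 0 (by simp)⟩
      have mp_eq : ∀ n (e : E n) x, x ∈ Metric.closedBall (0 : Fin n → ℝ) 1 →
          (mp n e x : P.X.carrier) = S.map n e.1 x := by
        intro n e x hx
        simp only [mp, dif_pos hx]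
      have hpre : ∀ n (e : E n) (C : Set P.A), Metric.closedBall 0 1 ∩ mp n e ⁻¹' C =
          Metric.closedBall 0 1 ∩ S.map n e.1 ⁻¹' (Subtype.val '' C) := by
        intro n e C
        ext x
        simp only [Set.mem_inter_iff, Set.mem_preimage]
        refine and_congr_right fun hx => ?_
        rw [← mp_eq n e x hx, Subtype.val_injective.mem_set_image]
      have hskel : ∀ (a : P.A) n, a.1 ∈ S.skelLT n ↔
          ∃ m < n, ∃ e : E m, ∃ y ∈ Metric.closedBall (0 : Fin m → ℝ) 1, mp m e y = a := by
        intro a n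
        constructor
        · intro h
          obtain ⟨m, hm, e, y, hy, hya⟩ := open_cell a.1 a.2 n h
          have hy' := Metric.ball_subset_closedBall hy
          exact ⟨m, hm, e, y, hy', Subtype.ext ((mp_eq m e y hy').trans hya)⟩
        · rintro ⟨m, hm, e, y, hy, rfl⟩
          exact ⟨m, hm, e.1, y, hy, (mp_eq m e y hy).symm⟩
      refine ⟨{ cell := E
                cellAct := fun n =>
                  { smul := fun g e => ⟨g • e.1, hsmul g n e⟩
                    one_smul := fun e => Subtype.ext (one_smul G e.1)
                    mul_smul := fun g h e => Subtype.ext (mul_smul g h e.1) }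
                map := mp
                continuousOn := ?_
                map_smul := ?_
                boundary := ?_
                bijective := ?_
                isClosed_of_subset := ?_
                isClosed_of_inter := ?_ }⟩
      · intro n e
        rw [Topology.IsInducing.subtypeVal.continuousOn_iff]
        exact (S.continuousOn n e.1).congr (fun x hx => mp_eq n e x hx)
      · intro n g e x hx
        refine Subtype.ext ((mp_eq _ _ x hx).trans ?_)
        refine (S.map_smul n g e.1 x hx).trans ?_
        exact congrArg (g • ·) (mp_eq n e x hx).symm
      · intro n e x hx
        have hx' := Metric.sphere_subset_closedBall hx
        obtain ⟨m, hm, r⟩ := S.boundary n e.1 x hx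
        refine (hskel (mp n e x) n).1 ?_
        rw [mp_eq n e x hx']
        exact ⟨m, hm, r⟩
      · constructor
        · rintro ⟨n, e, x⟩ ⟨m, e', y⟩ hxy
          have h2 := congrArg Subtype.val hxy
          simp only at h2
          rw [mp_eq n e x (Metric.ball_subset_closedBall x.2),
            mp_eq m e' y (Metric.ball_subset_closedBall y.2)] at h2
          have h3 := @S.bijective.1 ⟨n, e.1, x⟩ ⟨m, e'.1, y⟩ h2
          obtain rfl : n = m := congrArg Sigma.fst h3
          simp only [Sigma.mk.injEq, heq_eq_eq, Prod.mk.injEq, true_and] at h3 ⊢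
          exact ⟨Subtype.ext h3.1, h3.2⟩
        · intro a
          obtain ⟨⟨n, e, x⟩, hx⟩ := S.bijective.2 a.1
          have hx0 : S.map n e x ∈ P.A := by
            have : S.map n e x = a.1 := hx
            rw [this]; exact a.2
          refine ⟨⟨n, ⟨e, key n e x x.2 hx0⟩, x⟩, Subtype.ext ?_⟩
          exact (mp_eq n _ x (Metric.ball_subset_closedBall x.2)).trans hx
      · intro n C hC h
        have := hclosed n C (fun c hc => (hskel c n).2 (hC c hc)) (fun m hm e => by
          rw [← hpre]; exact h m hm e)
        have h2 := this.preimage (continuous_subtype_val (p := fun x => x ∈ P.A))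
        rwa [Set.preimage_image_eq _ Subtype.val_injective] at h2
      · intro C h
        have : IsClosed (Subtype.val '' C : Set P.X.carrier) := by
          refine S.isClosed_of_inter _ fun n => ?_
          have h1 := hclosed n (C ∩ {c | (c : P.X.carrier) ∈ S.skelLT n}) (fun c hc => hc.2) (by
            intro m hm e
            have hcont : ContinuousOn (mp m e) (Metric.closedBall 0 1) := by
              rw [Topology.IsInducing.subtypeVal.continuousOn_iff]
              exact (S.continuousOn m e.1).congr (fun x hx => mp_eq m e x hx)
            rw [← hpre]
            have := h n
            have h3 := hcont.preimage_isClosed_of_isClosed Metric.isClosed_closedBall this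
            convert h3 using 4
            ext a
            exact hskel a n)
          convert h1 using 1
          ext x
          simp only [GCWStructure.skelLT, Set.mem_inter_iff, Set.mem_image, Set.mem_ofPred_eq,
            Subtype.exists, exists_and_right, exists_eq_right]
        have h2 := this.preimage (continuous_subtype_val (p := fun x => x ∈ P.A))
        rwa [Set.preimage_image_eq _ Subtype.val_injective] at h2 }

/-- The functor `(X, A) ↦ (A, ∅)`. -/
def subFunctor (G : Type u) [Group G] : GCWPair.{u} G ⥤ GCWPair.{u} G where
  obj P := P.sub.toPair
  map {P Q} f :=
    { toFun := fun a => ⟨f.toFun a.1, f.mapsTo a.1 a.2⟩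
      continuous := (f.continuous.comp continuous_subtype_val).subtype_mk _
      equivariant := fun g a => Subtype.ext (f.equivariant g a.1)
      mapsTo := fun _ h => h.elim }

/-- The inclusion `i : A → X`, i.e. `(A, ∅) → (X, ∅)`. -/
def GCWPair.inclSub (P : GCWPair G) : P.sub.toPair ⟶ P.X.toPair where
  toFun := fun a => a.1
  continuous := continuous_subtype_val
  equivariant _ _ := rfl
  mapsTo _ h := h.elim

/-- The inclusion `j : (X, ∅) → (X, A)`. -/
def GCWPair.inclPair (P : GCWPair G) : P.X.toPair ⟶ P where
  toFun := id
  continuous := continuous_id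
  equivariant _ _ := rfl
  mapsTo _ h := h.elim

/-- The disjoint union of a family of `G`-CW-complexes. -/
def coproduct {I : Type u} (X : I → GCWComplex G) : GCWComplex G where
  carrier := Σ i, (X i).carrier
  cont := ⟨fun g => continuous_sigma fun i =>
    continuous_sigmaMk.comp (continuous_const_smul g)⟩
  exists_structure := by
    have S : ∀ i, GCWStructure G (X i).carrier := fun i => (X i).exists_structure.some
    refine ⟨{ cell := fun n => Σ i, (S i).cell n
              map := fun n e x => ⟨e.1, (S e.1).map n e.2 x⟩
              continuousOn := fun n e =>
                continuous_sigmaMk.comp_continuousOn ((S e.1).continuousOn n e.2)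
              map_smul := ?_
              boundary := ?_
              bijective := ?_
              isClosed_of_subset := ?_
              isClosed_of_inter := ?_ }⟩
    · rintro n g ⟨i, e⟩ x hx
      exact congrArg (Sigma.mk i) ((S i).map_smul n g e x hx)
    · rintro n ⟨i, e⟩ x hx
      obtain ⟨m, hm, e', y, hy, h⟩ := (S i).boundary n e x hx
      exact ⟨m, hm, ⟨i, e'⟩, y, hy, congrArg (Sigma.mk i) h⟩
    · constructor
      · rintro ⟨n, ⟨i, e⟩, x⟩ ⟨m, ⟨j, e'⟩, y⟩ h
        obtain rfl : i = j := congrArg Sigma.fst h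
        have h1 : (S i).map n e x = (S i).map m e' y := by simpa using h
        have h2 := @(S i).bijective.1 ⟨n, e, x⟩ ⟨m, e', y⟩ h1
        obtain rfl : n = m := congrArg Sigma.fst h2
        simp only [Sigma.mk.injEq, heq_eq_eq, Prod.mk.injEq, true_and] at h2 ⊢
        exact h2
      · rintro ⟨i, x⟩
        obtain ⟨⟨n, e, y⟩, h⟩ := (S i).bijective.2 x
        exact ⟨⟨n, ⟨i, e⟩, y⟩, congrArg (Sigma.mk i) h⟩
    · intro n C hC h
      rw [isClosed_sigma_iff]
      intro i
      refine (S i).isClosed_of_subset n _ ?_ (fun m hm e => h m hm ⟨i, e⟩)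
      intro c hc
      obtain ⟨m, hm, ⟨j, e⟩, y, hy, hyc⟩ := hC _ hc
      obtain rfl : j = i := congrArg Sigma.fst hyc
      exact ⟨m, hm, e, y, hy, by simpa using hyc⟩
    · intro C h
      rw [isClosed_sigma_iff]
      intro i
      refine (S i).isClosed_of_inter _ fun n => ?_
      have := isClosed_sigma_iff.1 (h n) i
      convert this using 1
      ext c
      simp only [Set.mem_inter_iff, Set.mem_preimage, Set.mem_ofPred_eq]
      refine and_congr_right fun _ => ?_
      constructor
      · rintro ⟨m, hm, e, y, hy, rfl⟩
        exact ⟨m, hm, ⟨i, e⟩, y, hy, rfl⟩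
      · rintro ⟨m, hm, ⟨j, e⟩, y, hy, hyc⟩
        obtain rfl : j = i := congrArg Sigma.fst hyc
        exact ⟨m, hm, e, y, hy, by simpa using hyc⟩

/-- The canonical inclusion `jᵢ : Xᵢ → ∐ Xᵢ`. -/
def coproductIncl {I : Type u} (X : I → GCWComplex G) (i : I) :
    (X i).toPair ⟶ (coproduct X).toPair where
  toFun x := ⟨i, x⟩
  continuous := continuous_sigmaMk (σ := fun i => (X i).carrier) (i := i)
  equivariant _ _ := rfl
  mapsTo _ h := h.elim

/-- Two maps of `G`-CW-pairs are `G`-homotopic (through maps of pairs). -/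
def GHomotopic {P Q : GCWPair G} (f₀ f₁ : P ⟶ Q) : Prop :=
  ∃ h : P.X.carrier × unitInterval → Q.X.carrier, Continuous h ∧
    (∀ x, h (x, 0) = f₀.toFun x) ∧ (∀ x, h (x, 1) = f₁.toFun x) ∧
    (∀ (g : G) x t, h (g • x, t) = g • h (x, t)) ∧ (∀ x ∈ P.A, ∀ t, h (x, t) ∈ Q.A)

/-- `F : (X, A) → (Y, B)` exhibits `(Y, B)` as `(X ∪_f B, B)`, where `f = F|_A : A → B` is a
cellular `G`-map: `Y` is the pushout of `X ← A → B`, and there are `G`-CW-structures on `X` (with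
`A` as a subcomplex) and on `B` for which `f` maps the `n`-skeleton of `A` to that of `B`. -/
def IsCellularPushout {P Q : GCWPair G} (F : P ⟶ Q) : Prop :=
  (∃ (S : GCWStructure G P.X.carrier) (T : GCWStructure G Q.sub.carrier), S.IsSubcomplex P.A ∧
    ∀ (n : ℕ) (a : P.sub.carrier), P.inclSub.toFun a ∈ S.skelLT n →
      ((subFunctor G).map F).toFun a ∈ T.skelLT n) ∧
  IsPushout (C := TopCat.{u})
    (TopCat.ofHom ⟨P.inclSub.toFun, P.inclSub.continuous⟩)
    (TopCat.ofHom ⟨((subFunctor G).map F).toFun, ((subFunctor G).map F).continuous⟩)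
    (TopCat.ofHom ⟨F.toFun, F.continuous⟩)
    (TopCat.ofHom ⟨Q.inclSub.toFun, Q.inclSub.continuous⟩)

end GCW

/-! ### Homology theories -/

/-- A `G`-homology theory with values in `Λ`-modules. -/
structure GHomologyTheory (G : Type u) [Group G] (Λ : Type v) [Ring Λ] where
  /-- the functors `ℋₙ^G` -/
  H : ℤ → (GCWPair.{u} G ⥤ ModuleCat.{w} Λ)
  /-- the boundary homomorphisms `∂ₙ : ℋₙ^G(X, A) → ℋₙ₋₁^G(A)` -/
  bdry : ∀ n, H n ⟶ subFunctor G ⋙ H (n - 1)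
  homotopy_invariance : ∀ {P Q : GCWPair.{u} G} (f₀ f₁ : P ⟶ Q), GHomotopic f₀ f₁ →
    ∀ n, (H n).map f₀ = (H n).map f₁
  exact_X : ∀ (P : GCWPair.{u} G) n,
    Function.Exact ((H n).map P.inclSub).hom ((H n).map P.inclPair).hom
  exact_pair : ∀ (P : GCWPair.{u} G) n,
    Function.Exact ((H n).map P.inclPair).hom ((bdry n).app P).hom
  exact_A : ∀ (P : GCWPair.{u} G) n,
    Function.Exact ((bdry n).app P).hom ((H (n - 1)).map P.inclSub).hom
  excision : ∀ {P Q : GCWPair.{u} G} (F : P ⟶ Q), IsCellularPushout F →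
    ∀ n, Function.Bijective ((H n).map F).hom
  disjoint_union : ∀ {I : Type u} [DecidableEq I] (X : I → GCWComplex.{u} G) n,
    Function.Bijective (DirectSum.toModule Λ I ((H n).obj (coproduct X).toPair)
      (fun i => ((H n).map (coproductIncl X i)).hom))

/-! ### Induction -/

section Induction

variable {H G K : Type u} [Group H] [Group G] [Group K]

/-- The orbit relation of the right `H`-action `(g, x) · h = (g α(h), h⁻¹ x)` on `G × X`. -/
def indSetoid (α : H →* G) (X : Type u) [MulAction H X] : Setoid (G × X) where
  r p q := ∃ h : H, q = (p.1 * α h, h⁻¹ • p.2)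
  iseqv :=
    { refl := fun p => ⟨1, by simp⟩
      symm := by
        rintro p _ ⟨h, rfl⟩
        exact ⟨h⁻¹, by simp⟩
      trans := by
        rintro p _ _ ⟨h, rfl⟩ ⟨k, rfl⟩
        exact ⟨h * k, by simp [mul_assoc, mul_smul]⟩ }

/-- The induction `α_* X = G ×_α X` of an `H`-set `X` with `α : H → G`. -/
def Ind (α : H →* G) (X : Type u) [MulAction H X] : Type u := Quotient (indSetoid α X)

namespace Ind

variable (α : H →* G) {X : Type u} [MulAction H X]

/-- The class of `(g, x)` in `G ×_α X`. -/
def mk (g : G) (x : X) : Ind α X := Quotient.mk (indSetoid α X) (g, x)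

theorem mk_eq_iff {g g' : G} {x x' : X} :
    mk α g x = mk α g' x' ↔ ∃ h : H, g' = g * α h ∧ x' = h⁻¹ • x := by
  refine Quotient.eq.trans ?_
  exact exists_congr fun h => Prod.ext_iff

theorem mk_mul (g : G) (h : H) (x : X) : mk α (g * α h) x = mk α g (h • x) :=
  ((mk_eq_iff α).2 ⟨h, rfl, by simp⟩).symm

theorem exists_mk (p : Ind α X) : ∃ g x, mk α g x = p := by
  obtain ⟨⟨g, x⟩, h⟩ := Quotient.exists_rep p
  exact ⟨g, x, h⟩

/-- Maps out of `G ×_α X`. -/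
def lift {Z : Type*} (f : G → X → Z) (hf : ∀ g h x, f (g * α h) (h⁻¹ • x) = f g x) :
    Ind α X → Z :=
  Quotient.lift (fun p : G × X => f p.1 p.2) (by
    rintro p _ ⟨h, rfl⟩
    exact (hf p.1 h p.2).symm)

instance : MulAction G (Ind α X) where
  smul k := lift α (fun g x => mk α (k * g) x) (fun g h x => by
    rw [← mul_assoc, mk_mul, smul_inv_smul])
  one_smul p := by
    obtain ⟨g, x, rfl⟩ := exists_mk α p
    exact congrArg (mk α · x) (one_mul g)
  mul_smul k l p := by
    obtain ⟨g, x, rfl⟩ := exists_mk α p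
    exact congrArg (mk α · x) (mul_assoc k l g)

theorem smul_mk (k g : G) (x : X) : k • mk α g x = mk α (k * g) x := rfl

/-- The quotient topology of the product topology on `G × X`, where `G` is discrete. -/
instance [TopologicalSpace X] : TopologicalSpace (Ind α X) :=
  letI : TopologicalSpace G := ⊥
  inferInstanceAs (TopologicalSpace (Quotient (indSetoid α X)))

theorem isOpen_iff [TopologicalSpace X] (C : Set (Ind α X)) :
    IsOpen C ↔ ∀ g, IsOpen (mk α g ⁻¹' C) := by
  let _ : TopologicalSpace G := ⊥
  have : DiscreteTopology G := ⟨rfl⟩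
  refine (isOpen_coinduced (f := Quotient.mk (indSetoid α X)) (s := C)).trans ?_
  constructor
  · intro h g
    exact h.preimage (Continuous.prodMk_right g)
  · intro h
    have h' : ∀ (g : G) (x : X), mk α g x ∈ C →
        Quotient.mk (indSetoid α X) ⁻¹' C ∈ nhds (g, x) := by
      intro g x hx
      rw [nhds_prod_eq, nhds_discrete, Filter.pure_prod, Filter.mem_map]
      exact (h g).mem_nhds hx
    rw [isOpen_iff_mem_nhds]
    rintro ⟨g, x⟩ hx
    exact h' g x hx

theorem isClosed_iff [TopologicalSpace X] (C : Set (Ind α X)) :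
    IsClosed C ↔ ∀ g, IsClosed (mk α g ⁻¹' C) := by
  simp only [← isOpen_compl_iff, isOpen_iff α, Set.preimage_compl]

theorem continuous_mk [TopologicalSpace X] (g : G) : Continuous (mk α g : X → Ind α X) :=
  continuous_def.2 fun _ hC => (isOpen_iff α _).1 hC g

theorem continuous_of [TopologicalSpace X] {Z : Type*} [TopologicalSpace Z] {f : Ind α X → Z}
    (hf : ∀ g, Continuous (fun x => f (mk α g x))) : Continuous f :=
  continuous_def.2 fun _ hC => (isOpen_iff α _).2 fun g => hC.preimage (hf g)

/-- The induced map `α_* X → α_* Y`. -/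
def map {Y : Type u} [MulAction H Y] (f : X → Y) (hf : ∀ (h : H) x, f (h • x) = h • f x) :
    Ind α X → Ind α Y :=
  lift α (fun g x => mk α g (f x)) (fun g h x => by rw [mk_mul, hf, smul_inv_smul])

end Ind

/-- If `X` is an `H`-CW-complex with subcomplex `A`, then `α_* X` is a `G`-CW-complex with the
image of `G × A` as a subcomplex. -/
theorem exists_ind_structure (α : H →* G) {X : Type u} [TopologicalSpace X] [MulAction H X]
    (S : GCWStructure H X) (A : Set X) (hA : S.IsSubcomplex A) :
    ∃ T : GCWStructure G (Ind α X), T.IsSubcomplex {p | ∃ g, ∃ a ∈ A, Ind.mk α g a = p} := by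
  classical
  let mp : ∀ n, Ind α (S.cell n) → (Fin n → ℝ) → Ind α X := fun n e x =>
    if hx : x ∈ Metric.closedBall (0 : Fin n → ℝ) 1 then
      Ind.lift α (fun g e => Ind.mk α g (S.map n e x)) (fun g h e => by
        rw [S.map_smul n h⁻¹ e x hx, Ind.mk_mul, smul_inv_smul]) e
    else
      Ind.lift α (fun g e => Ind.mk α g (S.map n e 0)) (fun g h e => by
        rw [S.map_smul n h⁻¹ e 0 (by simp), Ind.mk_mul, smul_inv_smul]) e
  have mp_mk : ∀ n g (e : S.cell n) x, x ∈ Metric.closedBall (0 : Fin n → ℝ) 1 →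
      mp n (Ind.mk α g e) x = Ind.mk α g (S.map n e x) := by
    intro n g e x hx
    simp only [mp, dif_pos hx]
    rfl
  have hskel : ∀ g x n, (∃ m < n, ∃ e : Ind α (S.cell m),
      ∃ y ∈ Metric.closedBall (0 : Fin m → ℝ) 1, mp m e y = Ind.mk α g x) ↔ x ∈ S.skelLT n := by
    intro g x n
    constructor
    · rintro ⟨m, hm, e, y, hy, h⟩
      obtain ⟨g', e, rfl⟩ := Ind.exists_mk α e
      rw [mp_mk m g' e y hy] at h
      obtain ⟨k, -, rfl⟩ := (Ind.mk_eq_iff α).1 h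
      exact ⟨m, hm, k⁻¹ • e, y, hy, S.map_smul m _ e y hy⟩
    · rintro ⟨m, hm, e, y, hy, rfl⟩
      exact ⟨m, hm, Ind.mk α g e, y, hy, mp_mk m g e y hy⟩
  have hA' : ∀ g x, (∃ g', ∃ a ∈ A, Ind.mk α g' a = Ind.mk α g x) ↔ x ∈ A := by
    intro g x
    constructor
    · rintro ⟨g', a, ha, h⟩
      obtain ⟨k, -, rfl⟩ := (Ind.mk_eq_iff α).1 h
      exact hA.1 _ _ ha
    · intro hx
      exact ⟨g, x, hx, rfl⟩
  refine ⟨{ cell := fun n => Ind α (S.cell n)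
            map := mp
            continuousOn := ?_
            map_smul := ?_
            boundary := ?_
            bijective := ?_
            isClosed_of_subset := ?_
            isClosed_of_inter := ?_ }, ?_, ?_⟩
  · intro n e
    obtain ⟨g, e, rfl⟩ := Ind.exists_mk α e
    exact ((Ind.continuous_mk α g).comp_continuousOn (S.continuousOn n e)).congr
      (fun x hx => mp_mk n g e x hx)
  · intro n k e x hx
    obtain ⟨g, e, rfl⟩ := Ind.exists_mk α e
    rw [Ind.smul_mk, mp_mk _ _ _ _ hx, mp_mk _ _ _ _ hx, Ind.smul_mk]
  · intro n e x hx
    obtain ⟨g, e, rfl⟩ := Ind.exists_mk α e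
    rw [mp_mk _ _ _ _ (Metric.sphere_subset_closedBall hx)]
    exact (hskel g _ n).2 (S.boundary n e x hx)
  · constructor
    · rintro ⟨n, e, x⟩ ⟨m, e', y⟩ h
      obtain ⟨g, e, rfl⟩ := Ind.exists_mk α e
      obtain ⟨g', e', rfl⟩ := Ind.exists_mk α e'
      simp only at h
      have hx := Metric.ball_subset_closedBall x.2
      have hy := Metric.ball_subset_closedBall y.2
      rw [mp_mk _ _ _ _ hx, mp_mk _ _ _ _ hy] at h
      obtain ⟨k, hk, hk'⟩ := (Ind.mk_eq_iff α).1 h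
      rw [← S.map_smul n k⁻¹ e _ hx] at hk'
      have h2 := @S.bijective.1 ⟨m, e', y⟩ ⟨n, k⁻¹ • e, x⟩ hk'
      obtain rfl : m = n := congrArg Sigma.fst h2
      simp only [Sigma.mk.injEq, heq_eq_eq, Prod.mk.injEq, true_and] at h2 ⊢
      obtain ⟨rfl, rfl⟩ := h2
      exact ⟨(Ind.mk_eq_iff α).2 ⟨k, hk, rfl⟩, rfl⟩
    · intro p
      obtain ⟨g, x, rfl⟩ := Ind.exists_mk α p
      obtain ⟨⟨n, e, y⟩, rfl⟩ := S.bijective.2 x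
      exact ⟨⟨n, Ind.mk α g e, y⟩, mp_mk n g e y (Metric.ball_subset_closedBall y.2)⟩
  · intro n C hC h
    rw [Ind.isClosed_iff]
    intro g
    refine S.isClosed_of_subset n _ (fun x hx => (hskel g x n).1 (hC _ hx)) ?_
    intro m hm e
    have := h m hm (Ind.mk α g e)
    convert this using 1
    ext x
    simp only [Set.mem_inter_iff, Set.mem_preimage]
    refine and_congr_right fun hx => ?_
    rw [mp_mk m g e x hx]
  · intro C h
    rw [Ind.isClosed_iff]
    intro g
    refine S.isClosed_of_inter _ fun n => ?_
    have := (Ind.isClosed_iff α _).1 (h n) g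
    convert this using 1
    ext x
    simp only [Set.mem_inter_iff, Set.mem_preimage, Set.mem_ofPred_eq]
    exact and_congr_right fun _ => (hskel g x n).symm
  · rintro k _ ⟨g, a, ha, rfl⟩
    exact ⟨k * g, a, ha, rfl⟩
  · intro n e
    obtain ⟨g, e, rfl⟩ := Ind.exists_mk α e
    rcases hA.2 n e with he | he
    · left
      intro x hx
      change ∃ g', ∃ a ∈ A, Ind.mk α g' a = mp n (Ind.mk α g e) x
      rw [mp_mk n g e x hx]
      exact (hA' g _).2 (he x hx)
    · right
      intro x hx
      change ¬ ∃ g', ∃ a ∈ A, Ind.mk α g' a = mp n (Ind.mk α g e) x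
      rw [mp_mk n g e x (Metric.ball_subset_closedBall hx), hA' g]
      exact he x hx

/-- The `G`-CW-pair `α_*(X, A) = (α_* X, α_* A)`. -/
def indPair (α : H →* G) (P : GCWPair H) : GCWPair G where
  X :=
    { carrier := Ind α P.X.carrier
      cont := ⟨fun k => Ind.continuous_of α fun g => Ind.continuous_mk α (k * g)⟩
      exists_structure := by
        obtain ⟨S, hS⟩ := P.isSub
        exact ⟨(exists_ind_structure α S P.A hS).choose⟩ }
  A := {p | ∃ g, ∃ a ∈ P.A, Ind.mk α g a = p}
  isSub := by
    obtain ⟨S, hS⟩ := P.isSub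
    exact exists_ind_structure α S P.A hS

/-- The induction functor `α_*`. -/
def indFunctor (α : H →* G) : GCWPair.{u} H ⥤ GCWPair.{u} G where
  obj P := indPair α P
  map {P Q} f :=
    { toFun := Ind.map α f.toFun f.equivariant
      continuous := Ind.continuous_of α fun g => (Ind.continuous_mk α g).comp f.continuous
      equivariant := fun k p => by
        obtain ⟨g, x, rfl⟩ := Ind.exists_mk α p
        rfl
      mapsTo := by
        rintro _ ⟨g, a, ha, rfl⟩
        exact ⟨g, f.toFun a, f.mapsTo a ha, rfl⟩ }
  map_id P := by
    ext p
    obtain ⟨g, x, rfl⟩ := Ind.exists_mk α p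
    rfl
  map_comp f f' := by
    ext p
    obtain ⟨g, x, rfl⟩ := Ind.exists_mk α p
    rfl

/-- The canonical `G`-map from `α_* A` (the induction of the `H`-space `A`) to the subspace
`α_* A` of `α_* X`, `(g, a) ↦ (g, a)`. -/
def indSub (α : H →* G) (P : GCWPair H) :
    (indFunctor α).obj ((subFunctor H).obj P) ⟶ (subFunctor G).obj ((indFunctor α).obj P) where
  toFun := Ind.lift α (fun g (a : P.sub.carrier) =>
      (⟨Ind.mk α g (P.inclSub.toFun a), g, a.1, a.2, rfl⟩ : (indPair α P).sub.carrier))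
    (fun g h a => Subtype.ext (by
      have h1 : P.inclSub.toFun (h⁻¹ • a) = h⁻¹ • P.inclSub.toFun a :=
        P.inclSub.equivariant h⁻¹ a
      exact (congrArg (Ind.mk α (g * α h)) h1).trans
        ((Ind.mk_mul α g h _).trans (congrArg (Ind.mk α g) (smul_inv_smul h _)))))
  continuous := Ind.continuous_of α fun g =>
    ((Ind.continuous_mk α g).comp P.inclSub.continuous).subtype_mk _
  equivariant k p := by
    obtain ⟨g, x, rfl⟩ := Ind.exists_mk α p
    rfl
  mapsTo := by
    rintro _ ⟨_, _, h, _⟩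
    exact h.elim

/-- The natural map `f₁ : β_* α_* (X, A) → (β ∘ α)_* (X, A)`, `(k, g, x) ↦ (k β(g), x)`. -/
def indComp (α : H →* G) (β : G →* K) (P : GCWPair H) :
    (indFunctor β).obj ((indFunctor α).obj P) ⟶ (indFunctor (β.comp α)).obj P where
  toFun := Ind.lift β (fun k (p : Ind α P.X.carrier) =>
      Ind.lift α (fun g x => Ind.mk (β.comp α) (k * β g) x) (fun g h x => by
        rw [map_mul, ← mul_assoc]
        exact (Ind.mk_mul (β.comp α) _ h _).trans (by rw [smul_inv_smul])) p)
    (fun k g' p => by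
      obtain ⟨g, x, rfl⟩ := Ind.exists_mk α p
      change Ind.mk (β.comp α) (k * β g' * β (g'⁻¹ * g)) x = Ind.mk (β.comp α) (k * β g) x
      congr 1
      simp [mul_assoc])
  continuous := Ind.continuous_of β fun k => Ind.continuous_of α fun g =>
    Ind.continuous_mk (β.comp α) (k * β g)
  equivariant l p := by
    obtain ⟨k, q, rfl⟩ := Ind.exists_mk β p
    obtain ⟨g, x, rfl⟩ := Ind.exists_mk α q
    change Ind.mk (β.comp α) (l * k * β g) x = Ind.mk (β.comp α) (l * (k * β g)) x
    rw [mul_assoc]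
  mapsTo := by
    rintro _ ⟨k, _, ⟨g, a, ha, rfl⟩, rfl⟩
    exact ⟨k * β g, a, ha, rfl⟩

/-- The `G`-map `f₂ : (X, A) → c(g)_* (X, A)`, `x ↦ (1, g⁻¹ x)`, where `c(g)` is conjugation. -/
def indConj (g : G) (P : GCWPair G) :
    P ⟶ (indFunctor (MulAut.conj g).toMonoidHom).obj P where
  toFun x := Ind.mk (MulAut.conj g).toMonoidHom 1 (g⁻¹ • x)
  continuous := (Ind.continuous_mk _ 1).comp (continuous_const_smul g⁻¹)
  equivariant k x := by
    rw [← mul_smul]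
    refine (Ind.mk_eq_iff _).2 ⟨g⁻¹ * k * g, ?_, ?_⟩
    · simp [mul_assoc]
    · simp [mul_assoc, ← mul_smul]
  mapsTo x hx := by
    obtain ⟨S, hS⟩ := P.isSub
    exact ⟨1, g⁻¹ • x, hS.1 _ _ hx, rfl⟩

end Induction

/-! ### Equivariant homology theories over a group `Γ` -/

/-- An equivariant homology theory with values in `Λ`-modules over the group `Γ`. A group over `Γ`
is a group `G` with a homomorphism `ξ : G →* Γ`. -/
structure EquivariantHomologyTheory (Γ : Type u) [Group Γ] (Λ : Type v) [Ring Λ] where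
  /-- the `G`-homology theory assigned to `(G, ξ)` -/
  theory : ∀ {G : Type u} [Group G], (G →* Γ) → GHomologyTheory.{u, v, w} G Λ
  /-- the induction structure: natural homomorphisms `ind_α : ℋₙ^H(X, A) → ℋₙ^G(α_*(X, A))` -/
  ind : ∀ {H G : Type u} [Group H] [Group G] (ξ : H →* Γ) (μ : G →* Γ) (α : H →* G),
    μ.comp α = ξ → ∀ n, (theory ξ).H n ⟶ indFunctor α ⋙ (theory μ).H n
  ind_bdry : ∀ {H G : Type u} [Group H] [Group G] (ξ : H →* Γ) (μ : G →* Γ) (α : H →* G)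
    (h : μ.comp α = ξ) n (P : GCWPair.{u} H),
    (ind ξ μ α h n).app P ≫ ((theory μ).bdry n).app ((indFunctor α).obj P) =
      ((theory ξ).bdry n).app P ≫ (ind ξ μ α h (n - 1)).app ((subFunctor H).obj P) ≫
        ((theory μ).H (n - 1)).map (indSub α P)
  ind_comp : ∀ {H G K : Type u} [Group H] [Group G] [Group K]
    (ξ : H →* Γ) (μ : G →* Γ) (ν : K →* Γ) (α : H →* G) (β : G →* K)
    (hα : μ.comp α = ξ) (hβ : ν.comp β = μ) (hβα : ν.comp (β.comp α) = ξ) n (P : GCWPair.{u} H),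
    (ind ξ ν (β.comp α) hβα n).app P =
      (ind ξ μ α hα n).app P ≫ (ind μ ν β hβ n).app ((indFunctor α).obj P) ≫
        ((theory ν).H n).map (indComp α β P)
  ind_conj : ∀ {G : Type u} [Group G] (ξ : G →* Γ) (g : G), ξ g = 1 →
    ∀ (h : ξ.comp (MulAut.conj g).toMonoidHom = ξ) n (P : GCWPair.{u} G),
    (ind ξ ξ (MulAut.conj g).toMonoidHom h n).app P = ((theory ξ).H n).map (indConj g P)
  ind_bijective : ∀ {H G : Type u} [Group H] [Group G] (ξ : H →* Γ) (μ : G →* Γ) (α : H →* G)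
    (h : μ.comp α = ξ), Function.Injective α →
    ∀ n, Function.Bijective ((ind ξ μ α h n).app (point H)).hom

/-! ### Continuity -/

section Continuity

variable {Γ : Type u} [Group Γ] {Λ : Type v} [Ring Λ]

theorem indPoint_A {H G : Type u} [Group H] [Group G] (α : H →* G) :
    ((indFunctor α).obj (point H)).A = ∅ := by
  ext p
  simp only [Set.mem_empty_iff_false, iff_false]
  rintro ⟨_, _, h, _⟩
  exact h.elim

namespace EquivariantHomologyTheory

/-- The map `aₙ({•}, α) : ℋₙ^H({•}) → ℋₙ^G(α_*{•}) → ℋₙ^G({•})`, the composite of `ind_α` and the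
map induced by the projection `α_* {•} → {•}`. -/
def a (ℋ : EquivariantHomologyTheory.{u, v, w} Γ Λ) {H G : Type u} [Group H] [Group G]
    (ξ : H →* Γ) (μ : G →* Γ) (α : H →* G) (h : μ.comp α = ξ) (n : ℤ) :
    ((ℋ.theory ξ).H n).obj (point H) ⟶ ((ℋ.theory μ).H n).obj (point G) :=
  (ℋ.ind ξ μ α h n).app (point H) ≫
    ((ℋ.theory μ).H n).map (toPoint ((indFunctor α).obj (point H)) (indPoint_A α))

theorem a_comp (ℋ : EquivariantHomologyTheory.{u, v, w} Γ Λ) {H G K : Type u}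
    [Group H] [Group G] [Group K] (ξ : H →* Γ) (μ : G →* Γ) (ν : K →* Γ) (α : H →* G) (β : G →* K)
    (hα : μ.comp α = ξ) (hβ : ν.comp β = μ) (hβα : ν.comp (β.comp α) = ξ) (n : ℤ) :
    ℋ.a ξ μ α hα n ≫ ℋ.a μ ν β hβ n = ℋ.a ξ ν (β.comp α) hβα n := by
  simp only [a, Category.assoc]
  rw [ℋ.ind_comp ξ μ ν α β hα hβ hβα]
  have := (ℋ.ind μ ν β hβ n).naturality
    (toPoint ((indFunctor α).obj (point H)) (indPoint_A α))
  simp only [Functor.comp_map] at this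
  rw [reassoc_of% this]
  simp only [Category.assoc, ← Functor.map_comp]
  rfl

/-- For a directed system of groups `(Gᵢ, φᵢⱼ)` with compatible homomorphisms `ψᵢ : Gᵢ → G` and
`ξ : G → Γ`, the map `tₙ^G({•}) : colimᵢ ℋₙ^{Gᵢ}({•}) → ℋₙ^G({•})`, where `Gᵢ` is a group over `Γ`
by `ξ ∘ ψᵢ`. -/
noncomputable def t (ℋ : EquivariantHomologyTheory.{u, v, w} Γ Λ) {G : Type u} [Group G]
    (ξ : G →* Γ) {I : Type u} [Preorder I] [DecidableEq I] {Gi : I → Type u} [∀ i, Group (Gi i)]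
    (φ : ∀ i j, i ≤ j → Gi i →* Gi j) (ψ : ∀ i, Gi i →* G)
    (hψ : ∀ i j (hij : i ≤ j), (ψ j).comp (φ i j hij) = ψ i) (n : ℤ) :
    Module.DirectLimit
      (fun i => ((ℋ.theory (ξ.comp (ψ i))).H n).obj (point (Gi i)))
      (fun i j hij => (ℋ.a (ξ.comp (ψ i)) (ξ.comp (ψ j)) (φ i j hij)
        (by rw [MonoidHom.comp_assoc, hψ i j hij]) n).hom) →ₗ[Λ]
    ((ℋ.theory ξ).H n).obj (point G) :=
  Module.DirectLimit.lift Λ I _ _ (fun i => (ℋ.a (ξ.comp (ψ i)) ξ (ψ i) rfl n).hom) (by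
    intro i j hij x
    have h := ℋ.a_comp (ξ.comp (ψ i)) (ξ.comp (ψ j)) ξ (φ i j hij) (ψ j)
      (by rw [MonoidHom.comp_assoc, hψ i j hij]) rfl (by rw [hψ i j hij]) n
    have h2 : ℋ.a (ξ.comp (ψ i)) ξ ((ψ j).comp (φ i j hij)) (by rw [hψ i j hij]) n =
        ℋ.a (ξ.comp (ψ i)) ξ (ψ i) rfl n := by
      congr 1
      exact hψ i j hij
    rw [h2] at h
    exact congrArg (fun f => f.hom x) h)

end EquivariantHomologyTheory

/-- `(Gᵢ, φᵢⱼ)` is a directed system of groups and `G`, with the structure maps `ψᵢ : Gᵢ → G`, is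
its colimit in the category of groups. -/
structure IsGroupColimit {I : Type u} [Preorder I] {Gi : I → Type u} [∀ i, Group (Gi i)]
    (φ : ∀ i j, i ≤ j → Gi i →* Gi j) {G : Type u} [Group G] (ψ : ∀ i, Gi i →* G) : Prop where
  map_id : ∀ i, φ i i le_rfl = MonoidHom.id (Gi i)
  map_comp : ∀ i j k (hij : i ≤ j) (hjk : j ≤ k),
    (φ j k hjk).comp (φ i j hij) = φ i k (hij.trans hjk)
  compatible : ∀ i j (hij : i ≤ j), (ψ j).comp (φ i j hij) = ψ i
  universal : ∀ (K : Type u) [Group K] (f : ∀ i, Gi i →* K),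
    (∀ i j (hij : i ≤ j), (f j).comp (φ i j hij) = f i) →
    ∃! F : G →* K, ∀ i, F.comp (ψ i) = f i

/-- `G` is the directed union of the subgroups `Sᵢ`, `i ∈ I`. -/
structure IsDirectedUnion {I : Type u} [Preorder I] {G : Type u} [Group G] (S : I → Subgroup G) :
    Prop where
  mono : Monotone S
  exists_mem : ∀ g : G, ∃ i, g ∈ S i

/-- A continuous equivariant homology theory. -/
def EquivariantHomologyTheory.IsContinuous (ℋ : EquivariantHomologyTheory.{u, v, w} Γ Λ) : Prop :=
  ∀ {G : Type u} [Group G] (ξ : G →* Γ) {I : Type u} [Preorder I] [IsDirectedOrder I] [Nonempty I]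
    [DecidableEq I] (S : I → Subgroup G) (hS : IsDirectedUnion S) (n : ℤ),
    Function.Bijective (ℋ.t ξ (fun _ _ hij => Subgroup.inclusion (hS.mono hij))
      (fun i => (S i).subtype) (fun _ _ _ => rfl) n)

/-- A strongly continuous equivariant homology theory. -/
def EquivariantHomologyTheory.IsStronglyContinuous
    (ℋ : EquivariantHomologyTheory.{u, v, w} Γ Λ) : Prop :=
  ∀ {G : Type u} [Group G] (ξ : G →* Γ) {I : Type u} [Preorder I] [IsDirectedOrder I] [Nonempty I]
    [DecidableEq I] {Gi : I → Type u} [∀ i, Group (Gi i)] (φ : ∀ i j, i ≤ j → Gi i →* Gi j)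
    (ψ : ∀ i, Gi i →* G) (hψ : IsGroupColimit φ ψ) (n : ℤ),
    Function.Bijective (ℋ.t ξ φ ψ hψ.compatible n)

end Continuity

/-! ### Families of subgroups and the Isomorphism Conjectures -/

/-- A family of subgroups of `G`: a set of subgroups closed under conjugation and taking
subgroups. -/
structure SubgroupFamily (G : Type u) [Group G] where
  carrier : Set (Subgroup G)
  conj_mem : ∀ H ∈ carrier, ∀ g : G, H.map (MulAut.conj g).toMonoidHom ∈ carrier
  mem_of_le : ∀ H ∈ carrier, ∀ L ≤ H, L ∈ carrier

/-- The family `φ^* ℱ = {H ≤ K | φ(H) ∈ ℱ}`. -/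
def SubgroupFamily.pullback {K G : Type u} [Group K] [Group G] (φ : K →* G)
    (ℱ : SubgroupFamily G) : SubgroupFamily K where
  carrier := {H | H.map φ ∈ ℱ.carrier}
  conj_mem H hH g := by
    have := ℱ.conj_mem _ hH (φ g)
    simp only [Set.mem_ofPred_eq, Subgroup.map_map] at this ⊢
    convert this using 2
    ext x
    simp
  mem_of_le H hH L hL := ℱ.mem_of_le _ hH _ (Subgroup.map_mono hL)

/-- `E` is a classifying space `E_ℱ(G)`: the fixed point set `E^H` is contractible for `H ∈ ℱ` and
empty for `H ∉ ℱ`. -/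
def IsClassifyingSpace {G : Type u} [Group G] (ℱ : SubgroupFamily G) (E : GCWComplex G) : Prop :=
  ∀ H : Subgroup G,
    (H ∈ ℱ.carrier → ContractibleSpace (MulAction.fixedPoints H E.carrier)) ∧
    (H ∉ ℱ.carrier → MulAction.fixedPoints H E.carrier = ∅)

section Conjectures

variable {Γ : Type u} [Group Γ] {Λ : Type v} [Ring Λ]

/-- The Isomorphism Conjecture for `(G, ξ)` and the family `ℱ`: the projection `E_ℱ(G) → {•}`
induces isomorphisms on `ℋₙ^G` for all `n`. The classifying space `E_ℱ(G)` exists and is unique up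
to `G`-homotopy, and the condition is imposed for all models. -/
def EquivariantHomologyTheory.IsomorphismConjecture
    (ℋ : EquivariantHomologyTheory.{u, v, w} Γ Λ) {G : Type u} [Group G] (ξ : G →* Γ)
    (ℱ : SubgroupFamily G) : Prop :=
  ∀ E : GCWComplex G, IsClassifyingSpace ℱ E →
    ∀ n : ℤ, Function.Bijective (((ℋ.theory ξ).H n).map E.pr).hom

/-- The Fibered Isomorphism Conjecture for `(G, ξ)` and the family `ℱ`. -/
def EquivariantHomologyTheory.FiberedIsomorphismConjecture
    (ℋ : EquivariantHomologyTheory.{u, v, w} Γ Λ) {G : Type u} [Group G] (ξ : G →* Γ)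
    (ℱ : SubgroupFamily G) : Prop :=
  ∀ {K : Type u} [Group K] (φ : K →* G), ℋ.IsomorphismConjecture (ξ.comp φ) (ℱ.pullback φ)

end Conjectures

/-- A class of groups closed under isomorphisms, taking subgroups and taking quotients. -/
structure GroupClass where
  mem : ∀ (G : Type u) [Group G], Prop
  of_equiv : ∀ {G K : Type u} [Group G] [Group K], G ≃* K → mem G → mem K
  subgroup : ∀ {G : Type u} [Group G] (H : Subgroup G), mem G → mem H
  quotient : ∀ {G : Type u} [Group G] (N : Subgroup G) [N.Normal], mem G → mem (G ⧸ N)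

/-- The family `𝒞(G)` of subgroups of `G` which belong to `𝒞`. -/
def GroupClass.family (𝒞 : GroupClass.{u}) (G : Type u) [Group G] : SubgroupFamily G where
  carrier := {H | 𝒞.mem H}
  conj_mem H hH g := 𝒞.of_equiv (H.equivMapOfInjective _ (MulAut.conj g).injective) hH
  mem_of_le _ hH _ hL := 𝒞.of_equiv (Subgroup.subgroupOfEquivOfLe hL) (𝒞.subgroup _ hH)

end EquivHomology

/-!
A homomorphism `K → G` into a colimit `G = colim Gᵢ` exhibits `K` as the colimit of the pullbacks
`Kᵢ = K ×_G Gᵢ` (`IsConcreteColimit.pullback`), and pullbacks of families along `K → G` and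
`Kᵢ → K` are compatible. The fibered conjecture for `G` thus reduces to the unfibered one: if it holds
for all `Gᵢ` and the families pulled back from `G`, then it holds for `G`
(`EquivariantHomologyTheory.isomorphismConjecture_of_colimit`).

The reason is that homology commutes with the colimit: for each `G`-CW-complex `X`, the canonical map
`colim ℋ^{Gᵢ}(res X) → ℋ^G(X)` is bijective (`EquivariantHomologyTheory.good_resSystem`). Applied to
`E_ℱ(G)`, whose restriction to `Gᵢ` is a classifying space of the pulled back family
(`IsClassifyingSpace.res`), and to the point, this presents `ℋ^G(E_ℱ(G)) → ℋ^G({•})` as a colimit of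
isomorphisms. On an orbit `G / L` the claim is the continuity of the theory for `L`, the colimit of
the preimages of `L` in the `Gᵢ` (`EquivariantHomologyTheory.good_resSystem_orbit`); here a single
orbit may restrict to many `Gᵢ`-orbits, which are merged at later stages. Both sides are homology
theories in `X`, so the claim passes from orbits to all complexes. This cellular induction is
axiomatized as a `CellularClass`, a class of pairs closed under what the axioms of a homology theory
respect (`TheorySystem.cellularClass_good`): the five lemma and excision give finite-dimensional
complexes, and an arbitrary complex is a homotopy retract of the telescope of its skeleta, which a
Mayer–Vietoris argument cuts into disjoint unions of finite-dimensional pieces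
(`CellularClass.toPair`). The excision axiom concerns cellular attaching maps; collapsing
subcomplexes extends it to relative homeomorphisms (`GHomologyTheory.toHomologyTheory`), which is the
form in which excision pulls back along restriction, induction and products (`GoodFunctor`).

One point is left. The hypothesis on `Gᵢ` concerns `𝒞(Gᵢ)`, whereas the family pulled back from `𝒞(G)`
may be larger; it contains `𝒞(Gᵢ)` as `𝒞` is closed under quotients (`GroupClass.map_mem`). The
conjecture passes to larger families if it holds on all subgroups
(`EquivariantHomologyTheory.IsomorphismConjecture.of_le`): for `ℱ ⊆ 𝒢`, the product
`E_ℱ(K) × E_𝒢(K)` is again a classifying space for `ℱ`, and its projection to `E_𝒢(K)` is a homology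
isomorphism, because on an orbit `K / L` it is induced from the projection `res_L E_ℱ(K) → {•}`. A
model of `E_ℱ(K)` is the infinite join of the orbits `K / L`, `L ∈ ℱ` (`InfJoin`), whose open cells
are cubes so that products of cells are cells again.

The continuous and the strongly continuous case differ only in which colimits the homology of the
point commutes with (`EquivariantHomologyTheory.isColimit_pointSys`); injectivity of the maps `Gᵢ → G`
is inherited by all systems derived from them.
-/

namespace EquivHomology

open Set Metric Topology

/-! ### Cells, skeleta and the weak topology of a `G`-CW-complex -/

/-- The closed unit ball of `Fin n → ℝ` for the sup norm, the domain of the characteristic maps. -/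
abbrev disc (n : ℕ) : Set (Fin n → ℝ) := closedBall 0 1

theorem mem_disc {n : ℕ} {y : Fin n → ℝ} : y ∈ disc n ↔ ∀ i, |y i| ≤ 1 := by
  rw [mem_closedBall_zero_iff, pi_norm_le_iff_of_nonneg zero_le_one]
  rfl

theorem mem_openDisc {n : ℕ} {y : Fin n → ℝ} : y ∈ ball (0 : Fin n → ℝ) 1 ↔ ∀ i, |y i| < 1 := by
  rw [mem_ball_zero_iff, pi_norm_lt_iff zero_lt_one]
  rfl

theorem mem_sphere_of_disc {n : ℕ} {y : Fin n → ℝ} (hy : y ∈ disc n)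
    (hy' : y ∉ ball (0 : Fin n → ℝ) 1) : y ∈ sphere (0 : Fin n → ℝ) 1 :=
  le_antisymm (mem_closedBall.1 hy) (not_lt.1 fun hb => hy' (mem_ball.2 hb))

theorem isClosed_disc_inter {X : Type*} {n : ℕ} {f : (Fin n → ℝ) → X} {C : Set X} :
    IsClosed (disc n ∩ f ⁻¹' C) ↔ IsClosed {y : disc n | f y ∈ C} := by
  rw [isClosed_closedBall.isClosedEmbedding_subtypeVal.isClosed_iff_image_isClosed]
  apply iff_of_eq
  congr 1
  ext y
  simp [and_comm]

namespace GCWStructure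

variable {G X : Type u} [Group G] [TopologicalSpace X] [MulAction G X] (S : GCWStructure G X)

theorem continuous_map (n : ℕ) (e : S.cell n) : Continuous fun y : disc n => S.map n e y :=
  continuousOn_iff_continuous_domRestrict.1 (S.continuousOn n e)

variable {S}

theorem map_mem_skelLT {m n : ℕ} (h : m < n) (e : S.cell m) {y : Fin m → ℝ} (hy : y ∈ disc m) :
    S.map m e y ∈ S.skelLT n :=
  ⟨m, h, e, y, hy, rfl⟩

theorem skelLT_mono {m n : ℕ} (h : m ≤ n) : S.skelLT m ⊆ S.skelLT n := by
  rintro _ ⟨k, hk, r⟩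
  exact ⟨k, hk.trans_le h, r⟩

theorem exists_openCell_of_mem_skelLT {n : ℕ} {c : X} (hc : c ∈ S.skelLT n) :
    ∃ m < n, ∃ e : S.cell m, ∃ y ∈ ball (0 : Fin m → ℝ) 1, S.map m e y = c := by
  induction n using Nat.strong_induction_on with
  | _ n ih =>
    obtain ⟨m, hm, e, y, hy, rfl⟩ := hc
    by_cases hy' : y ∈ ball (0 : Fin m → ℝ) 1
    · exact ⟨m, hm, e, y, hy', rfl⟩
    · obtain ⟨k, hk, r⟩ := ih m hm (S.boundary m e y (mem_sphere_of_disc hy hy'))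
      exact ⟨k, hk.trans hm, r⟩

variable (S) in
theorem exists_openCell (c : X) :
    ∃ m, ∃ e : S.cell m, ∃ y ∈ ball (0 : Fin m → ℝ) 1, S.map m e y = c := by
  obtain ⟨⟨m, e, y⟩, h⟩ := S.bijective.2 c
  exact ⟨m, e, y, y.2, h⟩

theorem openCell_unique {m m' : ℕ} {e : S.cell m} {e' : S.cell m'} {y : Fin m → ℝ}
    {y' : Fin m' → ℝ} (hy : y ∈ ball (0 : Fin m → ℝ) 1) (hy' : y' ∈ ball (0 : Fin m' → ℝ) 1)
    (h : S.map m e y = S.map m' e' y') :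
    (⟨m, e, y⟩ : Σ n, S.cell n × (Fin n → ℝ)) = ⟨m', e', y'⟩ := by
  have h2 := @S.bijective.1 ⟨m, e, ⟨y, hy⟩⟩ ⟨m', e', ⟨y', hy'⟩⟩ h
  obtain rfl : m = m' := congrArg Sigma.fst h2
  simp only [Sigma.mk.injEq, heq_eq_eq, Prod.mk.injEq, true_and, Subtype.mk.injEq] at h2 ⊢
  exact h2

theorem openCell_unique' {m : ℕ} {e e' : S.cell m} {y y' : Fin m → ℝ}
    (hy : y ∈ ball (0 : Fin m → ℝ) 1) (hy' : y' ∈ ball (0 : Fin m → ℝ) 1)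
    (h : S.map m e y = S.map m e' y') : e = e' ∧ y = y' := by
  simpa using openCell_unique hy hy' h

theorem lt_of_map_mem_skelLT {m n : ℕ} {e : S.cell m} {y : Fin m → ℝ}
    (hy : y ∈ ball (0 : Fin m → ℝ) 1) (h : S.map m e y ∈ S.skelLT n) : m < n := by
  obtain ⟨k, hk, e', y', hy', h'⟩ := exists_openCell_of_mem_skelLT h
  have : k = m := congrArg Sigma.fst (openCell_unique hy' hy h')
  omega

theorem map_sphere_mem_skelLT {n : ℕ} {e : S.cell n} {y : Fin n → ℝ}
    (hy : y ∈ sphere (0 : Fin n → ℝ) 1) : S.map n e y ∈ S.skelLT n :=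
  S.boundary n e y hy

variable (S) in
theorem exists_mem_skelLT (c : X) : ∃ n, c ∈ S.skelLT n := by
  obtain ⟨m, e, y, hy, rfl⟩ := S.exists_openCell c
  exact ⟨m + 1, map_mem_skelLT (Nat.lt_succ_self m) e (ball_subset_closedBall hy)⟩

theorem smul_mem_skelLT {n : ℕ} (g : G) {c : X} (hc : c ∈ S.skelLT n) : g • c ∈ S.skelLT n := by
  obtain ⟨m, hm, e, y, hy, rfl⟩ := hc
  exact ⟨m, hm, g • e, y, hy, S.map_smul m g e y hy⟩

variable (S) in
theorem isClosed_skelLT (n : ℕ) : IsClosed (S.skelLT n) := by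
  refine S.isClosed_of_subset n _ (fun c hc => hc) fun m hm e => ?_
  have : disc m ∩ S.map m e ⁻¹' S.skelLT n = disc m :=
    inter_eq_left.2 fun y hy => map_mem_skelLT hm e hy
  exact this ▸ isClosed_closedBall

variable (S) in
theorem isClosed_iff {C : Set X} :
    IsClosed C ↔ ∀ n e, IsClosed {y : disc n | S.map n e y ∈ C} := by
  refine ⟨fun h n e => h.preimage (S.continuous_map n e), fun h => ?_⟩
  refine S.isClosed_of_inter C fun n => S.isClosed_of_subset n _ (fun c hc => hc.2) ?_
  intro m hm e
  rw [isClosed_disc_inter]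
  convert h m e using 1
  ext y
  exact and_iff_left (map_mem_skelLT hm e y.2)

/-- A subset of a skeleton is closed as soon as its preimages in the cells of that skeleton are. -/
theorem isClosed_of_subset_skelLT {n : ℕ} {C : Set X} (hC : C ⊆ S.skelLT n)
    (h : ∀ m < n, ∀ e, IsClosed {y : disc m | S.map m e y ∈ C}) : IsClosed C :=
  S.isClosed_of_subset n C hC fun m hm e => isClosed_disc_inter.2 (h m hm e)

variable (S) in
theorem isQuotientMap_cells :
    IsQuotientMap (fun p : Σ n, Σ _ : S.cell n, disc n => S.map p.1 p.2.1 p.2.2) := by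
  refine isQuotientMap_iff_isClosed.2 ⟨fun c => ?_, fun C => ?_⟩
  · obtain ⟨m, e, y, hy, rfl⟩ := S.exists_openCell c
    exact ⟨⟨m, e, y, ball_subset_closedBall hy⟩, rfl⟩
  · rw [S.isClosed_iff, isClosed_sigma_iff]
    refine forall_congr' fun n => ?_
    rw [isClosed_sigma_iff]
    rfl

variable (S) in
theorem isQuotientMap_cells_skelLT (n : ℕ) :
    IsQuotientMap (fun p : Σ m : Fin n, Σ _ : S.cell m, disc m =>
      (⟨S.map p.1 p.2.1 p.2.2, map_mem_skelLT p.1.2 p.2.1 p.2.2.2⟩ : S.skelLT n)) := by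
  refine isQuotientMap_iff_isClosed.2 ⟨fun c => ?_, fun C => ?_⟩
  · obtain ⟨_, m, hm, e, y, hy, rfl⟩ := c
    exact ⟨⟨⟨m, hm⟩, e, y, hy⟩, rfl⟩
  · rw [(S.isClosed_skelLT n).isClosedEmbedding_subtypeVal.isClosed_iff_image_isClosed,
      isClosed_sigma_iff]
    have key : ∀ m (hm : m < n) (e : S.cell m), {y : disc m | S.map m e y ∈ Subtype.val '' C} =
        {y : disc m | (⟨S.map m e y, map_mem_skelLT hm e y.2⟩ : S.skelLT n) ∈ C} := by
      intro m hm e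
      ext y
      simp [map_mem_skelLT hm e y.2]
    constructor
    · intro h m
      refine isClosed_sigma_iff.2 fun e => ?_
      have := S.isClosed_iff.1 h m e
      rwa [key m m.2 e] at this
    · intro h
      refine isClosed_of_subset_skelLT (n := n) (by rintro _ ⟨c, -, rfl⟩; exact c.2) ?_
      intro m hm e
      rw [key m hm e]
      exact isClosed_sigma_iff.1 (h ⟨m, hm⟩) e

end GCWStructure

/-- Continuity on `(Σ i, Y i) × Z` may be checked on the summands. -/
theorem continuous_sigma_prod {ι : Type*} {Y : ι → Type*} [∀ i, TopologicalSpace (Y i)]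
    {Z W : Type*} [TopologicalSpace Z] [TopologicalSpace W] {f : (Σ i, Y i) × Z → W}
    (hf : ∀ i, Continuous fun p : Y i × Z => f (⟨i, p.1⟩, p.2)) : Continuous f := by
  refine continuous_iff_continuousAt.2 ?_
  rintro ⟨⟨i, y⟩, z⟩
  have : IsOpenEmbedding (Prod.map (Sigma.mk i) id : Y i × Z → (Σ i, Y i) × Z) :=
    IsOpenEmbedding.sigmaMk.prodMap .id
  exact (this.continuousAt_iff (x := (y, z))).1 (hf i).continuousAt

theorem isClosed_iff_continuous_notMem {X : Type*} [TopologicalSpace X] {C : Set X} :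
    IsClosed C ↔ Continuous fun x => x ∉ C := by
  rw [← isOpen_compl_iff, continuous_Prop]
  rfl

namespace GCWStructure

variable {G X : Type u} [Group G] [TopologicalSpace X] [MulAction G X] {S : GCWStructure G X}
  {Z W : Type*} [TopologicalSpace Z] [LocallyCompactSpace Z] [TopologicalSpace W]

variable (S) in
/-- The product of a CW-complex with a locally compact space carries the weak topology. -/
theorem continuous_prod {f : X × Z → W}
    (h : ∀ n e, Continuous fun p : disc n × Z => f (S.map n e p.1, p.2)) : Continuous f :=
  S.isQuotientMap_cells.continuous_lift_prod_left
    (continuous_sigma_prod fun n => continuous_sigma_prod fun e => h n e)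

theorem continuous_skelLT_prod {n : ℕ} {f : X × Z → W}
    (h : ∀ m < n, ∀ e, Continuous fun p : disc m × Z => f (S.map m e p.1, p.2)) :
    Continuous fun p : S.skelLT n × Z => f (p.1, p.2) :=
  (S.isQuotientMap_cells_skelLT n).continuous_lift_prod_left
    (continuous_sigma_prod fun m => continuous_sigma_prod fun e => h m m.2 e)

theorem isClosed_prod {C : Set (X × Z)}
    (h : ∀ n e, IsClosed {p : disc n × Z | (S.map n e p.1, p.2) ∈ C}) : IsClosed C :=
  isClosed_iff_continuous_notMem.2
    (S.continuous_prod fun n e => isClosed_iff_continuous_notMem.1 (h n e))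

theorem isClosed_prod_of_subset {n : ℕ} {C : Set (X × Z)} (hC : ∀ p ∈ C, p.1 ∈ S.skelLT n)
    (h : ∀ m < n, ∀ e, IsClosed {p : disc m × Z | (S.map m e p.1, p.2) ∈ C}) : IsClosed C := by
  have h1 : IsClosed {p : S.skelLT n × Z | ((p.1 : X), p.2) ∈ C} :=
    isClosed_iff_continuous_notMem.2 (continuous_skelLT_prod (f := fun p : X × Z => p ∉ C)
      fun m hm e => isClosed_iff_continuous_notMem.1 (h m hm e))
  have h2 : IsClosedEmbedding (Prod.map Subtype.val id : S.skelLT n × Z → X × Z) :=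
    (S.isClosed_skelLT n).isClosedEmbedding_subtypeVal.prodMap .id
  convert h2.isClosedMap _ h1 using 1
  ext ⟨x, z⟩
  constructor
  · intro hx
    exact ⟨(⟨x, hC _ hx⟩, z), hx, rfl⟩
  · rintro ⟨⟨x', z'⟩, hx, h⟩
    obtain ⟨rfl, rfl⟩ := Prod.ext_iff.1 h
    exact hx

/-! ### Subcomplexes -/

theorem IsSubcomplex.map_mem {A : Set X} (hA : S.IsSubcomplex A) {n : ℕ} {e : S.cell n}
    {x : Fin n → ℝ} (hx : x ∈ ball (0 : Fin n → ℝ) 1) (hxA : S.map n e x ∈ A)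
    {y : Fin n → ℝ} (hy : y ∈ disc n) : S.map n e y ∈ A := by
  rcases hA.2 n e with h | h
  · exact h y hy
  · exact (h x hx hxA).elim

theorem IsSubcomplex.isClosed_of_subset_skelLT_of_cells {A : Set X} (hA : S.IsSubcomplex A) {n : ℕ}
    {C : Set X} (hCA : C ⊆ A) (hC : C ⊆ S.skelLT n)
    (h : ∀ m < n, ∀ e : S.cell m, (∀ y ∈ disc m, S.map m e y ∈ A) →
      IsClosed {y : disc m | S.map m e y ∈ C}) : IsClosed C := by
  induction n generalizing C with
  | zero =>
    refine isClosed_of_subset_skelLT hC ?_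
    intro m hm
    omega
  | succ n ih =>
    have h1 : IsClosed (C ∩ S.skelLT n) := by
      refine ih (inter_subset_left.trans hCA) inter_subset_right ?_
      intro m hm e he
      convert h m (by omega) e he using 1
      ext y
      exact and_iff_left (map_mem_skelLT hm e y.2)
    refine isClosed_of_subset_skelLT hC ?_
    intro m hm e
    rcases hA.2 m e with he | he
    · exact h m hm e he
    · convert h1.preimage (S.continuous_map m e) using 1
      ext y
      refine (and_iff_left_of_imp fun hy => ?_).symm
      have hy' : (y : Fin m → ℝ) ∈ sphere (0 : Fin m → ℝ) 1 :=
        mem_sphere_of_disc y.2 fun hb => he _ hb (hCA hy)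
      exact skelLT_mono (Nat.lt_succ_iff.1 hm) (map_sphere_mem_skelLT hy')

theorem IsSubcomplex.isClosed_of_subset {A : Set X} (hA : S.IsSubcomplex A) {C : Set X}
    (hCA : C ⊆ A) (h : ∀ m, ∀ e : S.cell m, (∀ y ∈ disc m, S.map m e y ∈ A) →
      IsClosed {y : disc m | S.map m e y ∈ C}) : IsClosed C := by
  refine S.isClosed_of_inter C fun n => ?_
  refine hA.isClosed_of_subset_skelLT_of_cells (n := n) (inter_subset_left.trans hCA) inter_subset_right ?_
  intro m hm e he
  convert h m e he using 1
  ext y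
  exact and_iff_left (map_mem_skelLT hm e y.2)

theorem IsSubcomplex.isClosed {A : Set X} (hA : S.IsSubcomplex A) : IsClosed A :=
  hA.isClosed_of_subset Subset.rfl fun m e he => by simp [he]

/-- The skeleta are subcomplexes. -/
theorem isSubcomplex_skelLT (S : GCWStructure G X) (n : ℕ) : S.IsSubcomplex (S.skelLT n) := by
  refine ⟨fun g a ha => smul_mem_skelLT g ha, fun m e => ?_⟩
  by_cases hm : m < n
  · exact Or.inl fun x hx => map_mem_skelLT hm e hx
  · exact Or.inr fun x hx h => hm (lt_of_map_mem_skelLT hx h)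

end GCWStructure

theorem GCWPair.isClosed_A {G : Type u} [Group G] (P : GCWPair G) : IsClosed P.A :=
  let ⟨_, h⟩ := P.isSub
  h.isClosed

/-! ### Isomorphisms of pairs, subcomplexes as complexes -/

section Pairs

variable {G : Type u} [Group G]

theorem GCWPair.smul_mem_A (P : GCWPair G) (g : G) {x : P.X.carrier} : g • x ∈ P.A ↔ x ∈ P.A := by
  obtain ⟨S, hS⟩ := P.isSub
  refine ⟨fun h => ?_, hS.1 g x⟩
  simpa using hS.1 g⁻¹ _ h

/-- A homeomorphism of pairs is an isomorphism. -/
theorem GCWPair.isIso_of_isHomeomorph {P Q : GCWPair G} (f : P ⟶ Q) (hf : IsHomeomorph f.toFun)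
    (hA : ∀ x, f.toFun x ∈ Q.A → x ∈ P.A) : IsIso f := by
  let e := hf.homeomorph
  have he : ∀ y, f.toFun (e.symm y) = y := e.apply_symm_apply
  refine ⟨⟨⟨e.symm, e.symm.continuous, fun g y => ?_, fun y hy => hA _ ?_⟩, ?_, ?_⟩⟩
  · exact hf.injective (by rw [he, f.equivariant, he])
  · rwa [he]
  · ext x
    exact e.symm_apply_apply x
  · ext y
    exact he y

/-- A map to `X` with values in `A`, as a map to the complex `A`. -/
def GCWPair.liftSub {R P : GCWPair G} (f : R ⟶ P) (hR : R.A = ∅) (hf : ∀ x, f.toFun x ∈ P.A) :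
    R ⟶ P.sub.toPair where
  toFun x := ⟨f.toFun x, hf x⟩
  continuous := f.continuous.subtype_mk _
  equivariant g x := Subtype.ext (f.equivariant g x)
  mapsTo x hx := by rw [hR] at hx; exact hx.elim

theorem GCWPair.isIso_liftSub {R P : GCWPair G} (f : R ⟶ P) (hR : R.A = ∅)
    (hf : IsEmbedding f.toFun) (hr : range f.toFun = P.A) :
    IsIso (GCWPair.liftSub f hR fun x => hr ▸ mem_range_self x) := by
  refine GCWPair.isIso_of_isHomeomorph _ ?_ (fun _ h => h.elim)
  have h1 : IsEmbedding (GCWPair.liftSub f hR fun x => hr ▸ mem_range_self x).toFun :=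
    hf.codRestrict P.A _
  refine isHomeomorph_iff_isEmbedding_surjective.2 ⟨h1, fun y => ?_⟩
  obtain ⟨x, hx⟩ : y.1 ∈ range f.toFun := by
    rw [hr]
    exact y.2
  exact ⟨x, Subtype.ext hx⟩

namespace GCWStructure

variable {X : GCWComplex G} {S : GCWStructure G X.carrier} {B : Set X.carrier}

/-- The action on a subcomplex. -/
abbrev IsSubcomplex.mulAction (hB : S.IsSubcomplex B) : MulAction G B where
  smul g a := ⟨g • a.1, hB.1 g a.1 a.2⟩
  one_smul a := Subtype.ext (one_smul G a.1)
  mul_smul g h a := Subtype.ext (mul_smul g h a.1)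

open Classical in
/-- The CW-structure of a subcomplex: it has those cells which are contained in it. -/
noncomputable abbrev IsSubcomplex.structureAux (hB : S.IsSubcomplex B) :
    letI := hB.mulAction; GCWStructure G B :=
  letI := hB.mulAction
  have hsmul : ∀ (g : G) n (e : {e : S.cell n // ∀ y ∈ disc n, S.map n e y ∈ B}),
      ∀ y ∈ disc n, S.map n (g • e.1) y ∈ B := fun g n e y hy => by
    rw [S.map_smul n g e.1 y hy]
    exact hB.1 g _ (e.2 y hy)
  let mp : ∀ n, {e : S.cell n // ∀ y ∈ disc n, S.map n e y ∈ B} → (Fin n → ℝ) → B := fun n e y =>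
    if hy : y ∈ disc n then ⟨S.map n e.1 y, e.2 y hy⟩ else ⟨S.map n e.1 0, e.2 0 (by simp)⟩
  have mp_eq : ∀ n e y, y ∈ disc n → (mp n e y : X.carrier) = S.map n e.1 y := fun n e y hy => by
    simp only [mp, dif_pos hy]
  have hskel : ∀ (a : B) n, (∃ m < n, ∃ e, ∃ y ∈ disc m, mp m e y = a) ↔ a.1 ∈ S.skelLT n := by
    intro a n
    constructor
    · rintro ⟨m, hm, e, y, hy, rfl⟩
      exact ⟨m, hm, e.1, y, hy, (mp_eq m e y hy).symm⟩
    · intro h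
      obtain ⟨m, hm, e, y, hy, hya⟩ := exists_openCell_of_mem_skelLT h
      have hy' := ball_subset_closedBall hy
      exact ⟨m, hm, ⟨e, fun z hz => hB.map_mem hy (hya ▸ a.2) hz⟩, y, hy',
        Subtype.ext ((mp_eq m _ y hy').trans hya)⟩
  { cell := fun n => {e : S.cell n // ∀ y ∈ disc n, S.map n e y ∈ B}
    cellAct := fun n =>
      { smul := fun g e => ⟨g • e.1, hsmul g n e⟩
        one_smul := fun e => Subtype.ext (one_smul G e.1)
        mul_smul := fun g h e => Subtype.ext (mul_smul g h e.1) }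
    map := mp
    continuousOn := fun n e => by
      rw [IsInducing.subtypeVal.continuousOn_iff]
      exact (S.continuousOn n e.1).congr (fun y hy => mp_eq n e y hy)
    map_smul := fun n g e y hy => by
      refine Subtype.ext ((mp_eq _ _ y hy).trans ?_)
      refine (S.map_smul n g e.1 y hy).trans ?_
      exact congrArg (g • ·) (mp_eq n e y hy).symm
    boundary := fun n e y hy => by
      refine (hskel (mp n e y) n).2 ?_
      rw [mp_eq n e y (sphere_subset_closedBall hy)]
      exact S.boundary n e.1 y hy
    bijective := by
      constructor
      · rintro ⟨n, e, x⟩ ⟨m, e', y⟩ hxy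
        have h2 := congrArg Subtype.val hxy
        simp only at h2
        rw [mp_eq n e x (ball_subset_closedBall x.2),
          mp_eq m e' y (ball_subset_closedBall y.2)] at h2
        have h3 := @S.bijective.1 ⟨n, e.1, x⟩ ⟨m, e'.1, y⟩ h2
        obtain rfl : n = m := congrArg Sigma.fst h3
        simp only [Sigma.mk.injEq, heq_eq_eq, Prod.mk.injEq, true_and] at h3 ⊢
        exact ⟨Subtype.ext h3.1, h3.2⟩
      · intro a
        obtain ⟨n, e, y, hy, hya⟩ := S.exists_openCell a.1
        exact ⟨⟨n, ⟨e, fun z hz => hB.map_mem hy (hya ▸ a.2) hz⟩, ⟨y, hy⟩⟩,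
          Subtype.ext ((mp_eq n _ y (ball_subset_closedBall hy)).trans hya)⟩
    isClosed_of_subset := fun n C hC h => by
      rw [hB.isClosed.isClosedEmbedding_subtypeVal.isClosed_iff_image_isClosed]
      refine hB.isClosed_of_subset_skelLT_of_cells (n := n) ?_ ?_ ?_
      · rintro _ ⟨c, -, rfl⟩
        exact c.2
      · rintro _ ⟨c, hc, rfl⟩
        exact (hskel c n).1 (hC c hc)
      · intro m hm e he
        convert isClosed_disc_inter.1 (h m hm ⟨e, he⟩) using 1
        ext y
        have := mp_eq m ⟨e, he⟩ y y.2
        constructor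
        · rintro ⟨c, hc, hcy⟩
          have : mp m ⟨e, he⟩ y = c := Subtype.ext (this.trans hcy.symm)
          change mp m ⟨e, he⟩ y ∈ C
          rwa [this]
        · intro hc
          exact ⟨_, hc, this⟩
    isClosed_of_inter := fun C h => by
      rw [hB.isClosed.isClosedEmbedding_subtypeVal.isClosed_iff_image_isClosed]
      refine S.isClosed_of_inter _ fun n => ?_
      have := h n
      rw [hB.isClosed.isClosedEmbedding_subtypeVal.isClosed_iff_image_isClosed] at this
      convert this using 1
      ext c
      constructor
      · rintro ⟨⟨c, hc, rfl⟩, hcn⟩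
        exact ⟨c, ⟨hc, (hskel c n).2 hcn⟩, rfl⟩
      · rintro ⟨c, ⟨hc, hcn⟩, rfl⟩
        exact ⟨⟨c, hc, rfl⟩, (hskel c n).1 hcn⟩ }

/-- A subcomplex, as a `G`-CW-complex. -/
def IsSubcomplex.complex (hB : S.IsSubcomplex B) : GCWComplex G :=
  letI := hB.mulAction
  { carrier := B
    cont := ⟨fun g => ((continuous_const_smul g).comp continuous_subtype_val).subtype_mk _⟩
    exists_structure := ⟨hB.structureAux⟩ }

/-- The inclusion of a subcomplex. -/
def IsSubcomplex.incl (hB : S.IsSubcomplex B) : hB.complex.toPair ⟶ X.toPair where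
  toFun a := a.1
  continuous := continuous_subtype_val
  equivariant _ _ := rfl
  mapsTo _ h := h.elim

/-- The CW-structure of a subcomplex. -/
noncomputable def IsSubcomplex.structure (hB : S.IsSubcomplex B) :
    GCWStructure G hB.complex.carrier := hB.structureAux

theorem IsSubcomplex.structure_map (hB : S.IsSubcomplex B) (n : ℕ) (e : hB.structure.cell n)
    {y : Fin n → ℝ} (hy : y ∈ disc n) :
    hB.incl.toFun (hB.structure.map n e y) = S.map n e.1 y := by
  exact congrArg Subtype.val (dif_pos hy)

theorem IsSubcomplex.structure_mem_skelLT (hB : S.IsSubcomplex B) (n : ℕ) {a : hB.complex.carrier}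
    (ha : hB.incl.toFun a ∈ S.skelLT n) : a ∈ hB.structure.skelLT n := by
  obtain ⟨m, e, y, hy, rfl⟩ := hB.structure.exists_openCell a
  rw [hB.structure_map m e (ball_subset_closedBall hy)] at ha
  exact map_mem_skelLT (lt_of_map_mem_skelLT hy ha) e (ball_subset_closedBall hy)

/-- A nested pair `A ⊆ B` of subcomplexes of `X`, as a pair. -/
def IsSubcomplex.pair {A : Set X.carrier} (hB : S.IsSubcomplex B) (hA : S.IsSubcomplex A) :
    GCWPair G where
  X := hB.complex
  A := hB.incl.toFun ⁻¹' A
  isSub := by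
    refine ⟨hB.structure, fun g a ha => hA.1 g _ ha, fun n e => ?_⟩
    refine (hA.2 n e.1).imp (fun h y hy => ?_) fun h y hy hyA => ?_
    · change hB.incl.toFun _ ∈ A
      rw [hB.structure_map n e hy]
      exact h y hy
    · change hB.incl.toFun _ ∈ A at hyA
      rw [hB.structure_map n e (ball_subset_closedBall hy)] at hyA
      exact h y hy hyA

/-- For subcomplexes `A ⊆ B`, the subcomplex `A` of the complex `B` is the complex `A`. -/
theorem IsSubcomplex.nonempty_iso_pair_sub {A : Set X.carrier} (hB : S.IsSubcomplex B)
    (hA : S.IsSubcomplex A) (hAB : A ⊆ B) :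
    Nonempty (hA.complex.toPair ≅ (hB.pair hA).sub.toPair) := by
  let f : hA.complex.toPair ⟶ hB.pair hA :=
    { toFun := fun a => ⟨a.1, hAB a.2⟩
      continuous := continuous_subtype_val.subtype_mk _
      equivariant := fun _ _ => rfl
      mapsTo := fun _ h => h.elim }
  have h1 : IsEmbedding f.toFun := IsEmbedding.inclusion hAB
  have := GCWPair.isIso_liftSub f rfl h1 (by
    ext b
    constructor
    · rintro ⟨a, rfl⟩
      exact a.2
    · intro hb
      exact ⟨⟨b.1, hb⟩, rfl⟩)
  exact ⟨asIso (GCWPair.liftSub f rfl _)⟩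

end GCWStructure

end Pairs

/-! ### Relative homeomorphisms and collapsing -/

section Collapse

variable {G : Type u} [Group G]

/-- A relative homeomorphism `(X, A) → (Y, B)`: it maps `X ∖ A` bijectively onto `Y ∖ B`, and `Y / B`
has the quotient topology from `X`. -/
structure IsRelHomeo {P Q : GCWPair G} (F : P ⟶ Q) : Prop where
  mem_of_mem : ∀ x, F.toFun x ∈ Q.A → x ∈ P.A
  injOn : ∀ x y, x ∉ P.A → y ∉ P.A → F.toFun x = F.toFun y → x = y
  surj : ∀ y, y ∉ Q.A → ∃ x, F.toFun x = y
  isClosed : ∀ C : Set Q.X.carrier, (Q.A ⊆ C ∨ Disjoint Q.A C) → IsClosed (F.toFun ⁻¹' C) →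
    IsClosed C

/-- The underlying set of `X / A`: the complement of `A` and one further point. -/
def CollapseSpace (P : GCWPair G) : Type u := Option {x : P.X.carrier // x ∉ P.A}

namespace CollapseSpace

variable (P : GCWPair G)

open Classical in
/-- The quotient map `X → X / A`. -/
noncomputable def mk (x : P.X.carrier) : CollapseSpace P :=
  if h : x ∈ P.A then (none : Option _) else some ⟨x, h⟩

/-- The point to which `A` is collapsed. -/
def base : CollapseSpace P := (none : Option _)

variable {P}

theorem mk_of_mem {x : P.X.carrier} (hx : x ∈ P.A) : mk P x = base P := dif_pos hx

theorem mk_of_notMem {x : P.X.carrier} (hx : x ∉ P.A) :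
    mk P x = (some ⟨x, hx⟩ : Option {x : P.X.carrier // x ∉ P.A}) := dif_neg hx

theorem mk_eq_base_iff {x : P.X.carrier} : mk P x = base P ↔ x ∈ P.A := by
  refine ⟨fun h => ?_, mk_of_mem⟩
  by_contra hx
  rw [mk_of_notMem hx] at h
  exact Option.some_ne_none _ h

theorem mk_injective {x y : P.X.carrier} (hx : x ∉ P.A) (h : mk P x = mk P y) : x = y := by
  have hy : y ∉ P.A := fun hy => hx (mk_eq_base_iff.1 (h.trans (mk_of_mem hy)))
  rw [mk_of_notMem hx, mk_of_notMem hy] at h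
  exact congrArg Subtype.val (Option.some.inj h)

theorem eq_base_or_mk (p : CollapseSpace P) : p = base P ∨ ∃ x, x ∉ P.A ∧ mk P x = p := by
  match p with
  | none => exact Or.inl rfl
  | some x => exact Or.inr ⟨x.1, x.2, mk_of_notMem x.2⟩

/-- Maps out of `X / A`. -/
def lift {W : Type*} (b : W) (f : P.X.carrier → W) (p : CollapseSpace P) : W :=
  Option.elim p b fun x => f x.1

theorem lift_mk {W : Type*} {b : W} {f : P.X.carrier → W} (h : ∀ x ∈ P.A, f x = b)
    (x : P.X.carrier) : lift b f (mk P x) = f x := by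
  by_cases hx : x ∈ P.A
  · rw [mk_of_mem hx, h x hx]
    rfl
  · rw [mk_of_notMem hx]
    rfl

noncomputable instance : MulAction G (CollapseSpace P) where
  smul g := lift (base P) fun x => mk P (g • x)
  one_smul p := by
    rcases eq_base_or_mk p with rfl | ⟨x, -, rfl⟩
    · rfl
    · refine (lift_mk (fun y hy => mk_of_mem ?_) x).trans (by rw [one_smul])
      exact (P.smul_mem_A 1).2 hy
  mul_smul g h p := by
    have key : ∀ (k : G) x, lift (base P) (fun x => mk P (k • x)) (mk P x) = mk P (k • x) :=
      fun k x => lift_mk (fun y hy => mk_of_mem ((P.smul_mem_A k).2 hy)) x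
    rcases eq_base_or_mk p with rfl | ⟨x, -, rfl⟩
    · rfl
    · refine (key (g * h) x).trans ?_
      rw [mul_smul]
      refine (key g (h • x)).symm.trans ?_
      exact congrArg (lift (base P) fun x => mk P (g • x)) (key h x).symm

theorem smul_mk (g : G) (x : P.X.carrier) : g • mk P x = mk P (g • x) :=
  lift_mk (fun _ hy => mk_of_mem ((P.smul_mem_A g).2 hy)) x

noncomputable instance : TopologicalSpace (CollapseSpace P) := .coinduced (mk P) inferInstance

theorem continuous_mk : Continuous (mk P) := continuous_coinduced_rng

theorem continuous_of {W : Type*} [TopologicalSpace W] {f : CollapseSpace P → W}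
    (hf : Continuous fun x => f (mk P x)) : Continuous f := continuous_coinduced_dom.2 hf

theorem isClosed_iff {C : Set (CollapseSpace P)} : IsClosed C ↔ IsClosed (mk P ⁻¹' C) :=
  isClosed_coinduced

end CollapseSpace

open CollapseSpace in
/-- `X / A` has one `0`-cell and the cells of `X` which are not in `A`. -/
theorem exists_collapse_structure (P : GCWPair G) {S : GCWStructure G P.X.carrier}
    (hS : S.IsSubcomplex P.A) : ∃ T : GCWStructure G (CollapseSpace P),
      T.IsSubcomplex {base P} := by
  let E : ℕ → Type u := fun n =>
    {e : S.cell n // ∀ x ∈ ball (0 : Fin n → ℝ) 1, S.map n e x ∉ P.A} ⊕ ULift.{u} (PLift (n = 0))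
  have hsmul : ∀ n (g : G)
      (e : {e : S.cell n // ∀ x ∈ ball (0 : Fin n → ℝ) 1, S.map n e x ∉ P.A}),
      ∀ x ∈ ball (0 : Fin n → ℝ) 1, S.map n (g • e.1) x ∉ P.A := by
    intro n g e x hx
    rw [S.map_smul n g e.1 x (ball_subset_closedBall hx), P.smul_mem_A]
    exact e.2 x hx
  let act : ∀ n, MulAction G (E n) := fun n =>
    { smul := fun g => Sum.map (fun e => ⟨g • e.1, hsmul n g e⟩) id
      one_smul := by
        rintro (e | e)
        · exact congrArg Sum.inl (Subtype.ext (one_smul G e.1))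
        · rfl
      mul_smul := by
        rintro g h (e | e)
        · exact congrArg Sum.inl (Subtype.ext (mul_smul g h e.1))
        · rfl }
  let mp : ∀ n, E n → (Fin n → ℝ) → CollapseSpace P := fun n e x =>
    Sum.elim (fun e => mk P (S.map n e.1 x)) (fun _ => base P) e
  have hskel : ∀ (x : P.X.carrier) n, x ∉ P.A →
      ((∃ m < n, ∃ e, ∃ y ∈ disc m, mp m e y = mk P x) ↔ x ∈ S.skelLT n) := by
    intro x n hx
    constructor
    · rintro ⟨m, hm, e | e, y, hy, h⟩
      · have h' : S.map m e.1 y = x := (mk_injective hx h.symm).symm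
        exact h' ▸ GCWStructure.map_mem_skelLT hm e.1 hy
      · exact (hx (mk_eq_base_iff.1 h.symm)).elim
    · intro h
      obtain ⟨m, hm, e, y, hy, rfl⟩ := GCWStructure.exists_openCell_of_mem_skelLT h
      refine ⟨m, hm, Sum.inl ⟨e, ?_⟩, y, ball_subset_closedBall hy, rfl⟩
      rcases hS.2 m e with he | he
      · exact (hx (he _ (ball_subset_closedBall hy))).elim
      · exact he
  have hbase : ∀ n, 0 < n → ∃ m < n, ∃ e, ∃ y ∈ disc m, mp m e y = base P := fun n hn =>
    ⟨0, hn, Sum.inr ⟨⟨rfl⟩⟩, 0, by simp, rfl⟩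
  have hskel' : ∀ (x : P.X.carrier) n, x ∈ S.skelLT n →
      ∃ m < n, ∃ e, ∃ y ∈ disc m, mp m e y = mk P x := by
    intro x n h
    by_cases hx : x ∈ P.A
    · rw [mk_of_mem hx]
      obtain ⟨m, hm, _⟩ := h
      exact hbase n (by omega)
    · exact (hskel x n hx).2 h
  refine ⟨{ cell := E
            cellAct := act
            map := mp
            continuousOn := ?_
            map_smul := ?_
            boundary := ?_
            bijective := ?_
            isClosed_of_subset := ?_
            isClosed_of_inter := ?_ }, ?_, ?_⟩
  · rintro n (e | e)
    · exact continuous_mk.comp_continuousOn (S.continuousOn n e.1)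
    · exact continuousOn_const
  · rintro n g (e | e) x hx
    · refine (congrArg (mk P) (S.map_smul n g e.1 x hx)).trans ?_
      exact (smul_mk g _).symm
    · rfl
  · rintro n (e | ⟨⟨⟨rfl⟩⟩⟩) x hx
    · exact hskel' _ n (S.boundary n e.1 x hx)
    · rw [Subsingleton.elim x 0, mem_sphere_iff_norm] at hx
      simp only [sub_self, norm_zero] at hx
      exact absurd hx zero_ne_one
  · constructor
    · rintro ⟨n, e | ⟨⟨⟨rfl⟩⟩⟩, x⟩ ⟨m, e' | ⟨⟨⟨rfl⟩⟩⟩, y⟩ h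
      · have h1 : S.map n e.1 x = S.map m e'.1 y := mk_injective (e.2 x x.2) h
        have h2 := @S.bijective.1 ⟨n, e.1, x⟩ ⟨m, e'.1, y⟩ h1
        obtain rfl : n = m := congrArg Sigma.fst h2
        simp only [Sigma.mk.injEq, heq_eq_eq, Prod.mk.injEq, true_and] at h2 ⊢
        exact ⟨congrArg Sum.inl (Subtype.ext h2.1), h2.2⟩
      · exact (e.2 x x.2 (mk_eq_base_iff.1 h)).elim
      · exact (e'.2 y y.2 (mk_eq_base_iff.1 h.symm)).elim
      · have : x = y := Subsingleton.elim _ _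
        rw [this]
    · intro p
      rcases eq_base_or_mk p with rfl | ⟨x, hx, rfl⟩
      · exact ⟨⟨0, Sum.inr ⟨⟨rfl⟩⟩, ⟨0, by simp⟩⟩, rfl⟩
      · obtain ⟨m, e, y, hy, rfl⟩ := S.exists_openCell x
        refine ⟨⟨m, Sum.inl ⟨e, ?_⟩, ⟨y, hy⟩⟩, rfl⟩
        rcases hS.2 m e with he | he
        · exact (hx (he _ (ball_subset_closedBall hy))).elim
        · exact he
  · -- the preimage of a closed set is the union of its part in a skeleton and, possibly, of `A`
    intro n C hC h
    rw [CollapseSpace.isClosed_iff]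
    have h1 : IsClosed (mk P ⁻¹' C ∩ S.skelLT n) := by
      refine GCWStructure.isClosed_of_subset_skelLT inter_subset_right fun m hm e => ?_
      have h2 : {y : disc m | S.map m e y ∈ mk P ⁻¹' C ∩ S.skelLT n} =
          {y : disc m | mk P (S.map m e y) ∈ C} := by
        ext y
        exact and_iff_left (GCWStructure.map_mem_skelLT hm e y.2)
      rw [h2]
      rcases hS.2 m e with he | he
      · have h3 : ∀ y : disc m, mk P (S.map m e y) = base P := fun y => mk_of_mem (he y y.2)
        simp only [h3]
        exact isClosed_const
      · exact isClosed_disc_inter.1 (h m hm (Sum.inl ⟨e, he⟩))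
    have h4 : mk P ⁻¹' C = (mk P ⁻¹' C ∩ S.skelLT n) ∪ {x | x ∈ P.A ∧ base P ∈ C} := by
      ext x
      by_cases hx : x ∈ P.A
      · simp only [mem_preimage, mk_of_mem hx, mem_union, mem_inter_iff, mem_ofPred_eq, hx, true_and]
        exact ⟨Or.inr, fun h => h.elim And.left id⟩
      · simp only [mem_preimage, mem_union, mem_inter_iff, mem_ofPred_eq, hx, false_and, or_false]
        exact (and_iff_left_of_imp fun h => (hskel x n hx).1 (hC _ h)).symm
    rw [h4]
    exact h1.union (P.isClosed_A.and isClosed_const)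
  · intro C h
    rw [CollapseSpace.isClosed_iff]
    refine S.isClosed_of_inter _ fun n => ?_
    have h1 := (CollapseSpace.isClosed_iff.1 (h n)).inter (S.isClosed_skelLT n)
    convert h1 using 1
    ext x
    constructor
    · rintro ⟨hx, hn⟩
      exact ⟨⟨hx, hskel' x n hn⟩, hn⟩
    · rintro ⟨⟨hx, -⟩, hn⟩
      exact ⟨hx, hn⟩
  · rintro g _ rfl
    rfl
  · rintro n (e | e)
    · right
      intro x hx h
      exact e.2 x hx (mk_eq_base_iff.1 h)
    · left
      intro x hx
      rfl

open CollapseSpace in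
/-- The pair `(X / A, {•})`. -/
noncomputable def collapse (P : GCWPair G) : GCWPair G where
  X :=
    { carrier := CollapseSpace P
      cont := ⟨fun g => continuous_of (by
        simp only [smul_mk]
        exact continuous_mk.comp (continuous_const_smul g))⟩
      exists_structure :=
        ⟨(exists_collapse_structure P P.isSub.choose_spec).choose⟩ }
  A := {base P}
  isSub := exists_collapse_structure P P.isSub.choose_spec

open CollapseSpace in
/-- The projection `(X, A) → (X / A, {•})`. -/
noncomputable def toCollapse (P : GCWPair G) : P ⟶ collapse P where
  toFun := mk P
  continuous := continuous_mk
  equivariant g x := (smul_mk g x).symm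
  mapsTo _ hx := mk_of_mem hx

open CollapseSpace in
/-- The attaching map `A → {•}` of `X / A` is cellular for every structure, so that the excision
axiom applies to `X / A`. -/
theorem isCellularPushout_toCollapse (P : GCWPair G) : IsCellularPushout (toCollapse P) := by
  have hsub : Subsingleton (collapse P).sub.carrier :=
    ⟨fun a b => Subtype.ext ((show a.1 = base P from a.2).trans (show b.1 = base P from b.2).symm)⟩
  constructor
  · obtain ⟨S, hS⟩ := P.isSub
    refine ⟨S, (collapse P).sub.exists_structure.some, hS, fun n a ha => ?_⟩
    set T := (collapse P).sub.exists_structure.some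
    -- a nonempty one-point complex has its point in the `0`-skeleton
    obtain ⟨m, hm, _⟩ := ha
    obtain ⟨k, e, y, hy, hk⟩ := T.exists_openCell (((subFunctor G).map (toCollapse P)).toFun a)
    obtain rfl : k = 0 := by
      by_contra hk0
      have hz : (fun _ => 1 / 2 : Fin k → ℝ) ∈ ball (0 : Fin k → ℝ) 1 :=
        mem_openDisc.2 fun _ => by norm_num [abs_of_pos]
      have hz' : (0 : Fin k → ℝ) ∈ ball (0 : Fin k → ℝ) 1 := by simp
      have := (GCWStructure.openCell_unique' (e := e) (e' := e) hz hz' (Subsingleton.elim _ _)).2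
      have := congrFun this ⟨0, Nat.pos_of_ne_zero hk0⟩
      norm_num at this
    exact ⟨0, by omega, e, y, ball_subset_closedBall hy, hk⟩
  · refine ⟨⟨?_⟩, ⟨Limits.PushoutCocone.IsColimit.mk _ (fun s => TopCat.ofHom ⟨lift
      (s.inr ⟨base P, rfl⟩) s.inl, ?_⟩) ?_ ?_ ?_⟩⟩
    · ext a
      rfl
    · refine continuous_of ?_
      have h : ∀ x ∈ P.A, s.inl x = s.inr ⟨base P, rfl⟩ := by
        intro x hx
        have h1 := ConcreteCategory.congr_hom s.condition (⟨x, hx⟩ : P.sub.carrier)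
        refine h1.trans ?_
        exact congrArg s.inr (Subsingleton.elim (α := (collapse P).sub.carrier) _ _)
      simp only [lift_mk h]
      exact s.inl.hom.continuous
    · intro s
      ext x
      refine Eq.trans (show _ = lift (P := P) (s.inr ⟨base P, rfl⟩) s.inl (mk P x) from rfl) ?_
      refine lift_mk (P := P) (fun x hx => ?_) x
      have h1 := ConcreteCategory.congr_hom s.condition (⟨x, hx⟩ : P.sub.carrier)
      refine h1.trans ?_
      exact congrArg s.inr (Subsingleton.elim (α := (collapse P).sub.carrier) _ _)
    · intro s
      ext b
      obtain ⟨b, hb⟩ := b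
      obtain rfl : b = base P := hb
      rfl
    · intro s m h1 h2
      ext p
      rcases eq_base_or_mk p with rfl | ⟨x, hx, rfl⟩
      · exact ConcreteCategory.congr_hom h2 (⟨base P, rfl⟩ : (collapse P).sub.carrier)
      · refine (ConcreteCategory.congr_hom h1 x).trans ?_
        rw [mk_of_notMem hx]
        rfl

open CollapseSpace in
/-- A relative homeomorphism becomes an isomorphism after collapsing. -/
theorem exists_collapse_iso_of_isRelHomeo {P Q : GCWPair G} {F : P ⟶ Q} (hF : IsRelHomeo F) :
    ∃ e : collapse P ⟶ collapse Q, IsIso e ∧ toCollapse P ≫ e = F ≫ toCollapse Q := by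
  let ef : CollapseSpace P → CollapseSpace Q := lift (base Q) fun x => mk Q (F.toFun x)
  have hl : ∀ x, ef (mk P x) = mk Q (F.toFun x) := lift_mk fun x hx => mk_of_mem (F.mapsTo x hx)
  let e : collapse P ⟶ collapse Q :=
    { toFun := ef
      continuous := continuous_of (by
        simp only [hl]
        exact continuous_mk.comp F.continuous)
      equivariant := fun g p => by
        rcases eq_base_or_mk p with rfl | ⟨x, -, rfl⟩
        · rfl
        · refine (congrArg ef (smul_mk g x)).trans ((hl _).trans ?_)
          rw [F.equivariant]
          exact (smul_mk g _).symm.trans (congrArg (g • ·) (hl x).symm)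
      mapsTo := by
        rintro _ rfl
        rfl }
  have he : ∀ x, e.toFun (mk P x) = mk Q (F.toFun x) := hl
  have heb : e.toFun (base P) = base Q := rfl
  have hA : ∀ p, e.toFun p ∈ (collapse Q).A → p ∈ (collapse P).A := by
    intro p hp
    rcases eq_base_or_mk p with rfl | ⟨x, -, rfl⟩
    · rfl
    · exact mk_of_mem (hF.mem_of_mem x (mk_eq_base_iff.1 ((he x).symm.trans hp)))
  have hinj : Function.Injective e.toFun := by
    intro p q hpq
    rcases eq_base_or_mk p with rfl | ⟨x, hx, rfl⟩
    · exact (hA q (hpq.symm.trans heb)).symm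
    · rcases eq_base_or_mk q with rfl | ⟨y, hy, rfl⟩
      · exact hA _ (hpq.trans heb)
      · rw [he, he] at hpq
        have h1 : F.toFun x ∉ Q.A := fun h => hx (hF.mem_of_mem x h)
        rw [hF.injOn x y hx hy (mk_injective h1 hpq)]
  refine ⟨e, GCWPair.isIso_of_isHomeomorph e ?_ hA, ?_⟩
  · refine isHomeomorph_iff_continuous_isClosedMap_bijective.2 ⟨e.continuous, ?_, hinj, ?_⟩
    · intro C hC
      refine CollapseSpace.isClosed_iff.2 (hF.isClosed _ ?_ ?_)
      · have key : ∀ D : Set (CollapseSpace Q), Q.A ⊆ mk Q ⁻¹' D ∨ Disjoint Q.A (mk Q ⁻¹' D) := by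
          intro D
          by_cases h : base Q ∈ D
          · left
            intro y hy
            rwa [mem_preimage, mk_of_mem hy]
          · right
            refine disjoint_left.2 fun y hy hyD => h ?_
            rwa [mem_preimage, mk_of_mem hy] at hyD
        exact key _
      · convert CollapseSpace.isClosed_iff.1 hC using 1
        ext x
        refine (iff_of_eq (congrArg (· ∈ e.toFun '' C) (he x).symm)).trans ?_
        exact hinj.mem_set_image
    · intro q
      rcases eq_base_or_mk q with rfl | ⟨y, hy, rfl⟩
      · exact ⟨base P, rfl⟩
      · obtain ⟨x, rfl⟩ := hF.surj y hy
        exact ⟨mk P x, he x⟩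
  · ext x
    exact he x

end Collapse

/-! ### Directed systems of modules and the five lemma -/

/-- A directed system of abelian groups `M i` with compatible maps to an abelian group `N`. -/
structure IndSystem (I : Type*) [Preorder I] where
  M : I → Type w
  N : Type w
  [groupM : ∀ i, AddCommGroup (M i)]
  [groupN : AddCommGroup N]
  f : ∀ {i j : I}, i ≤ j → M i →+ M j
  g : ∀ i, M i →+ N
  g_f : ∀ {i j : I} (h : i ≤ j) x, g j (f h x) = g i x
  f_f : ∀ {i j k : I} (h : i ≤ j) (h' : j ≤ k) x, f h' (f h x) = f (h.trans h') x

namespace IndSystem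

attribute [instance] groupM groupN

variable {I : Type*} [Preorder I]

/-- The map `colimᵢ M i → N` is an isomorphism, expressed by elements. -/
structure IsColimit (S : IndSystem.{w} I) : Prop where
  surj : ∀ y, ∃ i x, S.g i x = y
  inj : ∀ i x, S.g i x = 0 → ∃ j, ∃ h : i ≤ j, S.f h x = 0

/-- A morphism of directed systems with target. -/
structure Hom (S T : IndSystem.{w} I) where
  φ : ∀ i, S.M i →+ T.M i
  φN : S.N →+ T.N
  comm_f : ∀ {i j : I} (h : i ≤ j) x, φ j (S.f h x) = T.f h (φ i x)
  comm_g : ∀ i x, φN (S.g i x) = T.g i (φ i x)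

/-- Exactness of `S → T → U`. -/
structure Exact {S T U : IndSystem.{w} I} (a : Hom S T) (b : Hom T U) : Prop where
  exact : ∀ i, Function.Exact (a.φ i) (b.φ i)
  exactN : Function.Exact a.φN b.φN

/-- The five lemma for directed systems. -/
theorem five_lemma [IsDirectedOrder I] {S₁ S₂ S₃ S₄ S₅ : IndSystem.{w} I} {a : Hom S₁ S₂}
    {b : Hom S₂ S₃} {c : Hom S₃ S₄} {d : Hom S₄ S₅} (hab : Exact a b) (hbc : Exact b c)
    (hcd : Exact c d) (h₁ : S₁.IsColimit) (h₂ : S₂.IsColimit) (h₄ : S₄.IsColimit)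
    (h₅ : S₅.IsColimit) : S₃.IsColimit := by
  constructor
  · intro y
    obtain ⟨i, x, hx⟩ := h₄.surj (c.φN y)
    have h0 : S₅.g i (d.φ i x) = 0 := by
      rw [← d.comm_g, hx]
      exact hcd.exactN.apply_apply_eq_zero y
    obtain ⟨j, hij, hj⟩ := h₅.inj i _ h0
    rw [← d.comm_f] at hj
    obtain ⟨z, hz⟩ := (hcd.exact j _).1 hj
    have h1 : c.φN (y - S₃.g j z) = 0 := by
      rw [map_sub, c.comm_g, hz, S₄.g_f, hx, sub_self]
    obtain ⟨t, ht⟩ := (hbc.exactN _).1 h1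
    obtain ⟨k, s, rfl⟩ := h₂.surj t
    obtain ⟨l, hjl, hkl⟩ := exists_ge_ge j k
    refine ⟨l, S₃.f hjl z + b.φ l (S₂.f hkl s), ?_⟩
    rw [map_add, S₃.g_f, ← b.comm_g, S₂.g_f, ht]
    abel
  · intro i x hx
    have h0 : S₄.g i (c.φ i x) = 0 := by rw [← c.comm_g, hx, map_zero]
    obtain ⟨j, hij, hj⟩ := h₄.inj i _ h0
    rw [← c.comm_f] at hj
    obtain ⟨z, hz⟩ := (hbc.exact j _).1 hj
    have h1 : b.φN (S₂.g j z) = 0 := by rw [b.comm_g, hz, S₃.g_f, hx]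
    obtain ⟨t, ht⟩ := (hab.exactN _).1 h1
    obtain ⟨k, s, rfl⟩ := h₁.surj t
    obtain ⟨l, hjl, hkl⟩ := exists_ge_ge j k
    have h2 : S₂.g l (S₂.f hjl z - a.φ l (S₁.f hkl s)) = 0 := by
      rw [map_sub, S₂.g_f, ← a.comm_g, S₁.g_f, ht, sub_self]
    obtain ⟨m, hlm, hm⟩ := h₂.inj l _ h2
    refine ⟨m, hij.trans (hjl.trans hlm), ?_⟩
    have h3 : b.φ m (S₂.f hlm (S₂.f hjl z)) = b.φ m (a.φ m (S₁.f hlm (S₁.f hkl s))) := by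
      rw [map_sub, sub_eq_zero] at hm
      rw [hm, ← a.comm_f]
    rw [hab.exact m |>.apply_apply_eq_zero, b.comm_f, b.comm_f, hz, S₃.f_f, S₃.f_f] at h3
    exact h3

/-- A retract of a colimit diagram is a colimit diagram. -/
theorem IsColimit.of_retract {S T : IndSystem.{w} I} (hT : T.IsColimit) (a : Hom S T) (b : Hom T S)
    (h : ∀ i x, b.φ i (a.φ i x) = x) (hN : ∀ x, b.φN (a.φN x) = x) : S.IsColimit := by
  constructor
  · intro y
    obtain ⟨i, x, hx⟩ := hT.surj (a.φN y)
    exact ⟨i, b.φ i x, by rw [← b.comm_g, hx, hN]⟩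
  · intro i x hx
    obtain ⟨j, hij, hj⟩ := hT.inj i (a.φ i x) (by rw [← a.comm_g, hx, map_zero])
    refine ⟨j, hij, ?_⟩
    rw [← h j (S.f hij x), a.comm_f, hj, map_zero]

theorem IsColimit.iff_of_bijective {S T : IndSystem.{w} I} (a : Hom S T)
    (h : ∀ i, Function.Bijective (a.φ i)) (hN : Function.Bijective a.φN) :
    S.IsColimit ↔ T.IsColimit := by
  constructor
  · intro hS
    constructor
    · intro y
      obtain ⟨y, rfl⟩ := hN.2 y
      obtain ⟨i, x, rfl⟩ := hS.surj y
      exact ⟨i, a.φ i x, (a.comm_g i x).symm⟩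
    · intro i x hx
      obtain ⟨x, rfl⟩ := (h i).2 x
      rw [← a.comm_g] at hx
      obtain ⟨j, hij, hj⟩ := hS.inj i x (hN.1 (hx.trans (map_zero _).symm))
      exact ⟨j, hij, by rw [← a.comm_f, hj, map_zero]⟩
  · intro hT
    constructor
    · intro y
      obtain ⟨i, x, hx⟩ := hT.surj (a.φN y)
      obtain ⟨x, rfl⟩ := (h i).2 x
      exact ⟨i, x, hN.1 ((a.comm_g i x).trans hx)⟩
    · intro i x hx
      obtain ⟨j, hij, hj⟩ := hT.inj i (a.φ i x) (by rw [← a.comm_g, hx, map_zero])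
      exact ⟨j, hij, (h j).1 (by rw [a.comm_f, hj, map_zero])⟩

/-- If two systems are colimit diagrams and a morphism between them is bijective at every stage,
then it is bijective in the limit. -/
theorem Hom.bijective_φN {S T : IndSystem.{w} I} (hS : S.IsColimit) (hT : T.IsColimit)
    (a : Hom S T) (h : ∀ i, Function.Bijective (a.φ i)) : Function.Bijective a.φN := by
  constructor
  · refine (injective_iff_map_eq_zero _).2 fun y hy => ?_
    obtain ⟨i, x, rfl⟩ := hS.surj y
    rw [a.comm_g] at hy
    obtain ⟨j, hij, hj⟩ := hT.inj i _ hy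
    rw [← a.comm_f] at hj
    rw [← S.g_f hij, (h j).1 (hj.trans (map_zero _).symm), map_zero]
  · intro y
    obtain ⟨i, x, rfl⟩ := hT.surj y
    obtain ⟨x, rfl⟩ := (h i).2 x
    exact ⟨S.g i x, a.comm_g i x⟩

end IndSystem

/-! ### Homology theories with strong excision -/

/-- A `G`-homology theory in which excision holds for all relative homeomorphisms. -/
structure HomologyTheory (G : Type u) [Group G] (Λ : Type v) [Ring Λ] where
  H : ℤ → (GCWPair.{u} G ⥤ ModuleCat.{w} Λ)
  bdry : ∀ n, H n ⟶ subFunctor G ⋙ H (n - 1)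
  homotopy_invariance : ∀ {P Q : GCWPair.{u} G} (f₀ f₁ : P ⟶ Q), GHomotopic f₀ f₁ →
    ∀ n, (H n).map f₀ = (H n).map f₁
  exact_X : ∀ (P : GCWPair.{u} G) n,
    Function.Exact ((H n).map P.inclSub).hom ((H n).map P.inclPair).hom
  exact_pair : ∀ (P : GCWPair.{u} G) n,
    Function.Exact ((H n).map P.inclPair).hom ((bdry n).app P).hom
  exact_A : ∀ (P : GCWPair.{u} G) n,
    Function.Exact ((bdry n).app P).hom ((H (n - 1)).map P.inclSub).hom
  excision : ∀ {P Q : GCWPair.{u} G} (F : P ⟶ Q), IsRelHomeo F →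
    ∀ n, Function.Bijective ((H n).map F).hom
  disjoint_union : ∀ {I : Type u} [DecidableEq I] (X : I → GCWComplex.{u} G) n,
    Function.Bijective (DirectSum.toModule Λ I ((H n).obj (coproduct X).toPair)
      (fun i => ((H n).map (coproductIncl X i)).hom))

section

variable {G : Type u} [Group G] {Λ : Type v} [Ring Λ]

theorem bijective_map_of_isIso (F : GCWPair.{u} G ⥤ ModuleCat.{w} Λ) {P Q : GCWPair G} (f : P ⟶ Q)
    [IsIso f] : Function.Bijective (F.map f).hom :=
  ConcreteCategory.bijective_of_isIso (F.map f)

/-- A `G`-homology theory satisfies excision for all relative homeomorphisms: both sides map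
isomorphically to the homology of the collapsed pair. -/
def GHomologyTheory.toHomologyTheory (h : GHomologyTheory.{u, v, w} G Λ) :
    HomologyTheory.{u, v, w} G Λ where
  H := h.H
  bdry := h.bdry
  homotopy_invariance := h.homotopy_invariance
  exact_X := h.exact_X
  exact_pair := h.exact_pair
  exact_A := h.exact_A
  disjoint_union := h.disjoint_union
  excision {P Q} F hF n := by
    obtain ⟨e, _, he⟩ := exists_collapse_iso_of_isRelHomeo hF
    have h1 := h.excision _ (isCellularPushout_toCollapse P) n
    have h2 := h.excision _ (isCellularPushout_toCollapse Q) n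
    have h3 := (bijective_map_of_isIso (h.H n) e).comp h1
    have h4 : ((h.H n).map e).hom ∘ ((h.H n).map (toCollapse P)).hom =
        ((h.H n).map (toCollapse Q)).hom ∘ ((h.H n).map F).hom := by
      have := congrArg (h.H n).map he
      rw [Functor.map_comp, Functor.map_comp] at this
      funext x
      exact ConcreteCategory.congr_hom this x
    rw [h4] at h3
    exact (Function.Bijective.of_comp_iff' h2 _).1 h3

/-- A morphism of homology theories. -/
structure HomologyTheory.Hom (A B : HomologyTheory.{u, v, w} G Λ) where
  app : ∀ n, A.H n ⟶ B.H n
  bdry : ∀ n P, (app n).app P ≫ (B.bdry n).app P =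
    (A.bdry n).app P ≫ (app (n - 1)).app ((subFunctor G).obj P)

/-- A directed system of homology theories `A i` with compatible morphisms to a theory `B`. -/
structure TheorySystem (I : Type*) [Preorder I] (A : I → HomologyTheory.{u, v, w} G Λ)
    (B : HomologyTheory.{u, v, w} G Λ) where
  f : ∀ {i j : I}, i ≤ j → (A i).Hom (A j)
  g : ∀ i, (A i).Hom B
  g_f : ∀ {i j : I} (h : i ≤ j) n P, ((f h).app n).app P ≫ ((g j).app n).app P =
    ((g i).app n).app P
  f_f : ∀ {i j k : I} (h : i ≤ j) (h' : j ≤ k) n P,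
    ((f h).app n).app P ≫ ((f h').app n).app P = ((f (h.trans h')).app n).app P

/-! ### Cellular classes of pairs -/

/-- A class of `G`-CW-pairs with the closure properties of "a given morphism of homology theories is
an isomorphism on the pair", which contains the orbits `ι_* {•} = G / L`. -/
structure CellularClass (Q : GCWPair.{u} G → Prop) : Prop where
  of_retract : ∀ {X T : GCWPair G} (σ : X ⟶ T) (p : T ⟶ X), GHomotopic (𝟙 X) (σ ≫ p) → Q T → Q X
  pair : ∀ P : GCWPair G, Q P.sub.toPair → Q P.X.toPair → Q P
  total : ∀ P : GCWPair G, Q P.sub.toPair → Q P → Q P.X.toPair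
  excision : ∀ {P P' : GCWPair G} (F : P ⟶ P'), IsRelHomeo F → (Q P ↔ Q P')
  coproduct : ∀ {I : Type u} (X : I → GCWComplex G), (∀ i, Q (X i).toPair) →
    Q (coproduct X).toPair
  orbit : ∀ L : Subgroup G, Q ((indFunctor L.subtype).obj (point L))

theorem GHomotopic.refl {P Q : GCWPair G} (f : P ⟶ Q) : GHomotopic f f :=
  ⟨fun p => f.toFun p.1, f.continuous.comp continuous_fst, fun _ => rfl, fun _ => rfl,
    fun g x _ => f.equivariant g x, fun x hx _ => f.mapsTo x hx⟩

theorem CellularClass.of_iso {Q : GCWPair.{u} G → Prop} (hQ : CellularClass Q) {X T : GCWPair G}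
    (e : X ≅ T) (h : Q T) : Q X :=
  hQ.of_retract e.hom e.inv (by rw [e.hom_inv_id]; exact .refl _) h

/-- A family of maps exhibiting `Y` as a disjoint union. -/
theorem isIso_of_isHomeomorph_sigma {I : Type u} {X : I → GCWComplex G} {Y : GCWComplex G}
    (f : ∀ i, (X i).toPair ⟶ Y.toPair)
    (hf : IsHomeomorph fun s : Σ i, (X i).carrier => (f s.1).toFun s.2) :
    ∃ e : (coproduct X).toPair ⟶ Y.toPair, IsIso e ∧ ∀ i, coproductIncl X i ≫ e = f i := by
  let e : (coproduct X).toPair ⟶ Y.toPair :=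
    { toFun := fun s : Σ i, (X i).carrier => (f s.1).toFun s.2
      continuous := hf.continuous
      equivariant := fun g s => (f s.1).equivariant g s.2
      mapsTo := fun _ h => h.elim }
  exact ⟨e, GCWPair.isIso_of_isHomeomorph e hf fun _ h => h, fun i => rfl⟩

theorem CellularClass.of_isHomeomorph_sigma {Q : GCWPair.{u} G → Prop} (hQ : CellularClass Q)
    {I : Type u} {X : I → GCWComplex G} {Y : GCWComplex G} (f : ∀ i, (X i).toPair ⟶ Y.toPair)
    (hf : IsHomeomorph fun s : Σ i, (X i).carrier => (f s.1).toFun s.2)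
    (h : ∀ i, Q (X i).toPair) : Q Y.toPair := by
  obtain ⟨e, _, -⟩ := isIso_of_isHomeomorph_sigma f hf
  exact hQ.of_iso (asIso e).symm (hQ.coproduct X h)

namespace TheorySystem

variable {I : Type*} [Preorder I] {A : I → HomologyTheory.{u, v, w} G Λ}
  {B : HomologyTheory.{u, v, w} G Λ} (T : TheorySystem I A B)

/-- The system of the homology groups of a pair. -/
def sys (n : ℤ) (P : GCWPair G) : IndSystem.{w} I where
  M i := ((A i).H n).obj P
  N := (B.H n).obj P
  f h := (((T.f h).app n).app P).hom.toAddMonoidHom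
  g i := (((T.g i).app n).app P).hom.toAddMonoidHom
  g_f h x := ConcreteCategory.congr_hom (T.g_f h n P) x
  f_f h h' x := ConcreteCategory.congr_hom (T.f_f h h' n P) x

/-- The morphism of systems induced by a map of pairs. -/
def map (n : ℤ) {P Q : GCWPair G} (F : P ⟶ Q) : (T.sys n P).Hom (T.sys n Q) where
  φ i := (((A i).H n).map F).hom.toAddMonoidHom
  φN := ((B.H n).map F).hom.toAddMonoidHom
  comm_f h x := (ConcreteCategory.congr_hom (((T.f h).app n).naturality F) x).symm
  comm_g i x := (ConcreteCategory.congr_hom (((T.g i).app n).naturality F) x).symm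

/-- The morphism of systems given by the boundary maps. -/
def bdry (n : ℤ) (P : GCWPair G) : (T.sys n P).Hom (T.sys (n - 1) P.sub.toPair) where
  φ i := (((A i).bdry n).app P).hom.toAddMonoidHom
  φN := ((B.bdry n).app P).hom.toAddMonoidHom
  comm_f h x := ConcreteCategory.congr_hom ((T.f h).bdry n P) x
  comm_g i x := ConcreteCategory.congr_hom ((T.g i).bdry n P) x

/-- The pairs on which `colimᵢ A i → B` is an isomorphism. -/
def Good (P : GCWPair G) : Prop := ∀ n, (T.sys n P).IsColimit

theorem exact_X (n : ℤ) (P : GCWPair G) :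
    IndSystem.Exact (T.map n P.inclSub) (T.map n P.inclPair) :=
  ⟨fun i => (A i).exact_X P n, B.exact_X P n⟩

theorem exact_pair (n : ℤ) (P : GCWPair G) :
    IndSystem.Exact (T.map n P.inclPair) (T.bdry n P) :=
  ⟨fun i => (A i).exact_pair P n, B.exact_pair P n⟩

theorem exact_A (n : ℤ) (P : GCWPair G) :
    IndSystem.Exact (T.bdry n P) (T.map (n - 1) P.inclSub) :=
  ⟨fun i => (A i).exact_A P n, B.exact_A P n⟩

open DirectSum in
/-- The class of pairs on which `colimᵢ A i → B` is an isomorphism is cellular as soon as it contains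
the orbits. -/
theorem cellularClass_good [IsDirectedOrder I] [Nonempty I]
    (h : ∀ L : Subgroup G, T.Good ((indFunctor L.subtype).obj (point L))) :
    CellularClass T.Good where
  of_retract {X Y} σ p hσ hY n := by
    have key : ∀ C : HomologyTheory.{u, v, w} G Λ, ∀ x : (C.H n).obj X,
        ((C.H n).map p).hom (((C.H n).map σ).hom x) = x := by
      intro C x
      have h1 := C.homotopy_invariance _ _ hσ n
      rw [CategoryTheory.Functor.map_comp, CategoryTheory.Functor.map_id] at h1
      exact (ConcreteCategory.congr_hom h1 x).symm
    exact (hY n).of_retract (T.map n σ) (T.map n p) (fun i => key (A i)) (key B)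
  pair P h1 h2 n := IndSystem.five_lemma (T.exact_X n P) (T.exact_pair n P) (T.exact_A n P)
    (h1 n) (h2 n) (h1 _) (h2 _)
  total P h1 h2 n := by
    obtain ⟨m, rfl⟩ : ∃ m, n = m - 1 := ⟨n + 1, by ring⟩
    exact IndSystem.five_lemma (T.exact_A m P) (T.exact_X (m - 1) P) (T.exact_pair (m - 1) P)
      (h2 m) (h1 _) (h2 _) (h1 _)
  excision F hF := forall_congr' fun n => IndSystem.IsColimit.iff_of_bijective (T.map n F)
    (fun i => (A i).excision F hF n) (B.excision F hF n)
  orbit := h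
  coproduct {J} X hX n := by
    classical
    have natural : ∀ {C D : HomologyTheory.{u, v, w} G Λ} (φ : C.Hom D)
        (z : ⨁ j, (C.H n).obj (X j).toPair),
        ((φ.app n).app (coproduct X).toPair).hom
          (toModule Λ J _ (fun j => ((C.H n).map (coproductIncl X j)).hom) z) =
        toModule Λ J _ (fun j => ((D.H n).map (coproductIncl X j)).hom)
          (lmap (fun j => ((φ.app n).app (X j).toPair).hom) z) := by
      intro C D φ z
      induction z using DirectSum.induction_on with
      | zero => simp
      | of j x =>
        rw [← DirectSum.lof_eq_of Λ, lmap_lof, toModule_lof, toModule_lof]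
        exact ConcreteCategory.congr_hom ((φ.app n).naturality (coproductIncl X j)) x
      | add x y hx hy => simp only [map_add, hx, hy]
    constructor
    · intro y
      obtain ⟨z, rfl⟩ := (B.disjoint_union X n).2 y
      induction z using DirectSum.induction_on with
      | zero => exact ⟨Classical.arbitrary I, 0, (map_zero _).trans (map_zero _).symm⟩
      | of j x =>
        obtain ⟨i, x, rfl⟩ := (hX j n).surj x
        refine ⟨i, (((A i).H n).map (coproductIncl X j)).hom x, ?_⟩
        refine Eq.trans ?_ (toModule_lof (M := fun j => (B.H n).obj (X j).toPair)
          (N := (B.H n).obj (coproduct X).toPair) Λ j _).symm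
        exact ((T.map n (coproductIncl X j)).comm_g i x).symm
      | add x y hx hy =>
        obtain ⟨i, x', hx⟩ := hx
        obtain ⟨k, y', hy⟩ := hy
        obtain ⟨l, hil, hkl⟩ := exists_ge_ge i k
        refine ⟨l, (T.sys n _).f hil x' + (T.sys n _).f hkl y', ?_⟩
        refine ((map_add _ _ _).trans ?_).trans (map_add _ _ _).symm
        exact congrArg₂ _ (((T.sys n _).g_f hil x').trans hx) (((T.sys n _).g_f hkl y').trans hy)
    · intro i y hy
      obtain ⟨z, rfl⟩ := ((A i).disjoint_union X n).2 y
      have hy0 := (natural (T.g i) z).symm.trans hy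
      have h0 := (B.disjoint_union X n).1 (hy0.trans (map_zero _).symm)
      have h1 : ∀ j, (T.sys n (X j).toPair).g i (z j) = 0 := fun j => by
        have := DFunLike.congr_fun h0 j
        rwa [lmap_apply] at this
      choose k hk hk0 using fun j => (hX j n).inj i (z j) (h1 j)
      obtain ⟨l, hl⟩ := (z.support.image k ∪ {i}).exists_le
      have hil : i ≤ l := hl i (by simp)
      refine ⟨l, hil, ?_⟩
      have h2 : lmap (fun j => (((T.f hil).app n).app (X j).toPair).hom) z = 0 := by
        refine DFinsupp.ext fun j => ?_
        rw [lmap_apply]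
        by_cases hj : j ∈ z.support
        · have hkl : k j ≤ l := hl _ (by
            simp only [Finset.mem_union, Finset.mem_image]
            exact Or.inl ⟨j, hj, rfl⟩)
          have := (T.sys n (X j).toPair).f_f (hk j) hkl (z j)
          rw [hk0 j, map_zero] at this
          exact this.symm
        · rw [DFinsupp.notMem_support_iff.1 hj, map_zero]
          rfl
      refine (natural (T.f hil) z).trans ?_
      exact (congrArg _ h2).trans (map_zero _)

end TheorySystem

end

section Disc

/-! ### The pairs `Z × (Dⁿ, Sⁿ⁻¹)` -/

/-- The face of the cube `Dⁿ` on which the coordinates are prescribed by `s : Fin n → {-1, 0, 1}`,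
`0` meaning that the coordinate is free, parametrized by a cube of the right dimension. The clipping
to `[-1, 1]` only serves to have a total function. -/
noncomputable def face {n k : ℕ} (s : Fin n → SignType) (hs : Fintype.card {i // s i = 0} = k)
    (x : Fin k → ℝ) : disc n :=
  ⟨fun i => max (-1) (min 1 (if h : s i = 0 then x (Fintype.equivFinOfCardEq hs ⟨i, h⟩) else s i)),
    mem_disc.2 fun _ => abs_le.2 ⟨le_max_left _ _, max_le (by norm_num) (min_le_left _ _)⟩⟩

theorem continuous_face {n k : ℕ} (s : Fin n → SignType)
    (hs : Fintype.card {i // s i = 0} = k) : Continuous (face s hs) := by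
  refine Continuous.subtype_mk (continuous_pi fun i => ?_) _
  refine continuous_const.max (continuous_const.min ?_)
  split_ifs
  · fun_prop
  · fun_prop

theorem clip_eq {a : ℝ} (h : |a| ≤ 1) : max (-1) (min 1 a) = a := by
  rw [min_eq_right (abs_le.1 h).2, max_eq_right (abs_le.1 h).1]

theorem face_free {n k : ℕ} {s : Fin n → SignType} (hs : Fintype.card {i // s i = 0} = k)
    {x : Fin k → ℝ} (hx : x ∈ disc k) (j : Fin k) :
    (face s hs x).1 ((Fintype.equivFinOfCardEq hs).symm j).1 = x j := by
  have h := ((Fintype.equivFinOfCardEq hs).symm j).2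
  simp only [face, dif_pos h, Subtype.coe_eta, Equiv.apply_symm_apply]
  exact clip_eq (mem_disc.1 hx j)

theorem face_of_eq_zero {n k : ℕ} {s : Fin n → SignType} (hs : Fintype.card {i // s i = 0} = k)
    {x : Fin k → ℝ} (hx : x ∈ disc k) {i : Fin n} (h : s i = 0) :
    (face s hs x).1 i = x (Fintype.equivFinOfCardEq hs ⟨i, h⟩) := by
  simp only [face, dif_pos h]
  exact clip_eq (mem_disc.1 hx _)

theorem face_of_ne_zero {n k : ℕ} {s : Fin n → SignType} (hs : Fintype.card {i // s i = 0} = k)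
    {x : Fin k → ℝ} {i : Fin n} (h : s i ≠ 0) : (face s hs x).1 i = s i := by
  simp only [face, dif_neg h]
  refine clip_eq ?_
  rcases hsi : s i <;> simp

theorem abs_coe_sign {s : SignType} (h : s ≠ 0) : |(s : ℝ)| = 1 := by
  rcases s <;> simp_all

open Classical in
/-- The open face containing a point of the cube. -/
noncomputable def signPattern {n : ℕ} (c : Fin n → ℝ) (i : Fin n) : SignType :=
  if c i = 1 then 1 else if c i = -1 then -1 else 0

theorem signPattern_eq_zero {n : ℕ} {c : Fin n → ℝ} {i : Fin n} (hc : c ∈ disc n) :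
    signPattern c i = 0 ↔ |c i| < 1 := by
  have h1 := mem_disc.1 hc i
  rw [lt_iff_le_and_ne, and_iff_right h1, Ne, abs_eq zero_le_one]
  unfold signPattern
  split_ifs <;> simp_all

theorem coe_signPattern {n : ℕ} {c : Fin n → ℝ} {i : Fin n} (h : signPattern c i ≠ 0) :
    (signPattern c i : ℝ) = c i := by
  unfold signPattern at *
  split_ifs at * <;> simp_all

theorem signPattern_face {n k : ℕ} {s : Fin n → SignType}
    (hs : Fintype.card {i // s i = 0} = k) {x : Fin k → ℝ} (hx : x ∈ ball (0 : Fin k → ℝ) 1) :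
    signPattern (face s hs x).1 = s := by
  funext i
  by_cases h : s i = 0
  · rw [h, signPattern_eq_zero (face s hs x).2, face_of_eq_zero hs (ball_subset_closedBall hx) h]
    exact mem_openDisc.1 hx _
  · have h1 := face_of_ne_zero hs (x := x) h
    unfold signPattern
    rw [h1]
    rcases hsi : s i
    · exact (h hsi).elim
    · norm_num
    · norm_num

theorem exists_face {n : ℕ} (c : disc n) :
    ∃ y ∈ ball (0 : Fin (Fintype.card {i // signPattern c.1 i = 0}) → ℝ) 1,
      face (signPattern c.1) rfl y = c := by
  let y : Fin (Fintype.card {i // signPattern c.1 i = 0}) → ℝ :=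
    fun j => c.1 ((Fintype.equivFinOfCardEq rfl).symm j).1
  have hy : y ∈ ball (0 : Fin (Fintype.card {i // signPattern c.1 i = 0}) → ℝ) 1 :=
    mem_openDisc.2 fun j =>
      (signPattern_eq_zero c.2).1 ((Fintype.equivFinOfCardEq rfl).symm j).2
  refine ⟨y, hy, Subtype.ext (funext fun i => ?_)⟩
  by_cases h : signPattern c.1 i = 0
  · rw [face_of_eq_zero rfl (ball_subset_closedBall hy) h]
    simp [y]
  · rw [face_of_ne_zero rfl h, coe_signPattern h]

variable {G : Type u} [Group G] (Z : Type u) [MulAction G Z]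

/-- The action on the first factor of `Z × Dⁿ`. -/
instance discAction (n : ℕ) : MulAction G (Σ _ : Z, disc n) where
  smul g p := ⟨g • p.1, p.2⟩
  one_smul p := by
    change (⟨(1 : G) • p.1, p.2⟩ : Σ _ : Z, disc n) = p
    rw [one_smul]
  mul_smul g h p := by
    change (⟨(g * h) • p.1, p.2⟩ : Σ _ : Z, disc n) = ⟨g • h • p.1, p.2⟩
    rw [mul_smul]

/-- The product of the discrete `G`-set `Z` with the cube `Dⁿ`, whose cells are the faces. -/
noncomputable def discStructure (n : ℕ) : GCWStructure G (Σ _ : Z, disc n) where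
  cell k := Z × {s : Fin n → SignType // Fintype.card {i // s i = 0} = k}
  cellAct k :=
    { smul := fun g e => (g • e.1, e.2)
      one_smul := fun e => Prod.ext (one_smul G e.1) rfl
      mul_smul := fun g h e => Prod.ext (mul_smul g h e.1) rfl }
  map k e x := ⟨e.1, face e.2.1 e.2.2 x⟩
  continuousOn k e := ((continuous_sigmaMk (σ := fun _ : Z => disc n)).comp
    (continuous_face e.2.1 e.2.2)).continuousOn
  map_smul k g e x _ := rfl
  boundary := by
    rintro k ⟨z, s, hs⟩ x hx
    have hx' := sphere_subset_closedBall hx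
    obtain ⟨y, hy, h⟩ := exists_face (face s hs x)
    refine ⟨_, ?_, (z, ⟨_, rfl⟩), y, ball_subset_closedBall hy, congrArg (Sigma.mk z) h⟩
    obtain ⟨j, hj⟩ : ∃ j, ¬ |x j| < 1 := by
      by_contra! hlt
      have := mem_openDisc.2 hlt
      rw [mem_sphere] at hx
      rw [mem_ball, hx] at this
      exact lt_irrefl _ this
    refine lt_of_lt_of_eq ?_ hs
    rw [Fintype.card_subtype, Fintype.card_subtype]
    refine Finset.card_lt_card (Finset.ssubset_iff_of_subset ?_ |>.2
      ⟨((Fintype.equivFinOfCardEq hs).symm j).1, ?_, ?_⟩)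
    · intro i
      simp only [Finset.mem_filter, Finset.mem_univ, true_and]
      intro hi
      by_contra h0
      rw [signPattern_eq_zero (face s _ x).2, face_of_ne_zero _ h0, abs_coe_sign h0] at hi
      exact lt_irrefl _ hi
    · simpa using ((Fintype.equivFinOfCardEq hs).symm j).2
    · simp only [Finset.mem_filter, Finset.mem_univ, true_and]
      rwa [signPattern_eq_zero (face s _ x).2, face_free _ hx']
  bijective := by
    constructor
    · rintro ⟨k, ⟨z, s, hs⟩, x⟩ ⟨k', ⟨z', s', hs'⟩, x'⟩ h
      simp only [Sigma.mk.injEq, heq_eq_eq] at h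
      obtain ⟨rfl, h⟩ := h
      obtain rfl : s = s' := by
        rw [← signPattern_face hs x.2, h, signPattern_face hs' x'.2]
      obtain rfl : k = k' := hs.symm.trans hs'
      have : x = x' := Subtype.ext (funext fun j => by
        rw [← face_free hs (ball_subset_closedBall x.2) j, h,
          face_free hs (ball_subset_closedBall x'.2) j])
      rw [this]
    · rintro ⟨z, c⟩
      obtain ⟨y, hy, h⟩ := exists_face c
      exact ⟨⟨_, (z, ⟨_, rfl⟩), ⟨y, hy⟩⟩, congrArg (Sigma.mk z) h⟩
  isClosed_of_subset m C hC h := by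
    refine isClosed_sigma_iff.2 fun z => ?_
    have h1 : (fun c => (⟨z, c⟩ : Σ _ : Z, disc n)) ⁻¹' C = ⋃ s : {s : Fin n → SignType // Fintype.card {i // s i = 0} < m},
        face s.1 rfl '' (closedBall 0 1 ∩ face s.1 rfl ⁻¹' ((fun c => (⟨z, c⟩ : Σ _ : Z, disc n)) ⁻¹' C)) := by
      ext c
      simp only [mem_iUnion]
      constructor
      · intro hc
        obtain ⟨k, hk, ⟨z', s, rfl⟩, y, hy, h⟩ := hC _ hc
        simp only [Sigma.mk.injEq, heq_eq_eq] at h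
        obtain ⟨rfl, rfl⟩ := h
        exact ⟨⟨s, hk⟩, y, ⟨hy, hc⟩, rfl⟩
      · rintro ⟨s, y, ⟨-, hy⟩, rfl⟩
        exact hy
    rw [h1]
    refine isClosed_iUnion_of_finite fun s => ?_
    refine (IsCompact.image ?_ (continuous_face _ _)).isClosed
    exact (isCompact_closedBall _ _).of_isClosed_subset (h _ s.2 (z, ⟨s.1, rfl⟩))
      inter_subset_left
  isClosed_of_inter C h := by
    convert h (n + 1) using 1
    refine (inter_eq_left.2 ?_).symm
    rintro ⟨z, c⟩ -
    obtain ⟨y, hy, h⟩ := exists_face c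
    refine ⟨_, Nat.lt_succ_iff.2 ?_, (z, ⟨_, rfl⟩), y, ball_subset_closedBall hy,
      congrArg (Sigma.mk z) h⟩
    exact (Fintype.card_subtype_le _).trans (Fintype.card_fin n).le

variable (G) in
/-- The subspace `Z × Sⁿ⁻¹`. -/
def discBoundary (n : ℕ) : Set (Σ _ : Z, disc n) := {p | p.2.1 ∉ ball (0 : Fin n → ℝ) 1}

theorem isSubcomplex_discBoundary (n : ℕ) :
    (discStructure (G := G) Z n).IsSubcomplex (discBoundary Z n) := by
  refine ⟨fun g p hp => hp, ?_⟩
  intro k e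
  obtain ⟨z, s, hs⟩ : Z × {s : Fin n → SignType // Fintype.card {i // s i = 0} = k} := e
  by_cases h : ∃ i, s i ≠ 0
  · left
    intro x hx hb
    obtain ⟨i, hi⟩ := h
    have : |(face s hs x).1 i| < 1 := mem_openDisc.1 hb i
    rw [face_of_ne_zero hs hi, abs_coe_sign hi] at this
    exact lt_irrefl _ this
  · right
    push Not at h
    intro x hx hb
    refine hb (mem_openDisc.2 fun i => ?_)
    change |(face s hs x).1 i| < 1
    rw [face_of_eq_zero hs (ball_subset_closedBall hx) (h i)]
    exact mem_openDisc.1 hx _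

theorem discBoundary_subset_skelLT (n : ℕ) :
    discBoundary Z n ⊆ (discStructure (G := G) Z n).skelLT n := by
  rintro ⟨z, c⟩ hc
  obtain ⟨y, hy, h⟩ := exists_face c
  refine ⟨Fintype.card {i // signPattern c.1 i = 0}, ?_, ((z, ⟨_, rfl⟩) :
    Z × {s : Fin n → SignType // Fintype.card {i // s i = 0} = _}), y, ball_subset_closedBall hy,
    congrArg (Sigma.mk z) h⟩
  refine lt_of_lt_of_eq ?_ (Fintype.card_fin n)
  obtain ⟨i, hi⟩ : ∃ i, ¬ |c.1 i| < 1 := by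
    by_contra! h
    exact hc (mem_openDisc.2 h)
  exact Fintype.card_subtype_lt (x := i) (by rwa [signPattern_eq_zero c.2])

/-- The complex `Z × Dⁿ`. -/
noncomputable def discComplex (n : ℕ) : GCWComplex G where
  carrier := Σ _ : Z, disc n
  cont := ⟨fun g => continuous_sigma fun z => continuous_sigmaMk (σ := fun _ : Z => disc n) (i := g • z)⟩
  exists_structure := ⟨discStructure Z n⟩

/-- The pair `Z × (Dⁿ, Sⁿ⁻¹)`. -/
noncomputable def discPair (n : ℕ) : GCWPair G where
  X := discComplex Z n
  A := discBoundary Z n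
  isSub := ⟨discStructure Z n, isSubcomplex_discBoundary Z n⟩

end Disc

/-! ### Induction over the cells: finite-dimensional complexes -/

section FiniteDim

variable {G : Type u} [Group G]

theorem GCWStructure.IsSubcomplex.nonempty_iso_sub {P : GCWPair G} {S : GCWStructure G P.X.carrier}
    (hA : S.IsSubcomplex P.A) : Nonempty (hA.complex.toPair ≅ P.sub.toPair) := by
  let f : hA.complex.toPair ⟶ P := hA.incl ≫ P.inclPair
  have := GCWPair.isIso_liftSub f rfl IsEmbedding.subtypeVal Subtype.range_val
  exact ⟨asIso (GCWPair.liftSub f rfl _)⟩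

/-- The characteristic maps of the `n`-cells, as a map of pairs. -/
noncomputable def charMap {X : GCWComplex G} (S : GCWStructure G X.carrier) (n : ℕ) :
    discPair (S.cell n) n ⟶ (⟨X, S.skelLT n, S, S.isSubcomplex_skelLT n⟩ : GCWPair G) where
  toFun := fun p : Σ _ : S.cell n, disc n => S.map n p.1 p.2
  continuous := continuous_sigma fun e => S.continuous_map n e
  equivariant := fun g (p : Σ _ : S.cell n, disc n) => S.map_smul n g p.1 p.2 p.2.2
  mapsTo := fun (p : Σ _ : S.cell n, disc n) hp =>
    GCWStructure.map_sphere_mem_skelLT (mem_sphere_of_disc p.2.2 hp)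

theorem isRelHomeo_charMap {X : GCWComplex G} (S : GCWStructure G X.carrier) (n : ℕ)
    (hS : S.skelLT (n + 1) = univ) : IsRelHomeo (charMap S n) where
  mem_of_mem p hp hb := lt_irrefl n (GCWStructure.lt_of_map_mem_skelLT hb hp)
  injOn := by
    rintro ⟨e, y⟩ ⟨e', y'⟩ hy hy' h
    obtain ⟨rfl, h2⟩ := GCWStructure.openCell_unique' (not_not.1 hy) (not_not.1 hy') h
    exact congrArg (Sigma.mk e) (Subtype.ext h2)
  surj c hc := by
    obtain ⟨m, hm, e, y, hy, rfl⟩ :=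
      GCWStructure.exists_openCell_of_mem_skelLT (hS ▸ mem_univ c : c ∈ S.skelLT (n + 1))
    obtain rfl : m = n := by
      refine le_antisymm (Nat.lt_succ_iff.1 hm) (not_lt.1 fun h => hc ?_)
      exact GCWStructure.map_mem_skelLT h e (ball_subset_closedBall hy)
    exact ⟨⟨e, y, ball_subset_closedBall hy⟩, rfl⟩
  isClosed C hC h := by
    refine S.isClosed_iff.2 fun m e => ?_
    rcases lt_trichotomy m n with hm | rfl | hm
    · rcases hC with hC | hC
      · convert isClosed_univ
        exact eq_univ_of_forall fun y => hC (GCWStructure.map_mem_skelLT hm e y.2)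
      · convert isClosed_empty
        exact eq_empty_of_forall_notMem fun y hy =>
          disjoint_left.1 hC (GCWStructure.map_mem_skelLT hm e y.2) hy
    · exact isClosed_sigma_iff.1 h e
    · have h0 : (0 : Fin m → ℝ) ∈ ball (0 : Fin m → ℝ) 1 := by simp
      have := GCWStructure.lt_of_map_mem_skelLT (S := S) (n := n + 1) (e := e) h0
        (hS ▸ mem_univ _)
      omega

/-- A discrete `G`-set is the disjoint union of its orbits. -/
theorem CellularClass.discComplex_zero {Q : GCWPair.{u} G → Prop} (hQ : CellularClass Q)
    (Z : Type u) [MulAction G Z] : Q (discComplex Z 0).toPair := by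
  let z : MulAction.orbitRel.Quotient G Z → Z := Quotient.out
  have hz : ∀ ω, (Quotient.mk (MulAction.orbitRel G Z) (z ω)) = ω := Quotient.out_eq
  let L : MulAction.orbitRel.Quotient G Z → Subgroup G := fun ω => MulAction.stabilizer G (z ω)
  let P : ∀ ω, GCWPair G := fun ω => (indFunctor (L ω).subtype).obj (point (L ω))
  let m : ∀ ω, (P ω).X.carrier → Z := fun ω => Ind.lift (L ω).subtype (fun g _ => g • z ω)
    (fun g h _ => by
      change (g * (h : G)) • z ω = g • z ω
      rw [mul_smul, h.2])
  let f : ∀ ω, (P ω).X.toPair ⟶ (discComplex Z 0).toPair := fun ω =>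
    { toFun := fun p => (⟨m ω p, 0, by simp⟩ : Σ _ : Z, disc 0)
      continuous := Ind.continuous_of _ fun g =>
        continuous_const (y := (⟨g • z ω, 0, by simp⟩ : Σ _ : Z, disc 0))
      equivariant := fun k p => by
        obtain ⟨g, x, rfl⟩ := Ind.exists_mk _ p
        exact congrArg (fun z : Z => (⟨z, 0, by simp⟩ : Σ _ : Z, disc 0)) (mul_smul k g (z ω))
      mapsTo := fun _ h => h.elim }
  have hdisc : DiscreteTopology (discComplex (G := G) Z 0).carrier :=
    inferInstanceAs (DiscreteTopology (Σ _ : Z, disc 0))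
  refine hQ.of_isHomeomorph_sigma f ⟨?_, fun U _ => isOpen_discrete _, ?_, ?_⟩ fun ω => ?_
  · exact continuous_sigma fun ω => (f ω).continuous
  · rintro ⟨ω, p⟩ ⟨ω', p'⟩ h
    obtain ⟨g, ⟨⟩, rfl⟩ := Ind.exists_mk _ p
    obtain ⟨g', ⟨⟩, rfl⟩ := Ind.exists_mk _ p'
    have h1 : g • z ω = g' • z ω' := congrArg Sigma.fst h
    obtain rfl : ω = ω' := by
      rw [← hz ω, ← hz ω']
      refine Quotient.sound ⟨g⁻¹ * g', ?_⟩
      change (g⁻¹ * g') • z ω' = z ω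
      rw [mul_smul, ← h1, inv_smul_smul]
    refine congrArg (Sigma.mk ω) ((Ind.mk_eq_iff _).2 ⟨⟨g⁻¹ * g', ?_⟩, ?_, rfl⟩)
    · change (g⁻¹ * g') • z ω = z ω
      rw [mul_smul, ← h1, inv_smul_smul]
    · exact (mul_inv_cancel_left g g').symm
  · rintro ⟨x, y⟩
    obtain ⟨g, hg⟩ : ∃ g : G, g • z (Quotient.mk _ x) = x := by
      have := Quotient.exact (hz (Quotient.mk (MulAction.orbitRel G Z) x))
      obtain ⟨g, hg⟩ := (MulAction.orbitRel G Z).symm this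
      exact ⟨g, hg⟩
    refine ⟨⟨Quotient.mk _ x, Ind.mk _ g PUnit.unit⟩, ?_⟩
    have hy : y = ⟨0, by simp⟩ := Subsingleton.elim _ _
    rw [hy]
    exact congrArg (fun z : Z => (⟨z, 0, by simp⟩ : Σ _ : Z, disc 0)) hg
  · have : IsIso (P ω).inclPair := GCWPair.isIso_of_isHomeomorph _ (Homeomorph.refl _).isHomeomorph
      fun x hx => by
        rw [indPoint_A] at hx
        exact hx
    exact hQ.of_iso (asIso (P ω).inclPair) (hQ.orbit _)

/-- `Z × Dⁿ` is homotopy equivalent to the discrete `G`-set `Z`. -/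
theorem CellularClass.discComplex {Q : GCWPair.{u} G → Prop} (hQ : CellularClass Q)
    (Z : Type u) [MulAction G Z] (n : ℕ) : Q (discComplex Z n).toPair := by
  let o : ∀ n, disc n := fun n => ⟨0, by simp⟩
  let f : ∀ m k, (EquivHomology.discComplex (G := G) Z m).toPair ⟶
      (EquivHomology.discComplex (G := G) Z k).toPair := fun m k =>
    { toFun := fun p : Σ _ : Z, disc m => (⟨p.1, o k⟩ : Σ _ : Z, disc k)
      continuous := continuous_sigma fun z =>
        continuous_const (y := (⟨z, o k⟩ : Σ _ : Z, disc k))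
      equivariant := fun _ _ => rfl
      mapsTo := fun _ h => h.elim }
  have hmem : ∀ (c : disc n) (t : unitInterval), (1 - (t : ℝ)) • c.1 ∈ disc n := by
    intro c t
    rw [mem_closedBall_zero_iff, norm_smul, Real.norm_eq_abs, abs_of_nonneg (sub_nonneg.2 t.2.2)]
    have h1 := mem_closedBall_zero_iff.1 c.2
    nlinarith [t.2.1, t.2.2, norm_nonneg c.1]
  refine hQ.of_retract (f n 0) (f 0 n) ⟨fun p : (Σ _ : Z, disc n) × unitInterval =>
    (⟨p.1.1, (1 - (p.2 : ℝ)) • p.1.2.1, hmem _ _⟩ : Σ _ : Z, disc n), ?_, ?_, ?_, ?_, ?_⟩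
    (hQ.discComplex_zero Z)
  · refine continuous_sigma_prod fun z => continuous_sigmaMk.comp (Continuous.subtype_mk ?_ _)
    fun_prop
  · rintro ⟨z, c⟩
    refine congrArg (Sigma.mk z) (Subtype.ext ?_)
    change (1 - (0 : ℝ)) • c.1 = c.1
    rw [sub_zero, one_smul]
  · rintro ⟨z, c⟩
    refine congrArg (Sigma.mk z) (Subtype.ext ?_)
    change (1 - (1 : ℝ)) • c.1 = 0
    rw [sub_self, zero_smul]
  · intro _ _ _
    rfl
  · intro _ h
    exact h.elim

/-- A cellular class contains the finite-dimensional complexes: `(Xⁿ, Xⁿ⁻¹)` is relatively homeomorphic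
to the pair `Z × (Dⁿ, Sⁿ⁻¹)` for the `G`-set `Z` of `n`-cells. -/
theorem CellularClass.of_skelLT_eq_univ {Q : GCWPair.{u} G → Prop} (hQ : CellularClass Q) {n : ℕ}
    {X : GCWComplex G} (S : GCWStructure G X.carrier) (hS : S.skelLT n = univ) : Q X.toPair := by
  induction n generalizing X with
  | zero =>
    have hX : ∀ x : X.carrier, False := fun x => by
      obtain ⟨m, hm, _⟩ : x ∈ S.skelLT 0 := hS ▸ mem_univ x
      omega
    refine hQ.of_isHomeomorph_sigma (I := PEmpty) (X := fun i => i.elim) (fun i => i.elim) ?_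
      fun i => i.elim
    refine ⟨continuous_sigma fun i => i.elim, fun U _ => ?_, fun x => x.1.elim,
      fun x => (hX x).elim⟩
    convert isOpen_empty
    exact eq_empty_of_forall_notMem fun x => (hX x).elim
  | succ n ih =>
    have hsub : ∀ (P : GCWPair G) (T : GCWStructure G P.X.carrier) (hT : T.IsSubcomplex P.A),
        P.A ⊆ T.skelLT n → Q P.sub.toPair := by
      intro P T hT h
      obtain ⟨e⟩ := hT.nonempty_iso_sub
      refine hQ.of_iso e.symm (ih hT.structure (eq_univ_of_forall fun a => ?_))
      exact hT.structure_mem_skelLT n (h a.2)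
    refine hQ.total ⟨X, S.skelLT n, S, S.isSubcomplex_skelLT n⟩
      (hsub _ S (S.isSubcomplex_skelLT n) Subset.rfl) ?_
    refine (hQ.excision _ (isRelHomeo_charMap S n hS)).1 (hQ.pair _ ?_ (hQ.discComplex _ n))
    exact hsub (discPair (S.cell n) n) (discStructure _ n) (isSubcomplex_discBoundary _ n)
      (discBoundary_subset_skelLT _ n)

end FiniteDim

/-! ### Products with a cell system -/

section SplitDisc

variable {p q n : ℕ} (h : p + q = n)

/-- The first `p` coordinates of a point of `ℝᵖ⁺ᵍ`. -/
def fstCoord (y : Fin n → ℝ) : Fin p → ℝ := fun i => y (Fin.cast h (Fin.castAdd q i))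

/-- The last `q` coordinates of a point of `ℝᵖ⁺ᵍ`. -/
def sndCoord (y : Fin n → ℝ) : Fin q → ℝ := fun i => y (Fin.cast h (Fin.natAdd p i))

/-- The point of `ℝᵖ⁺ᵍ` with given coordinates. -/
def joinCoord (a : Fin p → ℝ) (b : Fin q → ℝ) : Fin n → ℝ :=
  fun i => Fin.append a b (Fin.cast h.symm i)

@[simp] theorem fstCoord_joinCoord (a : Fin p → ℝ) (b : Fin q → ℝ) :
    fstCoord h (joinCoord h a b) = a := by
  subst h
  funext i
  simp [fstCoord, joinCoord]

@[simp] theorem sndCoord_joinCoord (a : Fin p → ℝ) (b : Fin q → ℝ) :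
    sndCoord h (joinCoord h a b) = b := by
  subst h
  funext i
  simp [sndCoord, joinCoord]

theorem forall_coord {P : Fin n → Prop} : (∀ i, P i) ↔
    (∀ i, P (Fin.cast h (Fin.castAdd q i))) ∧ ∀ i, P (Fin.cast h (Fin.natAdd p i)) := by
  subst h
  refine ⟨fun H => ⟨fun i => H _, fun i => H _⟩, fun H i => ?_⟩
  exact Fin.addCases (motive := P) H.1 H.2 i

theorem eq_of_coord {y y' : Fin n → ℝ} (h1 : fstCoord h y = fstCoord h y')
    (h2 : sndCoord h y = sndCoord h y') : y = y' :=
  funext ((forall_coord h).2 ⟨fun i => congrFun h1 i, fun i => congrFun h2 i⟩)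

theorem mem_disc_iff_coord {y : Fin n → ℝ} :
    y ∈ disc n ↔ fstCoord h y ∈ disc p ∧ sndCoord h y ∈ disc q := by
  simp only [mem_disc]
  exact forall_coord h

theorem mem_openDisc_iff_coord {y : Fin n → ℝ} : y ∈ ball (0 : Fin n → ℝ) 1 ↔
    fstCoord h y ∈ ball (0 : Fin p → ℝ) 1 ∧ sndCoord h y ∈ ball (0 : Fin q → ℝ) 1 := by
  simp only [mem_openDisc]
  exact forall_coord h

theorem joinCoord_mem_disc {a : Fin p → ℝ} {b : Fin q → ℝ} (ha : a ∈ disc p) (hb : b ∈ disc q) :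
    joinCoord h a b ∈ disc n := by
  rw [mem_disc_iff_coord h]
  rw [fstCoord_joinCoord, sndCoord_joinCoord]
  exact ⟨ha, hb⟩

theorem continuous_fstCoord : Continuous (fstCoord h) :=
  continuous_pi fun _ => continuous_apply _

theorem continuous_sndCoord : Continuous (sndCoord h) :=
  continuous_pi fun _ => continuous_apply _

theorem continuous_joinCoord :
    Continuous fun z : (Fin p → ℝ) × (Fin q → ℝ) => joinCoord h z.1 z.2 := by
  refine continuous_pi ((forall_coord h).2 ⟨fun i => ?_, fun i => ?_⟩)
  · simp only [joinCoord, Fin.cast_cast, Fin.cast_eq_self, Fin.append_left]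
    fun_prop
  · simp only [joinCoord, Fin.cast_cast, Fin.cast_eq_self, Fin.append_right]
    fun_prop

end SplitDisc

/-- A closed piece of the disc of an `n`-cell `e` on which the characteristic map factors through a
cell of smaller dimension. -/
structure CellFace {E : Type u} {cell : ℕ → Type u} (map : ∀ n, cell n → (Fin n → ℝ) → E) {n : ℕ}
    (e : cell n) where
  dim : ℕ
  dim_lt : dim < n
  face : cell dim
  carrier : Set (disc n)
  isClosed : IsClosed carrier
  proj : C(disc n, disc dim)
  map_eq : ∀ y ∈ carrier, map n e y = map dim face (proj y)

/-- A `G`-set `E` decomposed into open cells whose boundaries are finite unions of faces. The set `E`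
carries no topology; only its products with `G`-spaces will be topologized. -/
structure CellSystem (G E : Type u) [Group G] [MulAction G E] where
  cell : ℕ → Type u
  [cellAct : ∀ n, MulAction G (cell n)]
  map : ∀ n, cell n → (Fin n → ℝ) → E
  map_smul : ∀ n (g : G) e, ∀ x ∈ disc n, map n (g • e) x = g • map n e x
  bijective : Function.Bijective
    (fun p : (Σ n, cell n × ball (0 : Fin n → ℝ) 1) => map p.1 p.2.1 p.2.2)
  faces : ∀ n (e : cell n), ∃ L : Set (CellFace map e), L.Finite ∧
    ∀ y : disc n, (y : Fin n → ℝ) ∉ ball (0 : Fin n → ℝ) 1 → ∃ f ∈ L, y ∈ f.carrier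

attribute [instance] CellSystem.cellAct

namespace CellSystem

variable {G E : Type u} [Group G] [MulAction G E] (S : CellSystem G E)

theorem exists_openCell_le {n : ℕ} (e : S.cell n) {y : Fin n → ℝ} (hy : y ∈ disc n) :
    ∃ m ≤ n, ∃ e' : S.cell m, ∃ y' ∈ ball (0 : Fin m → ℝ) 1, S.map m e' y' = S.map n e y := by
  induction n using Nat.strong_induction_on with
  | _ n ih =>
    by_cases hy' : y ∈ ball (0 : Fin n → ℝ) 1
    · exact ⟨n, le_rfl, e, y, hy', rfl⟩
    · obtain ⟨L, -, hL⟩ := S.faces n e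
      obtain ⟨f, -, hf⟩ := hL ⟨y, hy⟩ hy'
      obtain ⟨m, hm, r⟩ := ih f.dim f.dim_lt f.face (f.proj ⟨y, hy⟩).2
      rw [← f.map_eq _ hf] at r
      exact ⟨m, hm.trans f.dim_lt.le, r⟩

variable {S}

theorem openCell_unique {m m' : ℕ} {e : S.cell m} {e' : S.cell m'} {y : Fin m → ℝ}
    {y' : Fin m' → ℝ} (hy : y ∈ ball (0 : Fin m → ℝ) 1) (hy' : y' ∈ ball (0 : Fin m' → ℝ) 1)
    (h : S.map m e y = S.map m' e' y') :
    (⟨m, e, y⟩ : Σ n, S.cell n × (Fin n → ℝ)) = ⟨m', e', y'⟩ := by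
  have h2 := @S.bijective.1 ⟨m, e, ⟨y, hy⟩⟩ ⟨m', e', ⟨y', hy'⟩⟩ h
  obtain rfl : m = m' := congrArg Sigma.fst h2
  simp only [Sigma.mk.injEq, heq_eq_eq, Prod.mk.injEq, true_and, Subtype.mk.injEq] at h2 ⊢
  exact h2

theorem dim_le {m n : ℕ} {e : S.cell m} {e' : S.cell n} {y : Fin m → ℝ} {y' : Fin n → ℝ}
    (hy : y ∈ ball (0 : Fin m → ℝ) 1) (hy' : y' ∈ disc n) (h : S.map m e y = S.map n e' y') :
    m ≤ n := by
  obtain ⟨k, hk, e'', y'', hy'', h'⟩ := S.exists_openCell_le e' hy'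
  have := congrArg Sigma.fst (openCell_unique hy hy'' (h.trans h'.symm))
  simp only at this
  omega

/-- The product `E × X`, with the topology coinduced by the products `Dⁿ × X` of the cells of `E`
with the space `X`. -/
def Product (_ : CellSystem G E) (X : Type u) : Type u := E × X

variable {X : Type u}

instance [MulAction G X] : MulAction G (S.Product X) := inferInstanceAs (MulAction G (E × X))

instance [TopologicalSpace X] : TopologicalSpace (S.Product X) :=
  ⨆ n, ⨆ e : S.cell n, .coinduced (fun z : disc n × X => ((S.map n e z.1, z.2) : E × X))
    inferInstance

variable (S) in
/-- The product of a characteristic map with the identity. -/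
def cellProd {n : ℕ} (e : S.cell n) (z : disc n × X) : S.Product X := (S.map n e z.1, z.2)

theorem exists_cellProd (p : S.Product X) :
    ∃ n, ∃ e : S.cell n, ∃ y : disc n, ∃ x, S.cellProd e (y, x) = p := by
  obtain ⟨⟨n, e, y⟩, h⟩ := S.bijective.2 p.1
  exact ⟨n, e, ⟨y, ball_subset_closedBall y.2⟩, p.2, Prod.ext h rfl⟩

variable [TopologicalSpace X]

theorem isClosed_iff {C : Set (S.Product X)} :
    IsClosed C ↔ ∀ n (e : S.cell n), IsClosed (S.cellProd e ⁻¹' C) := by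
  refine isClosed_iSup_iff.trans (forall_congr' fun n => isClosed_iSup_iff.trans ?_)
  exact forall_congr' fun e => isClosed_coinduced

theorem isOpen_iff {U : Set (S.Product X)} :
    IsOpen U ↔ ∀ n (e : S.cell n), IsOpen (S.cellProd e ⁻¹' U) := by
  simp only [← isClosed_compl_iff, isClosed_iff, preimage_compl]

theorem continuous_cellProd {n : ℕ} (e : S.cell n) :
    Continuous (S.cellProd e : disc n × X → S.Product X) :=
  continuous_iff_isClosed.2 fun _ hC => isClosed_iff.1 hC n e

theorem continuous_iff {W : Type*} [TopologicalSpace W] {f : S.Product X → W} :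
    Continuous f ↔ ∀ n (e : S.cell n), Continuous fun z : disc n × X => f (S.cellProd e z) := by
  refine ⟨fun h n e => h.comp (continuous_cellProd e), fun h => ?_⟩
  exact continuous_iff_isClosed.2 fun C hC => isClosed_iff.2 fun n e => hC.preimage (h n e)

theorem isQuotientMap_cellProd :
    IsQuotientMap (fun s : Σ n, Σ _ : S.cell n, disc n × X => S.cellProd s.2.1 s.2.2) := by
  refine isQuotientMap_iff_isClosed.2 ⟨fun p => ?_, fun C => ?_⟩
  · obtain ⟨n, e, y, x, rfl⟩ := exists_cellProd p
    exact ⟨⟨n, e, y, x⟩, rfl⟩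
  · rw [isClosed_iff, isClosed_sigma_iff]
    refine forall_congr' fun n => ?_
    rw [isClosed_sigma_iff]
    rfl

theorem continuous_prod {Z W : Type*} [TopologicalSpace Z] [LocallyCompactSpace Z]
    [TopologicalSpace W] {f : S.Product X × Z → W}
    (h : ∀ n (e : S.cell n), Continuous fun z : (disc n × X) × Z => f (S.cellProd e z.1, z.2)) :
    Continuous f :=
  isQuotientMap_cellProd.continuous_lift_prod_left
    (continuous_sigma_prod fun n => continuous_sigma_prod fun e => h n e)

theorem continuous_prodSnd : Continuous fun p : S.Product X => p.2 :=
  continuous_iff.2 fun _ _ => continuous_snd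

/-! #### The cells of a product -/

variable [MulAction G X]

instance [ContinuousConstSMul G X] : ContinuousConstSMul G (S.Product X) where
  continuous_const_smul g := continuous_iff.2 fun n e => by
    have h : ∀ z : disc n × X, g • S.cellProd e z = S.cellProd (g • e) (z.1, g • z.2) :=
      fun z => Prod.ext (S.map_smul n g e z.1 z.1.2).symm rfl
    simp only [h]
    exact (continuous_cellProd _).comp (by fun_prop)

variable (S) (T : GCWStructure G X)

/-- The cells of dimension `n` of a product. -/
abbrev prodCell (n : ℕ) : Type u :=
  Σ k : {k : ℕ × ℕ // k.1 + k.2 = n}, S.cell k.1.1 × T.cell k.1.2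

instance (n : ℕ) : MulAction G (S.prodCell T n) where
  smul g e := ⟨e.1, g • e.2⟩
  one_smul e := congrArg (Sigma.mk e.1) (one_smul G e.2)
  mul_smul g h e := congrArg (Sigma.mk e.1) (mul_smul g h e.2)

/-- The characteristic maps of a product. -/
def prodMap (n : ℕ) (e : S.prodCell T n) (y : Fin n → ℝ) : S.Product X :=
  (S.map _ e.2.1 (fstCoord e.1.2 y), T.map _ e.2.2 (sndCoord e.1.2 y))

variable {S T}

theorem exists_prodMap_eq {p q : ℕ} (e : S.cell p) (e' : T.cell q) (y : disc p) (y' : disc q) :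
    ∃ z ∈ disc (p + q), S.prodMap T (p + q) ⟨⟨(p, q), rfl⟩, e, e'⟩ z =
      S.cellProd e (y, T.map q e' y') := by
  refine ⟨joinCoord rfl y.1 y'.1, joinCoord_mem_disc _ y.2 y'.2, ?_⟩
  simp only [prodMap, fstCoord_joinCoord, sndCoord_joinCoord]
  rfl

theorem isClosed_of_prodCell {C : Set (S.Product X)} (n : ℕ)
    (hC : ∀ c ∈ C, ∃ m < n, ∃ e : S.prodCell T m, ∃ y ∈ disc m, S.prodMap T m e y = c)
    (h : ∀ m < n, ∀ e : S.prodCell T m, IsClosed (disc m ∩ S.prodMap T m e ⁻¹' C)) :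
    IsClosed C := by
  refine isClosed_iff.2 fun p e => ?_
  induction p using Nat.strong_induction_on with
  | _ p ih =>
    obtain ⟨L, hL, hcover⟩ := S.faces p e
    -- over the interior of the cell `e`, the set `C` lies over the `(n - p - 1)`-skeleton of `X`
    have h1 : IsClosed {z : disc p × X | S.cellProd e z ∈ C ∧ z.2 ∈ T.skelLT (n - p)} := by
      have h2 : IsClosed {z : X × disc p | S.cellProd e z.swap ∈ C ∧ z.1 ∈ T.skelLT (n - p)} := by
        refine GCWStructure.isClosed_prod_of_subset (n := n - p) (S := T) (fun z hz => hz.2) ?_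
        intro q hq e'
        have h3 := isClosed_disc_inter.1 (h (p + q) (by omega) ⟨⟨(p, q), rfl⟩, e, e'⟩)
        have h4 : Continuous fun z : disc q × disc p =>
            (⟨joinCoord rfl z.2.1 z.1.1, joinCoord_mem_disc rfl z.2.2 z.1.2⟩ : disc (p + q)) :=
          ((continuous_joinCoord rfl).comp ((continuous_subtype_val.comp continuous_snd).prodMk
            (continuous_subtype_val.comp continuous_fst))).subtype_mk _
        convert h3.preimage h4 using 1
        ext z
        simp only [prodMap, mem_ofPred_eq, mem_preimage, fstCoord_joinCoord, sndCoord_joinCoord]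
        exact and_iff_left (GCWStructure.map_mem_skelLT hq e' z.1.2)
      exact h2.preimage continuous_swap
    have h5 : S.cellProd e ⁻¹' C =
        (⋃ f ∈ L, {z : disc p × X | z.1 ∈ f.carrier ∧ S.cellProd f.face (f.proj z.1, z.2) ∈ C}) ∪
          {z : disc p × X | S.cellProd e z ∈ C ∧ z.2 ∈ T.skelLT (n - p)} := by
      ext ⟨y, x⟩
      constructor
      · intro hz
        by_cases hy : (y : Fin p → ℝ) ∈ ball (0 : Fin p → ℝ) 1
        · right
          refine ⟨hz, ?_⟩
          obtain ⟨m, hm, ⟨⟨⟨p', q⟩, hpq⟩, e₁, e₂⟩, z, hz, hzy⟩ := hC _ hz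
          have hz' := (mem_disc_iff_coord hpq).1 hz
          have hle := dim_le hy hz'.1 (congrArg Prod.fst hzy).symm
          have hx : T.map q e₂ (sndCoord hpq z) = x := congrArg Prod.snd hzy
          have hq : q < n - p := by
            have hpq' : p' + q = m := hpq
            have hle' : p ≤ p' := hle
            omega
          exact hx ▸ GCWStructure.map_mem_skelLT hq e₂ hz'.2
        · left
          obtain ⟨f, hf, hyf⟩ := hcover y hy
          simp only [mem_iUnion]
          refine ⟨f, hf, hyf, ?_⟩
          have : S.cellProd f.face (f.proj y, x) = S.cellProd e (y, x) :=
            Prod.ext (f.map_eq y hyf).symm rfl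
          rwa [this]
      · rintro (hz | hz)
        · simp only [mem_iUnion] at hz
          obtain ⟨f, hf, hyf, hz⟩ := hz
          have : S.cellProd f.face (f.proj y, x) = S.cellProd e (y, x) :=
            Prod.ext (f.map_eq y hyf).symm rfl
          rw [mem_preimage, ← this]
          exact hz
        · exact hz.1
    rw [h5]
    refine (hL.isClosed_biUnion fun f _ => ?_).union h1
    refine (f.isClosed.preimage continuous_fst).inter ((ih f.dim f.dim_lt f.face).preimage ?_)
    fun_prop

variable (S T) in
/-- The CW-structure of `E × X`. -/
def prodStructure : GCWStructure G (S.Product X) where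
  cell := S.prodCell T
  map := S.prodMap T
  continuousOn n e := by
    have h : Continuous fun y : disc n => S.prodMap T n e y := by
      have h1 : Continuous fun y : disc n =>
          ((⟨fstCoord e.1.2 y, ((mem_disc_iff_coord e.1.2).1 y.2).1⟩ : disc _),
            T.map _ e.2.2 (sndCoord e.1.2 y)) := by
        refine Continuous.prodMk (((continuous_fstCoord _).comp continuous_subtype_val).subtype_mk _)
          ?_
        exact (T.continuous_map _ e.2.2).comp (((continuous_sndCoord e.1.2).comp
          continuous_subtype_val).subtype_mk fun y => ((mem_disc_iff_coord e.1.2).1 y.2).2)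
      exact (continuous_cellProd e.2.1).comp h1
    exact continuousOn_iff_continuous_domRestrict.2 h
  map_smul n g e y hy := by
    have := (mem_disc_iff_coord e.1.2).1 hy
    exact Prod.ext (S.map_smul _ g e.2.1 _ this.1) (T.map_smul _ g e.2.2 _ this.2)
  boundary := by
    rintro n ⟨⟨⟨p, q⟩, rfl⟩, e, e'⟩ y hy
    have hy' := (mem_disc_iff_coord rfl).1 (sphere_subset_closedBall hy)
    by_cases h1 : fstCoord rfl y ∈ ball (0 : Fin p → ℝ) 1
    · have h2 : sndCoord rfl y ∉ ball (0 : Fin q → ℝ) 1 := fun h2 => by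
        have := (mem_openDisc_iff_coord rfl).2 ⟨h1, h2⟩
        rw [mem_ball, mem_sphere.1 hy] at this
        exact lt_irrefl _ this
      obtain ⟨m, hm, e'', z, hz, h⟩ := T.boundary q e' _ (mem_sphere_of_disc hy'.2 h2)
      obtain ⟨x, hx, hxz⟩ := exists_prodMap_eq e e'' ⟨_, hy'.1⟩ ⟨z, hz⟩
      refine ⟨p + m, by simpa using hm, _, x, hx, hxz.trans ?_⟩
      exact Prod.ext rfl h
    · obtain ⟨L, -, hL⟩ := S.faces p e
      obtain ⟨f, -, hf⟩ := hL ⟨_, hy'.1⟩ h1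
      obtain ⟨x, hx, hxz⟩ := exists_prodMap_eq f.face e' (f.proj ⟨_, hy'.1⟩) ⟨_, hy'.2⟩
      refine ⟨f.dim + q, by simpa using f.dim_lt, _, x, hx, hxz.trans ?_⟩
      exact Prod.ext (f.map_eq _ hf).symm rfl
  bijective := by
    constructor
    · rintro ⟨n, ⟨⟨⟨p, q⟩, rfl⟩, e, e'⟩, y⟩ ⟨n', ⟨⟨⟨p', q'⟩, rfl⟩, d, d'⟩, z⟩ h
      have hy := (mem_openDisc_iff_coord rfl).1 y.2
      have hz := (mem_openDisc_iff_coord rfl).1 z.2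
      have h1 := openCell_unique hy.1 hz.1 (congrArg Prod.fst h)
      have h2 := GCWStructure.openCell_unique hy.2 hz.2 (congrArg Prod.snd h)
      obtain rfl : p = p' := congrArg Sigma.fst h1
      obtain rfl : q = q' := congrArg Sigma.fst h2
      simp only [Sigma.mk.injEq, heq_eq_eq, Prod.mk.injEq, true_and] at h1 h2
      obtain ⟨rfl, h1⟩ := h1
      obtain ⟨rfl, h2⟩ := h2
      rw [Subtype.ext (eq_of_coord rfl h1 h2)]
    · rintro ⟨c, x⟩
      obtain ⟨⟨p, e, y⟩, rfl⟩ := S.bijective.2 c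
      obtain ⟨q, e', y', hy', rfl⟩ := T.exists_openCell x
      refine ⟨⟨p + q, ⟨⟨(p, q), rfl⟩, e, e'⟩, ⟨joinCoord rfl y.1 y', ?_⟩⟩, ?_⟩
      · rw [mem_openDisc_iff_coord rfl]
        simp only [fstCoord_joinCoord, sndCoord_joinCoord]
        exact ⟨y.2, hy'⟩
      · simp only [prodMap, fstCoord_joinCoord, sndCoord_joinCoord]
        rfl
  isClosed_of_subset n C hC h := isClosed_of_prodCell n hC h
  isClosed_of_inter C h := by
    refine isClosed_iff.2 fun p e => ?_
    have h2 : IsClosed {z : X × disc p | S.cellProd e z.swap ∈ C} := by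
      refine GCWStructure.isClosed_prod (S := T) fun q e' => ?_
      have h4 : Continuous fun z : disc q × disc p => S.cellProd e (z.2, T.map q e' z.1) :=
        (continuous_cellProd e).comp
          (continuous_snd.prodMk ((T.continuous_map q e').comp continuous_fst))
      convert (h (p + q + 1)).preimage h4 using 1
      ext z
      refine (and_iff_left ?_).symm
      obtain ⟨x, hx, hxz⟩ := exists_prodMap_eq e e' z.2 z.1
      exact ⟨p + q, Nat.lt_succ_self _, _, x, hx, hxz⟩
    exact h2.preimage continuous_swap

theorem isSubcomplex_prod {A : Set X} (hA : T.IsSubcomplex A) :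
    (S.prodStructure T).IsSubcomplex {p : S.Product X | p.2 ∈ A} := by
  refine ⟨fun g p hp => hA.1 g _ hp, ?_⟩
  rintro n ⟨⟨⟨p, q⟩, rfl⟩, e, e'⟩
  refine (hA.2 q e').imp (fun h y hy => ?_) fun h y hy => ?_
  · exact h _ ((mem_disc_iff_coord rfl).1 hy).2
  · exact h _ ((mem_openDisc_iff_coord rfl).1 hy).2

variable (S) in
/-- The product with a cell system as a functor of pairs. -/
def prodFunctor : GCWPair.{u} G ⥤ GCWPair.{u} G where
  obj P :=
    { X :=
        { carrier := S.Product P.X.carrier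
          exists_structure := ⟨S.prodStructure P.X.exists_structure.some⟩ }
      A := {p : S.Product P.X.carrier | p.2 ∈ P.A}
      isSub := ⟨S.prodStructure P.isSub.choose, isSubcomplex_prod P.isSub.choose_spec⟩ }
  map {P Q} f :=
    { toFun := fun p => (p.1, f.toFun p.2)
      continuous := continuous_iff.2 fun n e => (continuous_cellProd e).comp
        (continuous_fst.prodMk (f.continuous.comp continuous_snd))
      equivariant := fun g p => Prod.ext rfl (f.equivariant g p.2)
      mapsTo := fun p hp => f.mapsTo p.2 hp }

variable (S) in
/-- The projection `E × X → X`. -/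
def prodSnd (P : GCWPair G) : S.prodFunctor.obj P ⟶ P where
  toFun p := p.2
  continuous := continuous_prodSnd
  equivariant _ _ := rfl
  mapsTo _ h := h

end CellSystem

/-! ### Pushing a complex into its telescope -/

theorem max_inv_smul_mem_disc {n : ℕ} (w : Fin n → ℝ) : (max 1 ‖w‖)⁻¹ • w ∈ disc n := by
  have h : 0 < max 1 ‖w‖ := zero_lt_one.trans_le (le_max_left _ _)
  rw [mem_closedBall_zero_iff, norm_smul, norm_inv, inv_mul_le_iff₀ (norm_pos_iff.2 h.ne'), mul_one]
  exact (le_max_right _ _).trans (le_abs_self _)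

namespace GCWStructure

variable {G X : Type u} [Group G] [TopologicalSpace X] [MulAction G X] (S : GCWStructure G X)

/-- The open cell containing a point, with the coordinates of the point in this cell. -/
noncomputable def openCoord (c : X) : Σ n, S.cell n × ball (0 : Fin n → ℝ) 1 :=
  (Equiv.ofBijective _ S.bijective).symm c

/-- Push the point with coordinates `y` of an `n`-cell away from the centre, in dependence of the
time `t`: at a time `t ≥ n` the point does not move; at a time `t < n` it moves radially while the
time is set to `n`; when it hits the boundary of the cell, the time decreases from `n` on. At a
boundary point of the cell this is the identity. -/
noncomputable def pushCell (n : ℕ) (e : S.cell n) (y : Fin n → ℝ) (t : ℝ) : X × ℝ :=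
  (S.map n e ((max 1 ‖(1 + max (n - t) 0) • y‖)⁻¹ • (1 + max (n - t) 0) • y),
    max (n : ℝ) t + 1 - max 1 ‖(1 + max (n - t) 0) • y‖)

open Classical in
/-- Apply `pushCell` to the points of the open `n`-cells. -/
noncomputable def push (n : ℕ) (p : X × ℝ) : X × ℝ :=
  if (S.openCoord p.1).1 = n then
    S.pushCell _ (S.openCoord p.1).2.1 (S.openCoord p.1).2.2 p.2
  else p

variable {S}

theorem openCoord_map {n : ℕ} (e : S.cell n) {y : Fin n → ℝ} (hy : y ∈ ball (0 : Fin n → ℝ) 1) :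
    S.openCoord (S.map n e y) = ⟨n, e, ⟨y, hy⟩⟩ :=
  (Equiv.ofBijective _ S.bijective).symm_apply_apply ⟨n, e, ⟨y, hy⟩⟩

theorem pushCell_of_le {n : ℕ} (e : S.cell n) {y : Fin n → ℝ} (hy : y ∈ disc n) {t : ℝ}
    (ht : n ≤ t) : S.pushCell n e y t = (S.map n e y, t) := by
  have h : ‖y‖ ≤ 1 := mem_closedBall_zero_iff.1 hy
  simp [pushCell, max_eq_right (sub_nonpos.2 ht), max_eq_left h, max_eq_right ht]

theorem pushCell_of_norm_eq_one {n : ℕ} (e : S.cell n) {y : Fin n → ℝ} (hy : ‖y‖ = 1) (t : ℝ) :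
    S.pushCell n e y t = (S.map n e y, t) := by
  have h0 : 0 ≤ max ((n : ℝ) - t) 0 := le_max_right _ _
  have h : max 1 ‖(1 + max ((n : ℝ) - t) 0) • y‖ = 1 + max ((n : ℝ) - t) 0 := by
    rw [norm_smul, hy, mul_one, Real.norm_of_nonneg (by linarith), max_eq_right (by linarith)]
  have h2 : max (n : ℝ) t = max ((n : ℝ) - t) 0 + t := by
    rw [max_add, sub_add_cancel, zero_add]
  rw [pushCell, h, inv_smul_smul₀ (by linarith), h2]
  congr 1
  ring

theorem push_map {n : ℕ} (e : S.cell n) {y : Fin n → ℝ} (hy : y ∈ ball (0 : Fin n → ℝ) 1) (t : ℝ) :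
    S.push n (S.map n e y, t) = S.pushCell n e y t := by
  unfold push
  simp only
  rw [openCoord_map e hy, if_pos rfl]

theorem push_map_of_ne {m n : ℕ} (e : S.cell m) {y : Fin m → ℝ} (hy : y ∈ ball (0 : Fin m → ℝ) 1)
    (t : ℝ) (h : m ≠ n) : S.push n (S.map m e y, t) = (S.map m e y, t) := by
  unfold push
  simp only
  rw [openCoord_map e hy, if_neg h]

theorem push_of_mem {n : ℕ} {c : X} (hc : c ∈ S.skelLT n) (t : ℝ) : S.push n (c, t) = (c, t) := by
  obtain ⟨m, hm, e, y, hy, rfl⟩ := exists_openCell_of_mem_skelLT hc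
  exact push_map_of_ne e hy t hm.ne

theorem push_of_le {n : ℕ} (c : X) {t : ℝ} (ht : n ≤ t) : S.push n (c, t) = (c, t) := by
  obtain ⟨m, e, y, hy, rfl⟩ := S.exists_openCell c
  by_cases h : m = n
  · subst h
    rw [push_map e hy, pushCell_of_le e (ball_subset_closedBall hy) ht]
  · exact push_map_of_ne e hy t h

theorem push_map' {n : ℕ} (e : S.cell n) {y : Fin n → ℝ} (hy : y ∈ disc n) (t : ℝ) :
    S.push n (S.map n e y, t) = S.pushCell n e y t := by
  by_cases h : y ∈ ball (0 : Fin n → ℝ) 1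
  · exact push_map e h t
  · have h' := mem_sphere_of_disc hy h
    rw [push_of_mem (map_sphere_mem_skelLT (e := e) h'),
      pushCell_of_norm_eq_one e (mem_sphere_zero_iff_norm.1 h')]

theorem push_smul (n : ℕ) (g : G) (c : X) (t : ℝ) :
    S.push n (g • c, t) = (g • (S.push n (c, t)).1, (S.push n (c, t)).2) := by
  obtain ⟨m, e, y, hy, rfl⟩ := S.exists_openCell c
  rw [← S.map_smul m g e y (ball_subset_closedBall hy)]
  by_cases h : m = n
  · subst h
    rw [push_map e hy, push_map _ hy, pushCell, pushCell, S.map_smul _ _ _ _ (max_inv_smul_mem_disc _)]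
  · rw [push_map_of_ne e hy t h, push_map_of_ne _ hy t h, S.map_smul _ _ _ _
      (ball_subset_closedBall hy)]

theorem push_mem {n : ℕ} {c : X} (hc : c ∈ S.skelLT (n + 1)) (t : ℝ) :
    (S.push n (c, t)).1 ∈ S.skelLT n ∨
      (S.push n (c, t)).1 ∈ S.skelLT (n + 1) ∧ n ≤ (S.push n (c, t)).2 := by
  obtain ⟨m, hm, e, y, hy, rfl⟩ := exists_openCell_of_mem_skelLT hc
  by_cases h : m = n
  · subst h
    rw [push_map e hy, pushCell]
    set w := (1 + max ((m : ℝ) - t) 0) • y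
    rcases le_or_gt ‖w‖ 1 with h | h
    · rw [max_eq_left h]
      refine Or.inr ⟨map_mem_skelLT hm e ?_, ?_⟩
      · rw [inv_one, one_smul]
        exact mem_closedBall_zero_iff.2 h
      · simp
    · rw [max_eq_right h.le]
      refine Or.inl (map_sphere_mem_skelLT (e := e) (mem_sphere_zero_iff_norm.2 ?_))
      rw [norm_smul, norm_inv, norm_norm, inv_mul_cancel₀ (by linarith)]
  · rw [push_map_of_ne e hy t h]
    exact Or.inl (map_mem_skelLT (by omega) e (ball_subset_closedBall hy))

theorem continuousOn_push (n : ℕ) : ContinuousOn (S.push n) (S.skelLT (n + 1) ×ˢ univ) := by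
  have h1 : Continuous fun p : S.skelLT (n + 1) × ℝ => S.push n (p.1, p.2) := by
    refine continuous_skelLT_prod (f := S.push n) fun m hm e => ?_
    rcases Nat.lt_succ_iff_lt_or_eq.1 hm with h | rfl
    · have : ∀ p : disc m × ℝ, S.push n (S.map m e p.1, p.2) = (S.map m e p.1, p.2) :=
        fun p => push_of_mem (map_mem_skelLT h e p.1.2) _
      simp only [this]
      exact ((S.continuous_map m e).comp continuous_fst).prodMk continuous_snd
    · have : ∀ p : disc m × ℝ, S.push m (S.map m e p.1, p.2) = S.pushCell m e p.1 p.2 :=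
        fun p => push_map' e p.1.2 _
      simp only [this, pushCell]
      have h2 : Continuous fun p : disc m × ℝ => (max 1 ‖(1 + max (m - p.2) 0) • p.1.1‖)⁻¹ •
          (1 + max (m - p.2) 0) • p.1.1 := by
        have h3 : Continuous fun p : disc m × ℝ => (1 + max (m - p.2) 0) • p.1.1 := by fun_prop
        refine ((continuous_const.max h3.norm).inv₀ fun p => ?_).smul h3
        exact (zero_lt_one.trans_le (le_max_left _ _)).ne'
      refine Continuous.prodMk ((S.continuousOn m e).comp_continuous h2 fun p =>
        max_inv_smul_mem_disc _) (by fun_prop)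
  rw [continuousOn_iff_continuous_domRestrict]
  exact h1.comp (((continuous_fst.comp continuous_subtype_val).subtype_mk fun p => p.2.1).prodMk
    (continuous_snd.comp continuous_subtype_val))

variable (S) in
/-- Push the `(n - 1)`-skeleton into the telescope, one dimension after the other. -/
noncomputable def pushes : ℕ → X × ℝ → X × ℝ
  | 0 => id
  | n + 1 => pushes n ∘ S.push n

theorem pushes_succ (n : ℕ) (p : X × ℝ) : S.pushes (n + 1) p = S.pushes n (S.push n p) := rfl

theorem pushes_of_le {n : ℕ} (c : X) {t : ℝ} (ht : n ≤ t + 1) : S.pushes n (c, t) = (c, t) := by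
  induction n with
  | zero => rfl
  | succ n ih =>
    push_cast at ht
    rw [pushes_succ, push_of_le c (by linarith), ih (by linarith)]

theorem pushes_of_mem {m n : ℕ} (h : m ≤ n) {c : X} (hc : c ∈ S.skelLT m) (t : ℝ) :
    S.pushes n (c, t) = S.pushes m (c, t) := by
  induction n, h using Nat.le_induction with
  | base => rfl
  | succ n hn ih => rw [pushes_succ, push_of_mem (skelLT_mono hn hc), ih]

theorem pushes_smul (n : ℕ) (g : G) (c : X) (t : ℝ) :
    S.pushes n (g • c, t) = (g • (S.pushes n (c, t)).1, (S.pushes n (c, t)).2) := by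
  induction n generalizing c t with
  | zero => rfl
  | succ n ih => rw [pushes_succ, push_smul, ih]; rfl

theorem pushes_mem {n : ℕ} {c : X} (hc : c ∈ S.skelLT n) (t : ℝ) :
    ∃ k : ℕ, (S.pushes n (c, t)).1 ∈ S.skelLT (k + 1) ∧ k ≤ (S.pushes n (c, t)).2 := by
  induction n generalizing c t with
  | zero =>
    obtain ⟨m, hm, -⟩ := hc
    exact (Nat.not_lt_zero m hm).elim
  | succ n ih =>
    rw [pushes_succ]
    rcases push_mem hc t with h | ⟨h, h'⟩
    · exact ih h _
    · have := pushes_of_le (S := S) (n := n) (S.push n (c, t)).1 (h'.trans (by linarith))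
      rw [Prod.mk.eta] at this
      rw [this]
      exact ⟨n, h, h'⟩

theorem continuousOn_pushes (n : ℕ) : ContinuousOn (S.pushes n) (S.skelLT n ×ˢ univ) := by
  induction n with
  | zero => exact continuousOn_id
  | succ n ih =>
    have h1 : ContinuousOn (S.pushes n) (S.skelLT (n + 1) ×ˢ Ici (n : ℝ)) := by
      refine continuousOn_id.congr fun p hp => ?_
      exact pushes_of_le p.1 (hp.2.out.trans (by linarith))
    refine (ih.union_of_isClosed h1 ((S.isClosed_skelLT n).prod isClosed_univ)
      ((S.isClosed_skelLT _).prod isClosed_Ici)).comp (continuousOn_push n) fun p hp => ?_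
    exact (push_mem hp.1 p.2).imp (fun h => ⟨h, mem_univ _⟩) fun h => h

variable (S) in
/-- The retraction of `X × ℝ` onto the telescope, the set of all `(c, t)` for which `c` lies in the
`⌊t⌋`-skeleton. -/
noncomputable def pushTo (p : X × ℝ) : X × ℝ := S.pushes (S.exists_mem_skelLT p.1).choose p

theorem pushTo_eq {n : ℕ} {c : X} (hc : c ∈ S.skelLT n) (t : ℝ) :
    S.pushTo (c, t) = S.pushes n (c, t) := by
  have h := (S.exists_mem_skelLT c).choose_spec
  refine (pushes_of_mem (le_max_left _ n) h t).symm.trans ?_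
  exact pushes_of_mem (le_max_right _ n) hc t

theorem pushTo_of_le {n : ℕ} {c : X} (hc : c ∈ S.skelLT (n + 1)) {t : ℝ} (ht : n ≤ t) :
    S.pushTo (c, t) = (c, t) := by
  rw [pushTo_eq hc, pushes_of_le c (by push_cast; linarith)]

theorem pushTo_smul (g : G) (c : X) (t : ℝ) :
    S.pushTo (g • c, t) = (g • (S.pushTo (c, t)).1, (S.pushTo (c, t)).2) := by
  obtain ⟨n, hn⟩ := S.exists_mem_skelLT c
  rw [pushTo_eq hn, pushTo_eq (smul_mem_skelLT g hn), pushes_smul]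

theorem pushTo_mem (p : X × ℝ) :
    ∃ k : ℕ, (S.pushTo p).1 ∈ S.skelLT (k + 1) ∧ k ≤ (S.pushTo p).2 := by
  obtain ⟨n, hn⟩ := S.exists_mem_skelLT p.1
  obtain ⟨c, t⟩ := p
  rw [pushTo_eq hn]
  exact pushes_mem hn t

theorem continuous_pushTo : Continuous S.pushTo := by
  refine S.continuous_prod fun n e => ?_
  have h : ∀ p : disc n × ℝ, S.pushTo (S.map n e p.1, p.2) = S.pushes (n + 1) (S.map n e p.1, p.2) :=
    fun p => pushTo_eq (map_mem_skelLT n.lt_succ_self e p.1.2) _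
  simp only [h]
  refine (continuousOn_pushes (n + 1)).comp_continuous
    (((S.continuous_map n e).comp continuous_fst).prodMk continuous_snd) fun p => ?_
  exact ⟨map_mem_skelLT n.lt_succ_self e p.1.2, mem_univ _⟩

open Classical in
/-- The homotopy from the identity to `x ↦ (pushTo (x, 0)).1`, which at the parameter `s > 0` pushes
at the time `1 / s - 1`. -/
theorem continuous_pushTo_homotopy : Continuous fun p : X × unitInterval =>
    if p.2 = 0 then p.1 else (S.pushTo (p.1, (p.2 : ℝ)⁻¹ - 1)).1 := by
  refine S.continuous_prod fun n e => ?_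
  -- on an `n`-cell the homotopy is constant for parameters `s ≤ 1 / (n + 1)`
  have h : ∀ p : disc n × unitInterval,
      (if p.2 = 0 then S.map n e p.1 else (S.pushTo (S.map n e p.1, (p.2 : ℝ)⁻¹ - 1)).1) =
        (S.pushTo (S.map n e p.1, (max (p.2 : ℝ) (n + 1 : ℝ)⁻¹)⁻¹ - 1)).1 := by
    rintro ⟨y, s⟩
    have hn : (0 : ℝ) < (n : ℝ) + 1 := by positivity
    have hy := map_mem_skelLT n.lt_succ_self e y.2
    rcases le_or_gt (s : ℝ) (n + 1 : ℝ)⁻¹ with hs | hs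
    · simp only
      rw [max_eq_right hs, inv_inv, add_sub_cancel_right, pushTo_of_le hy le_rfl]
      split_ifs with h0
      · rfl
      · have h1 : 0 < (s : ℝ) := unitInterval.pos_iff_ne_zero.2 h0
        have h2 : (n : ℝ) + 1 ≤ (s : ℝ)⁻¹ := (le_inv_comm₀ hn h1).2 hs
        rw [pushTo_of_le hy (by linarith)]
    · have h0 : s ≠ 0 := by
        rintro rfl
        exact lt_asymm hs (by simpa using hn)
      simp only
      rw [if_neg h0, max_eq_left hs.le]
  simp only [h]
  refine continuous_fst.comp (continuous_pushTo.comp (Continuous.prodMk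
    ((S.continuous_map n e).comp continuous_fst) ?_))
  refine (Continuous.inv₀ (by fun_prop) fun p => ?_).sub continuous_const
  exact ((by positivity : (0 : ℝ) < (n + 1 : ℝ)⁻¹).trans_le (le_max_right _ _)).ne'

end GCWStructure

/-! ### The telescope -/

/-- The real line, with trivial action of every group. -/
def Line : Type u := ULift.{u} ℝ

namespace Line

variable {G : Type u} [Group G]

instance : MulAction G Line.{u} where
  smul _ t := t
  one_smul _ := rfl
  mul_smul _ _ _ := rfl

/-- The cells of the line: an integer `k` indexes the vertex `k` and the edge `[k, k + 1]`. -/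
def Cell (n : ℕ) : Type u := ULift.{u} (ℤ × PLift (n ≤ 1))

instance (n : ℕ) : MulAction G (Cell.{u} n) where
  smul _ t := t
  one_smul _ := rfl
  mul_smul _ _ _ := rfl

/-- The characteristic maps of the line; the sum has at most one term. -/
noncomputable def cellMap (n : ℕ) (e : Cell.{u} n) (y : Fin n → ℝ) : Line.{u} :=
  ⟨e.down.1 + ∑ i, (1 + y i) / 2⟩

theorem cell_cases {n : ℕ} (e : Cell.{u} n) : n = 0 ∨ n = 1 := by
  have := e.down.2.down
  omega

theorem cellMap_mem {n : ℕ} (e : Cell.{u} n) {y : Fin n → ℝ} (hy : y ∈ disc n) :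
    (cellMap n e y).down ∈ Icc (e.down.1 : ℝ) (e.down.1 + n) := by
  obtain rfl | rfl := cell_cases e
  · simp [cellMap]
  · have := abs_le.1 (mem_disc.1 hy 0)
    simp only [cellMap, Finset.univ_unique, Fin.default_eq_zero, Fin.isValue, Finset.sum_singleton,
      Nat.cast_one, mem_Icc]
    constructor <;> linarith

theorem floor_cellMap {n : ℕ} (e : Cell.{u} n) {y : Fin n → ℝ} (hy : y ∈ ball (0 : Fin n → ℝ) 1) :
    ⌊(cellMap n e y).down⌋ = e.down.1 := by
  obtain rfl | rfl := cell_cases e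
  · simp [cellMap]
  · have := abs_lt.1 (mem_openDisc.1 hy 0)
    simp only [cellMap, Finset.univ_unique, Fin.default_eq_zero, Fin.isValue, Finset.sum_singleton]
    rw [Int.floor_eq_iff]
    constructor <;> linarith

theorem bijective_cellMap : Function.Bijective
    (fun p : (Σ n, Cell.{u} n × ball (0 : Fin n → ℝ) 1) => cellMap p.1 p.2.1 p.2.2) := by
  constructor
  · rintro ⟨n, e, y⟩ ⟨m, e', z⟩ h
    simp only at h
    have hk : e.down.1 = e'.down.1 := by
      rw [← floor_cellMap e y.2, ← floor_cellMap e' z.2, h]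
    have hs : ∑ i, (1 + y.1 i) / 2 = ∑ i, (1 + z.1 i) / 2 := by
      have := congrArg ULift.down h
      simp only [cellMap, hk, add_right_inj] at this
      exact this
    obtain ⟨⟨k, ⟨hn⟩⟩⟩ := e
    obtain ⟨⟨k', ⟨hm⟩⟩⟩ := e'
    obtain rfl : k = k' := hk
    obtain ⟨y, hy⟩ := y
    obtain ⟨z, hz⟩ := z
    interval_cases n <;> interval_cases m
    · rw [Subsingleton.elim y z]
    · have := abs_lt.1 (mem_openDisc.1 hz 0)
      simp only [Finset.univ_eq_empty, Finset.sum_empty, Finset.univ_unique, Fin.default_eq_zero,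
        Fin.isValue, Finset.sum_singleton] at hs
      linarith
    · have := abs_lt.1 (mem_openDisc.1 hy 0)
      simp only [Finset.univ_eq_empty, Finset.sum_empty, Finset.univ_unique, Fin.default_eq_zero,
        Fin.isValue, Finset.sum_singleton] at hs
      linarith
    · obtain rfl : y = z := by
        funext i
        rw [Subsingleton.elim i 0]
        simp only [Finset.univ_unique, Fin.default_eq_zero, Fin.isValue,
          Finset.sum_singleton] at hs
        linarith
      rfl
  · rintro ⟨t⟩
    by_cases ht : t = ⌊t⌋
    · refine ⟨⟨0, ⟨⌊t⌋, ⟨zero_le_one⟩⟩, ⟨0, by simp⟩⟩, ?_⟩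
      exact congrArg ULift.up ((add_eq_left.2 (Finset.sum_empty)).trans ht.symm)
    · have h1 : (⌊t⌋ : ℝ) < t := lt_of_le_of_ne (Int.floor_le t) (Ne.symm ht)
      have h2 := Int.lt_floor_add_one t
      refine ⟨⟨1, ⟨⌊t⌋, ⟨le_rfl⟩⟩, ⟨fun _ => 2 * (t - ⌊t⌋) - 1, ?_⟩⟩, ?_⟩
      · rw [mem_openDisc]
        intro i
        rw [abs_lt]
        constructor <;> linarith
      · simp only [cellMap, Finset.univ_unique, Fin.default_eq_zero, Fin.isValue,
          Finset.sum_singleton]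
        congr 1
        ring

variable (G) in
/-- The cell decomposition of the line with the integers as vertices. -/
noncomputable def system : CellSystem G Line.{u} where
  cell := Cell
  map := cellMap
  map_smul _ _ _ _ _ := rfl
  bijective := bijective_cellMap
  faces n e := by
    obtain rfl | rfl := cell_cases e
    · refine ⟨∅, finite_empty, fun y hy => (hy ?_).elim⟩
      rw [Subsingleton.elim (y : Fin 0 → ℝ) 0]
      exact mem_ball_self one_pos
    · have hc : ∀ a : ℝ, IsClosed {y : disc 1 | y.1 0 = a} := fun a =>
        isClosed_eq ((continuous_apply 0).comp continuous_subtype_val) continuous_const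
      let v (ε : ℝ) (k : ℤ) (h : k = e.down.1 + (1 + ε) / 2) : CellFace cellMap e :=
        { dim := 0
          dim_lt := one_pos
          face := ⟨k, ⟨zero_le_one⟩⟩
          carrier := {y | y.1 0 = ε}
          isClosed := hc ε
          proj := ContinuousMap.const _ ⟨0, by simp⟩
          map_eq := fun y hy => by
            have hy : y.1 0 = ε := hy
            simp [cellMap, h, hy]
            rfl }
      refine ⟨{v (-1) e.down.1 (by simp), v 1 (e.down.1 + 1) (by norm_num)}, toFinite _,
        fun y hy => ?_⟩
      have h1 : |y.1 0| = 1 := by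
        refine le_antisymm (mem_disc.1 y.2 0) (not_lt.1 fun h => hy (mem_openDisc.2 fun i => ?_))
        rwa [Subsingleton.elim i 0]
      rcases eq_or_eq_neg_of_abs_eq h1 with h | h
      · exact ⟨_, Or.inr rfl, h⟩
      · exact ⟨_, Or.inl rfl, h⟩

variable {X : Type u} [TopologicalSpace X]

theorem continuous_time : Continuous fun p : (system G).Product X => p.1.down := by
  refine CellSystem.continuous_iff.2 fun n e => ?_
  change Continuous fun z : disc n × X => (e.down.1 : ℝ) + ∑ i, (1 + z.1.1 i) / 2
  refine continuous_const.add (continuous_finsetSum _ fun i _ => ?_)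
  exact (continuous_const.add ((continuous_apply i).comp
    (continuous_subtype_val.comp continuous_fst))).div_const 2

/-- The line is locally finite, so the cellular topology of the product is the product topology. -/
theorem continuous_mk : Continuous fun p : X × ℝ => (show (system G).Product X from (⟨p.2⟩, p.1)) := by
  have hlf : LocallyFinite fun k : ℤ => {p : X × ℝ | p.2 ∈ Icc (k : ℝ) (k + 1)} := by
    intro p
    refine ⟨{q | q.2 ∈ Ioo (p.2 - 1) (p.2 + 1)},
      (isOpen_Ioo.preimage continuous_snd).mem_nhds (by simp), ?_⟩
    refine (finite_Icc (⌊p.2⌋ - 2) (⌊p.2⌋ + 2)).subset ?_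
    rintro k ⟨q, ⟨h1, h2⟩, h3, h4⟩
    have h5 := Int.floor_le p.2
    have h6 := Int.lt_floor_add_one p.2
    constructor
    · have : ((⌊p.2⌋ - 2 : ℤ) : ℝ) < k + 1 := by push_cast; linarith
      exact Int.lt_add_one_iff.1 (by exact_mod_cast this)
    · have : (k : ℝ) < ((⌊p.2⌋ + 2 : ℤ) : ℝ) := by push_cast; linarith
      exact_mod_cast this.le
  refine hlf.continuous (eq_univ_of_forall fun p => ?_) (fun k => ?_) fun k => ?_
  · exact mem_iUnion.2 ⟨⌊p.2⌋, Int.floor_le _, (Int.lt_floor_add_one _).le⟩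
  · exact isClosed_Icc.preimage continuous_snd
  · let z : {p : X × ℝ | p.2 ∈ Icc (k : ℝ) (k + 1)} → disc 1 × X := fun p =>
      (⟨fun _ => 2 * (p.1.2 - k) - 1, mem_disc.2 fun _ => by
        have := p.2.1
        have := p.2.2
        rw [abs_le]
        constructor <;> linarith⟩, p.1.1)
    have hz : Continuous z := by
      refine Continuous.prodMk (Continuous.subtype_mk ?_ _) (by fun_prop)
      exact continuous_pi fun _ => by fun_prop
    rw [continuousOn_iff_continuous_domRestrict]
    refine ((CellSystem.continuous_cellProd (S := system G)
      (⟨k, ⟨le_rfl⟩⟩ : Cell.{u} 1)).comp hz).congr fun p => ?_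
    refine Prod.ext (congrArg ULift.up ?_) rfl
    simp only [z, Finset.univ_unique, Fin.default_eq_zero, Fin.isValue, Finset.sum_singleton]
    ring

theorem isSubcomplex_Icc [MulAction G X] {T : GCWStructure G X} {A : Set X}
    (hA : T.IsSubcomplex A) (a b : ℤ) : ((system G).prodStructure T).IsSubcomplex
      {p | (a : ℝ) ≤ p.1.down ∧ p.1.down ≤ b ∧ p.2 ∈ A} := by
  refine ⟨fun g p hp => ⟨hp.1, hp.2.1, hA.1 g _ hp.2.2⟩, ?_⟩
  rintro n ⟨⟨⟨p, q⟩, rfl⟩, e, e'⟩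
  have hp : p ≤ 1 := e.down.2.down
  by_cases h : a ≤ e.down.1 ∧ e.down.1 + p ≤ b
  · refine (hA.2 q e').imp (fun hA y hy => ?_) fun hA y hy hyA => ?_
    · obtain ⟨hy1, hy2⟩ := (mem_disc_iff_coord rfl).1 hy
      obtain ⟨h1, h2⟩ := cellMap_mem e hy1
      have h3 : (a : ℝ) ≤ e.down.1 := by exact_mod_cast h.1
      have h4 : (e.down.1 + p : ℝ) ≤ b := by exact_mod_cast h.2
      exact ⟨h3.trans h1, h2.trans h4, hA _ hy2⟩
    · exact hA _ ((mem_openDisc_iff_coord rfl).1 hy).2 hyA.2.2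
  · right
    intro y hy hyA
    obtain ⟨hy1, hy2⟩ := (mem_openDisc_iff_coord rfl).1 hy
    have hf := floor_cellMap e hy1
    have h1 : (a : ℝ) ≤ (cellMap p e (fstCoord rfl y)).down := hyA.1
    have h2 : (cellMap p e (fstCoord rfl y)).down ≤ b := hyA.2.1
    refine h ⟨hf ▸ Int.le_floor.2 h1, ?_⟩
    obtain rfl | rfl := cell_cases e
    · have : e.down.1 ≤ b := hf ▸ Int.floor_le_iff.2 (h2.trans_lt (lt_add_one _))
      simpa using this
    · have h3 := abs_lt.1 (mem_openDisc.1 hy1 0)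
      simp only [cellMap, Finset.univ_unique, Fin.default_eq_zero, Fin.isValue,
        Finset.sum_singleton] at h2
      have : (e.down.1 : ℝ) < b := by linarith
      exact_mod_cast this

end Line

section Telescope

variable {G : Type u} [Group G] {Q : GCWPair.{u} G → Prop} (hQ : CellularClass Q)

namespace GCWStructure

variable {X : GCWComplex G} {S : GCWStructure G X.carrier}

theorem IsSubcomplex.union {A B : Set X.carrier} (hA : S.IsSubcomplex A) (hB : S.IsSubcomplex B) :
    S.IsSubcomplex (A ∪ B) := by
  refine ⟨fun g a ha => ha.imp (hA.1 g a) (hB.1 g a), fun n e => ?_⟩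
  rcases hA.2 n e with h | h
  · exact Or.inl fun x hx => Or.inl (h x hx)
  · rcases hB.2 n e with h' | h'
    · exact Or.inl fun x hx => Or.inr (h' x hx)
    · exact Or.inr fun x hx hx' => hx'.elim (h x hx) (h' x hx)

theorem IsSubcomplex.iUnion {ι : Type*} {A : ι → Set X.carrier} (hA : ∀ i, S.IsSubcomplex (A i)) :
    S.IsSubcomplex (⋃ i, A i) := by
  refine ⟨fun g a ha => ?_, fun n e => ?_⟩
  · obtain ⟨i, hi⟩ := mem_iUnion.1 ha
    exact mem_iUnion.2 ⟨i, (hA i).1 g a hi⟩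
  · by_cases h : ∃ i, ∀ x ∈ disc n, S.map n e x ∈ A i
    · obtain ⟨i, hi⟩ := h
      exact Or.inl fun x hx => mem_iUnion.2 ⟨i, hi x hx⟩
    · refine Or.inr fun x hx hx' => ?_
      obtain ⟨i, hi⟩ := mem_iUnion.1 hx'
      exact h ⟨i, fun y hy => (hA i).map_mem hx hi hy⟩

end GCWStructure

open GCWStructure

include hQ in
/-- Mayer–Vietoris: a cellular class is closed under unions of subcomplexes whose intersection also
belongs to the class. -/
theorem CellularClass.union {X : GCWComplex G} {S : GCWStructure G X.carrier}
    {A B C : Set X.carrier} (hA : S.IsSubcomplex A) (hB : S.IsSubcomplex B) (hC : S.IsSubcomplex C)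
    (hABC : A ∩ B = C) (hQA : Q hA.complex.toPair) (hQB : Q hB.complex.toPair)
    (hQC : Q hC.complex.toPair) : Q (hA.union hB).complex.toPair := by
  have hAC : C ⊆ A := hABC ▸ inter_subset_left
  obtain ⟨e⟩ := hA.nonempty_iso_pair_sub hC hAC
  obtain ⟨e'⟩ := (hA.union hB).nonempty_iso_pair_sub hB subset_union_right
  let F : hA.pair hC ⟶ (hA.union hB).pair hB :=
    { toFun := fun a => ⟨a.1, Or.inl a.2⟩
      continuous := continuous_subtype_val.subtype_mk _
      equivariant := fun _ _ => rfl
      mapsTo := fun a (ha : a.1 ∈ C) => (hABC ▸ ha : a.1 ∈ A ∩ B).2 }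
  have hF : IsRelHomeo F := by
    refine ⟨fun x hx => ?_, fun x y _ _ h => ?_, fun y hy => ?_, fun K hK h => ?_⟩
    · have : x.1 ∈ A ∩ B := ⟨x.2, hx⟩
      rwa [hABC] at this
    · have : x.1 = y.1 := congrArg (fun z : ↥(A ∪ B) => z.1) h
      exact Subtype.ext this
    · exact ⟨⟨y.1, y.2.resolve_right hy⟩, rfl⟩
    · have h1 := hA.isClosed.isClosedEmbedding_subtypeVal.isClosedMap _ h
      have h2 : IsClosed {x : X.carrier | x ∈ B ∧ ∃ h : x ∈ A ∪ B, (⟨x, h⟩ : ↥(A ∪ B)) ∈ K} := by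
        rcases hK with hK | hK
        · convert hB.isClosed using 1
          ext x
          exact ⟨fun h => h.1, fun h => ⟨h, Or.inr h, hK (show x ∈ B from h)⟩⟩
        · convert isClosed_empty (X := X.carrier) using 1
          ext x
          refine ⟨fun ⟨h, h', h''⟩ => ?_, fun h => h.elim⟩
          exact disjoint_left.1 hK (show x ∈ B from h) h''
      refine (isClosed_induced_iff.2 ⟨_, h1.union h2, ?_⟩ : IsClosed (K : Set ↥(A ∪ B)))
      ext ⟨x, hx⟩
      refine Iff.symm ?_
      constructor
      · intro hxK
        rcases hx with hx' | hx'
        · exact Or.inl ⟨⟨x, hx'⟩, hxK, rfl⟩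
        · exact Or.inr ⟨hx', _, hxK⟩
      · rintro (⟨⟨x', hx'⟩, hxK, rfl⟩ | ⟨-, _, hxK⟩)
        · exact hxK
        · exact hxK
  have h1 : Q (hA.pair hC) := hQ.pair _ (hQ.of_iso e.symm hQC) hQA
  exact hQ.total ((hA.union hB).pair hB) (hQ.of_iso e'.symm hQB) ((hQ.excision F hF).1 h1)

variable {X : GCWComplex G} (S : GCWStructure G X.carrier)

variable (X) in
/-- The product of the line and a complex. -/
noncomputable def lineComplex : GCWComplex G := ((Line.system G).prodFunctor.obj X.toPair).X

namespace lineComplex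

/-- The first component of a point of the product. -/
def time (p : (lineComplex X).carrier) : ℝ :=
  (show (Line.system G).Product X.carrier from p).1.down

/-- The second component of a point of the product. -/
def base (p : (lineComplex X).carrier) : X.carrier :=
  (show (Line.system G).Product X.carrier from p).2

/-- The point with given components. -/
def pt (x : X.carrier) (t : ℝ) : (lineComplex X).carrier :=
  (show (Line.system G).Product X.carrier from (⟨t⟩, x))

theorem ext {p q : (lineComplex X).carrier} (h1 : time p = time q) (h2 : base p = base q) :
    p = q :=
  Prod.ext (congrArg ULift.up h1) h2

theorem continuous_time : Continuous (time : (lineComplex X).carrier → ℝ) := Line.continuous_time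

theorem continuous_base : Continuous (base : (lineComplex X).carrier → X.carrier) :=
  CellSystem.continuous_prodSnd

theorem continuous_pt : Continuous fun p : X.carrier × ℝ => pt p.1 p.2 := Line.continuous_mk

end lineComplex

open lineComplex

/-- The slab `[a, b] × X^(n-1)`. -/
def slab (a b : ℤ) (n : ℕ) : Set (lineComplex X).carrier :=
  {p | (a : ℝ) ≤ time p ∧ time p ≤ b ∧ base p ∈ S.skelLT n}

/-- The CW-structure of the product of the line and a complex. -/
noncomputable def lineStructure : GCWStructure G (lineComplex X).carrier :=
  (Line.system G).prodStructure S

theorem isSubcomplex_slab (a b : ℤ) (n : ℕ) : (lineStructure S).IsSubcomplex (slab S a b n) :=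
  Line.isSubcomplex_Icc (S.isSubcomplex_skelLT n) a b

/-- A union of slabs `[aᵢ, bᵢ] × X^(νᵢ - 1)`. -/
def slabs (a b : ℕ → ℤ) (ν : ℕ → ℕ) : Set (lineComplex X).carrier := ⋃ i, slab S (a i) (b i) (ν i)

theorem isSubcomplex_slabs (a b : ℕ → ℤ) (ν : ℕ → ℕ) :
    (lineStructure S).IsSubcomplex (slabs S a b ν) :=
  .iUnion fun i => isSubcomplex_slab S (a i) (b i) (ν i)

include hQ in
/-- A slab is homotopy equivalent to a skeleton. -/
theorem CellularClass.of_slab {a b : ℤ} (hab : a ≤ b) (n : ℕ) :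
    Q (isSubcomplex_slab S a b n).complex.toPair := by
  have hab' : (a : ℝ) ≤ b := by exact_mod_cast hab
  set W := (isSubcomplex_slab S a b n).complex
  have hn := S.isSubcomplex_skelLT n
  let ι : W.carrier → (lineComplex X).carrier := (isSubcomplex_slab S a b n).incl.toFun
  have hι : Continuous ι := (isSubcomplex_slab S a b n).incl.continuous
  have hmem : ∀ p : W.carrier, (a : ℝ) ≤ time (ι p) ∧ time (ι p) ≤ b ∧ base (ι p) ∈ S.skelLT n :=
    fun p => p.2
  let σ : W.toPair ⟶ hn.complex.toPair :=
    { toFun := fun p => ⟨base (ι p), (hmem p).2.2⟩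
      continuous := (continuous_base.comp hι).subtype_mk _
      equivariant := fun _ _ => rfl
      mapsTo := fun _ h => h.elim }
  let p : hn.complex.toPair ⟶ W.toPair :=
    { toFun := fun x => ⟨pt x.1 a, le_rfl, hab', x.2⟩
      continuous := (continuous_pt.comp
        (continuous_subtype_val.prodMk continuous_const)).subtype_mk _
      equivariant := fun _ _ => rfl
      mapsTo := fun _ h => h.elim }
  refine hQ.of_retract σ p ?_ (hQ.of_skelLT_eq_univ hn.structure (n := n)
    (eq_univ_of_forall fun x => hn.structure_mem_skelLT n x.2))
  refine ⟨fun z => ⟨pt (base (ι z.1)) (time (ι z.1) - z.2 * (time (ι z.1) - a)), ?_, ?_,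
    (hmem z.1).2.2⟩, ?_, fun x => ?_, fun x => ?_, fun _ _ _ => rfl, fun _ h => h.elim⟩
  · have h1 := (hmem z.1).1
    have h3 : (z.2 : ℝ) * (time (ι z.1) - a) ≤ 1 * (time (ι z.1) - a) :=
      mul_le_mul_of_nonneg_right z.2.2.2 (by linarith)
    change (a : ℝ) ≤ time (ι z.1) - z.2 * (time (ι z.1) - a)
    linarith
  · have h1 := (hmem z.1).1
    have h2 := (hmem z.1).2.1
    have h3 : 0 ≤ (z.2 : ℝ) * (time (ι z.1) - a) := mul_nonneg z.2.2.1 (by linarith)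
    change time (ι z.1) - z.2 * (time (ι z.1) - a) ≤ b
    linarith
  · have ht : Continuous fun z : W.carrier × unitInterval => time (ι z.1) :=
      continuous_time.comp (hι.comp continuous_fst)
    have hx : Continuous fun z : W.carrier × unitInterval => base (ι z.1) :=
      continuous_base.comp (hι.comp continuous_fst)
    exact (continuous_pt.comp (hx.prodMk (ht.sub (Continuous.mul
      (continuous_subtype_val.comp continuous_snd) (ht.sub continuous_const))))).subtype_mk _
  · refine Subtype.ext (lineComplex.ext ?_ rfl)
    change time (ι x) - (0 : unitInterval) * (time (ι x) - a) = time (ι x)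
    simp
  · refine Subtype.ext (lineComplex.ext ?_ rfl)
    change time (ι x) - (1 : unitInterval) * (time (ι x) - a) = a
    simp

include hQ in
/-- A union of slabs over disjoint intervals is their topological disjoint union. -/
theorem CellularClass.of_slabs {a b : ℕ → ℤ} (ν : ℕ → ℕ) (hab : ∀ i, a i ≤ b i)
    (hba : ∀ i, b i < a (i + 1)) : Q (isSubcomplex_slabs S a b ν).complex.toPair := by
  have ha : StrictMono a := strictMono_nat_of_lt_succ fun i => (hab i).trans_lt (hba i)
  have hlt : ∀ {i j}, i < j → b i + 1 ≤ (a j : ℝ) := fun {i j} h => by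
    exact_mod_cast (hba i).trans_le (ha.monotone h)
  let W : ULift.{u} ℕ → GCWComplex G := fun i =>
    (isSubcomplex_slab S (a i.down) (b i.down) (ν i.down)).complex
  let Y := (isSubcomplex_slabs S a b ν).complex
  have hY : ∀ p : Y.carrier, ∃ i, p.1 ∈ slab S (a i) (b i) (ν i) := fun p => mem_iUnion.1 p.2
  have hsub : ∀ i, slab S (a i) (b i) (ν i) ⊆ slabs S a b ν := fun i =>
    subset_iUnion (fun i => slab S (a i) (b i) (ν i)) i
  let f : ∀ i, (W i).toPair ⟶ Y.toPair := fun i =>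
    { toFun := inclusion (hsub i.down)
      continuous := continuous_inclusion (hsub i.down)
      equivariant := fun _ _ => rfl
      mapsTo := fun _ h => h.elim }
  have hf : ∀ i, IsEmbedding (f i).toFun := fun i => IsEmbedding.inclusion (hsub i.down)
  have ht : Continuous fun p : Y.carrier => time p.1 := continuous_time.comp continuous_subtype_val
  -- the slabs are separated by the time coordinate
  have huniq : ∀ {i j : ℕ} {p : (lineComplex X).carrier}, a i - 1 < time p → time p < b i + 1 →
      p ∈ slab S (a j) (b j) (ν j) → i = j := by
    intro i j t h1 h2 h3
    have h4 := h3.1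
    have h5 := h3.2.1
    rcases lt_trichotomy i j with h | h | h
    · have := hlt h
      linarith
    · exact h
    · have := hlt h
      linarith
  have hW : ∀ i (p : (W i).carrier), a i.down - 1 < time p.1 ∧ time p.1 < b i.down + 1 := by
    intro i p
    have h1 := p.2.1
    have h2 := p.2.2.1
    constructor <;> linarith
  have hopen : ∀ i, IsOpen (range (f i).toFun) := by
    intro i
    have : range (f i).toFun = {p : Y.carrier | time p.1 ∈ Ioo (a i.down - 1 : ℝ) (b i.down + 1)} := by
      ext p
      constructor
      · rintro ⟨q, rfl⟩
        exact hW i q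
      · rintro ⟨h1, h2⟩
        obtain ⟨j, hj⟩ := hY p
        obtain rfl : i.down = j := huniq h1 h2 hj
        exact ⟨⟨p.1, hj⟩, rfl⟩
    rw [this]
    exact isOpen_Ioo.preimage ht
  refine hQ.of_isHomeomorph_sigma f ⟨continuous_sigma fun i => (f i).continuous, ?_, ?_, ?_⟩
    fun i => CellularClass.of_slab hQ S (hab i.down) _
  · exact isOpenMap_sigma.2 fun i => (IsOpenEmbedding.mk (hf i) (hopen i)).isOpenMap
  · rintro ⟨i, p⟩ ⟨j, q⟩ h
    have h1 : p.1 = q.1 := congrArg (fun y : Y.carrier => y.1) h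
    have hij : i.down = j.down := huniq (hW i p).1 (hW i p).2 (h1 ▸ q.2)
    obtain rfl : i = j := ULift.ext _ _ hij
    exact congrArg (Sigma.mk i) (Subtype.ext h1)
  · intro p
    obtain ⟨j, hj⟩ := hY p
    exact ⟨⟨⟨j⟩, p.1, hj⟩, rfl⟩

include hQ in
/-- A cellular class contains all `G`-CW-complexes: the telescope of the skeleta, which contains the
given complex as a homotopy retract, is the union of two subcomplexes that, like their intersection,
are disjoint unions of spaces homotopy equivalent to skeleta. -/
theorem CellularClass.toPair (X : GCWComplex G) : Q X.toPair := by
  have S : GCWStructure G X.carrier := X.exists_structure.some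
  have hA := isSubcomplex_slabs S (fun i => 2 * i) (fun i => 2 * i + 1) (fun i => 2 * i + 1)
  have hB := isSubcomplex_slabs S (fun i => 2 * i + 1) (fun i => 2 * i + 2) (fun i => 2 * i + 2)
  have hC := isSubcomplex_slabs S (fun i => i + 1) (fun i => i + 1) (fun i => i + 1)
  have hABC : slabs S (fun i => 2 * i) (fun i => 2 * i + 1) (fun i => 2 * i + 1) ∩
      slabs S (fun i => 2 * i + 1) (fun i => 2 * i + 2) (fun i => 2 * i + 2) =
      slabs S (fun i => i + 1) (fun i => i + 1) (fun i => i + 1) := by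
    ext p
    simp only [slabs, slab, mem_inter_iff, mem_iUnion, mem_ofPred_eq]
    push_cast
    constructor
    · rintro ⟨⟨i, h1, h2, h3⟩, j, h4, h5, h6⟩
      have h7 : (2 * j + 1 : ℝ) ≤ 2 * i + 1 := h4.trans h2
      have h8 : (2 * i : ℝ) ≤ 2 * j + 2 := h1.trans h5
      have h9 : 2 * j + 1 ≤ 2 * i + 1 := by exact_mod_cast h7
      have h10 : 2 * i ≤ 2 * j + 2 := by exact_mod_cast h8
      obtain rfl | rfl : i = j ∨ i = j + 1 := by omega
      · exact ⟨2 * i, by push_cast; linarith, by push_cast; linarith, h3⟩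
      · push_cast at h1
        exact ⟨2 * j + 1, by push_cast; linarith, by push_cast; linarith, h6⟩
    · rintro ⟨k, h1, h2, h3⟩
      obtain ⟨i, rfl | rfl⟩ := Nat.even_or_odd' k
      · push_cast at h1 h2
        exact ⟨⟨i, by linarith, by linarith, h3⟩, i, by linarith, by linarith,
          skelLT_mono (by omega) h3⟩
      · push_cast at h1 h2
        exact ⟨⟨i + 1, by push_cast; linarith, by push_cast; linarith,
          skelLT_mono (by omega) h3⟩, i, by linarith, by linarith, h3⟩
  have hT := CellularClass.union hQ hA hB hC hABC
    (hQ.of_slabs S _ (fun i => by omega) fun i => by push_cast; omega)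
    (hQ.of_slabs S _ (fun i => by omega) fun i => by push_cast; omega)
    (hQ.of_slabs S _ (fun i => le_rfl) fun i => by push_cast; omega)
  have hmem : ∀ p : X.carrier × ℝ, pt (S.pushTo p).1 (S.pushTo p).2 ∈
      slabs S (fun i => 2 * i) (fun i => 2 * i + 1) (fun i => 2 * i + 1) ∪
      slabs S (fun i => 2 * i + 1) (fun i => 2 * i + 2) (fun i => 2 * i + 2) := by
    intro p
    obtain ⟨k, h1, h2⟩ := pushTo_mem (S := S) p
    have h3 := Nat.floor_le ((Nat.cast_nonneg k).trans h2)
    have h4 := Nat.lt_floor_add_one (S.pushTo p).2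
    have h5 : k ≤ ⌊(S.pushTo p).2⌋₊ := Nat.le_floor h2
    have h6 : (S.pushTo p).1 ∈ S.skelLT (⌊(S.pushTo p).2⌋₊ + 1) := skelLT_mono (by omega) h1
    generalize ⌊(S.pushTo p).2⌋₊ = m at h3 h4 h6
    obtain ⟨i, rfl | rfl⟩ := Nat.even_or_odd' m
    · refine Or.inl (mem_iUnion.2 ⟨i, ?_, ?_, h6⟩)
      · push_cast at h3 ⊢
        exact h3
      · push_cast at h4 ⊢
        exact h4.le
    · refine Or.inr (mem_iUnion.2 ⟨i, ?_, ?_, h6⟩)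
      · push_cast at h3 ⊢
        exact h3
      · push_cast at h4 ⊢
        exact h4.le.trans (by linarith)
  let σ : X.toPair ⟶ (hA.union hB).complex.toPair :=
    { toFun := fun x => ⟨pt (S.pushTo (x, 0)).1 (S.pushTo (x, 0)).2, hmem _⟩
      continuous := (continuous_pt.comp
        (continuous_pushTo.comp (continuous_id.prodMk continuous_const))).subtype_mk _
      equivariant := fun g x => Subtype.ext
        (congrArg (fun z : X.carrier × ℝ => pt z.1 z.2) (pushTo_smul (S := S) g x 0))
      mapsTo := fun _ h => h.elim }
  let p : (hA.union hB).complex.toPair ⟶ X.toPair :=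
    { toFun := fun y => base y.1
      continuous := continuous_base.comp continuous_subtype_val
      equivariant := fun _ _ => rfl
      mapsTo := fun _ h => h.elim }
  classical
  refine hQ.of_retract σ p ⟨_, continuous_pushTo_homotopy (S := S), fun x => if_pos rfl, fun x => ?_,
    fun g x t => ?_, fun _ h => h.elim⟩ hT
  · refine (if_neg one_ne_zero).trans ?_
    rw [Set.Icc.coe_one, inv_one, sub_self]
    rfl
  · simp only
    split_ifs
    · rfl
    · rw [pushTo_smul]

end Telescope

/-! ### Pulling back homology theories along functors -/

section GoodFunctor

variable {H G : Type u} [Group H] [Group G]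

/-- The properties of a functor between categories of equivariant CW-pairs that allow to pull back
homology theories. -/
structure GoodFunctor (Φ : GCWPair.{u} H ⥤ GCWPair.{u} G) : Prop where
  homotopic : ∀ {P Q : GCWPair H} {f₀ f₁ : P ⟶ Q}, GHomotopic f₀ f₁ →
    GHomotopic (Φ.map f₀) (Φ.map f₁)
  relHomeo : ∀ {P Q : GCWPair H} {F : P ⟶ Q}, IsRelHomeo F → IsRelHomeo (Φ.map F)
  toPair_A : ∀ X : GCWComplex H, (Φ.obj X.toPair).A = ∅
  inclPair : ∀ P : GCWPair H, IsHomeomorph (Φ.map P.inclPair).toFun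
  isEmbedding : ∀ P : GCWPair H, IsEmbedding (Φ.map (P.inclSub ≫ P.inclPair)).toFun
  range_eq : ∀ P : GCWPair H, range (Φ.map (P.inclSub ≫ P.inclPair)).toFun = (Φ.obj P).A
  coproduct : ∀ {I : Type u} (X : I → GCWComplex H), IsHomeomorph
    fun s : Σ i, (Φ.obj (X i).toPair).X.carrier => (Φ.map (coproductIncl X s.1)).toFun s.2

/-- A pair without subcomplex as a complex. -/
def GCWPair.dropA {R : GCWPair G} (hR : R.A = ∅) : R ⟶ R.X.toPair where
  toFun := id
  continuous := continuous_id
  equivariant _ _ := rfl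
  mapsTo x hx := by rw [hR] at hx; exact hx

theorem GCWPair.isIso_inclPair {R : GCWPair G} (hR : R.A = ∅) : IsIso R.inclPair :=
  ⟨GCWPair.dropA hR, by ext; rfl, by ext; rfl⟩

namespace GoodFunctor

variable {Φ : GCWPair.{u} H ⥤ GCWPair.{u} G} (hΦ : GoodFunctor Φ)

/-- The identification of `Φ A` with the subcomplex of `Φ (X, A)`. -/
def subIso (P : GCWPair H) : Φ.obj P.sub.toPair ⟶ (Φ.obj P).sub.toPair :=
  GCWPair.liftSub (Φ.map (P.inclSub ≫ P.inclPair)) (hΦ.toPair_A _)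
    fun x => hΦ.range_eq P ▸ mem_range_self x

instance (P : GCWPair H) : IsIso (hΦ.subIso P) :=
  GCWPair.isIso_liftSub _ _ (hΦ.isEmbedding P) (hΦ.range_eq P)

/-- The identification of `Φ X` with the underlying complex of `Φ (X, A)`. -/
def totalIso (P : GCWPair H) : Φ.obj P.X.toPair ⟶ (Φ.obj P).X.toPair where
  toFun := (Φ.map P.inclPair).toFun
  continuous := (Φ.map P.inclPair).continuous
  equivariant := (Φ.map P.inclPair).equivariant
  mapsTo x hx := by rw [hΦ.toPair_A] at hx; exact hx

instance (P : GCWPair H) : IsIso (hΦ.totalIso P) :=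
  GCWPair.isIso_of_isHomeomorph _ (hΦ.inclPair P) fun _ h => h.elim

/-- The inverse of `subIso`. -/
noncomputable def subInv (P : GCWPair H) : (Φ.obj P).sub.toPair ⟶ Φ.obj P.sub.toPair :=
  inv (hΦ.subIso P)

theorem subIso_subInv (P : GCWPair H) : hΦ.subIso P ≫ hΦ.subInv P = 𝟙 _ := IsIso.hom_inv_id _

theorem totalIso_inclPair (P : GCWPair H) :
    hΦ.totalIso P ≫ (Φ.obj P).inclPair = Φ.map P.inclPair := rfl

theorem subIso_inclSub (P : GCWPair H) :
    hΦ.subIso P ≫ (Φ.obj P).inclSub = Φ.map P.inclSub ≫ hΦ.totalIso P := by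
  ext x
  change (Φ.map (P.inclSub ≫ P.inclPair)).toFun x = (Φ.map P.inclPair).toFun _
  rw [CategoryTheory.Functor.map_comp]
  rfl

theorem subIso_naturality {P Q : GCWPair H} (f : P ⟶ Q) :
    Φ.map ((subFunctor H).map f) ≫ hΦ.subIso Q = hΦ.subIso P ≫ (subFunctor G).map (Φ.map f) := by
  ext x
  refine Subtype.ext ?_
  change (Φ.map ((subFunctor H).map f) ≫ Φ.map (Q.inclSub ≫ Q.inclPair)).toFun x =
    (Φ.map (P.inclSub ≫ P.inclPair) ≫ Φ.map f).toFun x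
  rw [← CategoryTheory.Functor.map_comp, ← CategoryTheory.Functor.map_comp]
  rfl

theorem subInv_naturality {P Q : GCWPair H} (f : P ⟶ Q) :
    (subFunctor G).map (Φ.map f) ≫ hΦ.subInv Q = hΦ.subInv P ≫ Φ.map ((subFunctor H).map f) := by
  have h := hΦ.subIso_naturality f
  unfold subInv
  exact (IsIso.comp_inv_eq (hΦ.subIso Q)).2
    ((IsIso.eq_inv_comp (hΦ.subIso P)).2 h.symm |>.trans (Category.assoc _ _ _).symm)

end GoodFunctor

variable {Λ : Type v} [Ring Λ]

theorem exact_of_ladder {A B C A' B' C' : ModuleCat.{w} Λ} {f : A ⟶ B} {g : B ⟶ C} {f' : A' ⟶ B'}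
    {g' : B' ⟶ C'} (a : A ⟶ A') (b : B ⟶ B') (c : C ⟶ C') (ha : Function.Bijective a.hom)
    (hb : Function.Bijective b.hom) (hc : Function.Bijective c.hom)
    (h1 : a ≫ f' = f ≫ b) (h2 : b ≫ g' = g ≫ c) (h : Function.Exact f'.hom g'.hom) :
    Function.Exact f.hom g.hom := by
  intro y
  have e1 : ∀ x, f'.hom (a.hom x) = b.hom (f.hom x) := fun x => ConcreteCategory.congr_hom h1 x
  have e2 : g'.hom (b.hom y) = c.hom (g.hom y) := ConcreteCategory.congr_hom h2 y
  constructor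
  · intro hy
    obtain ⟨x', hx'⟩ := (h (b.hom y)).1 (by rw [e2, hy, map_zero])
    obtain ⟨x, rfl⟩ := ha.2 x'
    exact ⟨x, hb.1 ((e1 x).symm.trans hx')⟩
  · rintro ⟨x, rfl⟩
    refine hc.1 ?_
    refine (e2.symm.trans ?_).trans (map_zero c.hom).symm
    exact (h _).2 ⟨a.hom x, e1 x⟩

open DirectSum in
/-- The homology theory `P ↦ h (Φ P)`. The functor `Φ` preserves subcomplexes only up to the isomorphism
`subIso`, by whose inverse the boundary map is corrected. -/
noncomputable def HomologyTheory.pull (h : HomologyTheory.{u, v, w} G Λ)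
    {Φ : GCWPair.{u} H ⥤ GCWPair.{u} G} (hΦ : GoodFunctor Φ) : HomologyTheory.{u, v, w} H Λ :=
  have hsub : ∀ n P, Function.Bijective ((h.H n).map (hΦ.subIso P)).hom := fun n P =>
    bijective_map_of_isIso (h.H n) (hΦ.subIso P)
  have htot : ∀ n P, Function.Bijective ((h.H n).map (hΦ.totalIso P)).hom := fun n P =>
    bijective_map_of_isIso (h.H n) (hΦ.totalIso P)
  have h1 : ∀ n P, (h.H n).map (hΦ.subIso P) ≫ (h.H n).map (Φ.obj P).inclSub =
      (h.H n).map (Φ.map P.inclSub) ≫ (h.H n).map (hΦ.totalIso P) := fun n P => by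
    rw [← CategoryTheory.Functor.map_comp, hΦ.subIso_inclSub, CategoryTheory.Functor.map_comp]
  have h2 : ∀ n P, (h.H n).map (hΦ.totalIso P) ≫ (h.H n).map (Φ.obj P).inclPair =
      (h.H n).map (Φ.map P.inclPair) ≫ 𝟙 _ := fun n P => by
    rw [← CategoryTheory.Functor.map_comp, hΦ.totalIso_inclPair, Category.comp_id]
  have h3 : ∀ n P, (h.bdry n).app (Φ.obj P) = ((h.bdry n).app (Φ.obj P) ≫
      (h.H (n - 1)).map (hΦ.subInv P)) ≫ (h.H (n - 1)).map (hΦ.subIso P) := fun n P => by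
    have h4 : (h.H (n - 1)).map (hΦ.subInv P) ≫ (h.H (n - 1)).map (hΦ.subIso P) = 𝟙 _ := by
      rw [← CategoryTheory.Functor.map_comp, ← CategoryTheory.Functor.map_id]
      exact congrArg _ (IsIso.inv_hom_id (hΦ.subIso P))
    exact ((Category.assoc _ _ _).trans ((congrArg _ h4).trans (Category.comp_id _))).symm
  { H n := Φ ⋙ h.H n
    bdry n :=
      { app := fun P => (h.bdry n).app (Φ.obj P) ≫ (h.H (n - 1)).map (hΦ.subInv P)
        naturality := fun P Q f => by
          have h1 := (h.bdry n).naturality (Φ.map f)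
          have h3 : (h.H (n - 1)).map ((subFunctor G).map (Φ.map f)) ≫
              (h.H (n - 1)).map (hΦ.subInv Q) = (h.H (n - 1)).map (hΦ.subInv P) ≫
                (h.H (n - 1)).map (Φ.map ((subFunctor H).map f)) :=
            (CategoryTheory.Functor.map_comp _ _ _).symm.trans
              ((congrArg _ (hΦ.subInv_naturality f)).trans (CategoryTheory.Functor.map_comp _ _ _))
          exact (Category.assoc _ _ _).symm.trans
            ((congrArg (· ≫ (h.H (n - 1)).map (hΦ.subInv Q)) h1).trans ((Category.assoc _ _ _).trans
              ((congrArg ((h.bdry n).app (Φ.obj P) ≫ ·) h3).trans (Category.assoc _ _ _).symm))) }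
    homotopy_invariance f₀ f₁ hf n := h.homotopy_invariance _ _ (hΦ.homotopic hf) n
    exact_X P n := exact_of_ladder _ _ (𝟙 _) (hsub n P) (htot n P) Function.bijective_id
      (h1 n P) (h2 n P) (h.exact_X (Φ.obj P) n)
    exact_pair P n := exact_of_ladder _ (𝟙 _) _ (htot n P) Function.bijective_id (hsub (n - 1) P)
      (h2 n P) ((Category.id_comp _).trans (h3 n P)) (h.exact_pair (Φ.obj P) n)
    exact_A P n := exact_of_ladder (𝟙 _) _ _ Function.bijective_id (hsub (n - 1) P)
      (htot (n - 1) P) ((Category.id_comp _).trans (h3 n P)) (h1 (n - 1) P)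
      (h.exact_A (Φ.obj P) n)
    excision F hF n := h.excision _ (hΦ.relHomeo hF) n
    disjoint_union {I} _ X n := by
      let X' : I → GCWComplex G := fun i => (Φ.obj (X i).toPair).X
      have hiso : ∀ Y : GCWComplex H, IsIso (Φ.obj Y.toPair).inclPair := fun Y =>
        GCWPair.isIso_inclPair (hΦ.toPair_A Y)
      have := hiso (EquivHomology.coproduct X)
      let f : ∀ i, (X' i).toPair ⟶ (Φ.obj (EquivHomology.coproduct X).toPair).X.toPair := fun i =>
        { toFun := (Φ.map (coproductIncl X i)).toFun
          continuous := (Φ.map (coproductIncl X i)).continuous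
          equivariant := (Φ.map (coproductIncl X i)).equivariant
          mapsTo := fun _ h => h.elim }
      obtain ⟨e, _, he⟩ := isIso_of_isHomeomorph_sigma f (hΦ.coproduct X)
      have h1 := h.disjoint_union X' n
      have h2 := (bijective_map_of_isIso (h.H n)
        (e ≫ (Φ.obj (EquivHomology.coproduct X).toPair).inclPair)).comp h1
      let L : (⨁ i, (h.H n).obj (X' i).toPair) →ₗ[Λ] ⨁ i, (h.H n).obj (Φ.obj (X i).toPair) :=
        lmap fun i => ((h.H n).map (Φ.obj (X i).toPair).inclPair).hom
      have hL : Function.Bijective L := by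
        have hb : ∀ i, Function.Bijective ((h.H n).map (Φ.obj (X i).toPair).inclPair).hom := fun i =>
          have := hiso (X i)
          bijective_map_of_isIso (h.H n) _
        exact ⟨DirectSum.lmap_injective _ |>.2 fun i => (hb i).1,
          DirectSum.lmap_surjective _ |>.2 fun i => (hb i).2⟩
      have key : (toModule Λ I ((h.H n).obj (Φ.obj (EquivHomology.coproduct X).toPair))
          fun i => ((h.H n).map (Φ.map (coproductIncl X i))).hom) ∘ L =
          ((h.H n).map (e ≫ (Φ.obj (EquivHomology.coproduct X).toPair).inclPair)).hom ∘
            (toModule Λ I ((h.H n).obj (EquivHomology.coproduct X').toPair)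
              fun i => ((h.H n).map (coproductIncl X' i)).hom) := by
        funext z
        simp only [Function.comp]
        induction z using DirectSum.induction_on with
        | zero => simp
        | of j x =>
          rw [← DirectSum.lof_eq_of Λ]
          simp only [L]
          rw [lmap_lof, toModule_lof, toModule_lof]
          have h3 : (Φ.obj (X j).toPair).inclPair ≫ Φ.map (coproductIncl X j) =
              coproductIncl X' j ≫ e ≫ (Φ.obj (EquivHomology.coproduct X).toPair).inclPair := by
            rw [← Category.assoc, he]
            rfl
          have h4 := congrArg (h.H n).map h3
          rw [CategoryTheory.Functor.map_comp, CategoryTheory.Functor.map_comp] at h4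
          exact ConcreteCategory.congr_hom h4 x
        | add x y hx hy => simp only [map_add, hx, hy]
      rw [← key] at h2
      exact (Function.Bijective.of_comp_iff _ hL).1 h2 }

end GoodFunctor

/-! ### Restriction, induction and products as good functors -/

section Restriction

variable {H G : Type u} [Group H] [Group G] (α : H →* G)

/-- The restriction of a CW-structure along a homomorphism. -/
def GCWStructure.res {X : Type u} [TopologicalSpace X] [MulAction G X] (S : GCWStructure G X) :
    letI := MulAction.compHom X α; GCWStructure H X :=
  letI := MulAction.compHom X α
  { cell := S.cell
    cellAct := fun _ => MulAction.compHom _ α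
    map := S.map
    continuousOn := S.continuousOn
    map_smul := fun n h e y hy => S.map_smul n (α h) e y hy
    boundary := S.boundary
    bijective := S.bijective
    isClosed_of_subset := S.isClosed_of_subset
    isClosed_of_inter := S.isClosed_of_inter }

/-- The restriction functor `α^*`. -/
def resFunctor : GCWPair.{u} G ⥤ GCWPair.{u} H where
  obj P :=
    letI := MulAction.compHom P.X.carrier α
    { X :=
        { carrier := P.X.carrier
          cont := ⟨fun h => continuous_const_smul (α h)⟩
          exists_structure := P.X.exists_structure.map (GCWStructure.res α) }
      A := P.A
      isSub := by
        obtain ⟨S, hS⟩ := P.isSub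
        exact ⟨S.res α, fun h => hS.1 (α h), hS.2⟩ }
  map f :=
    { toFun := f.toFun
      continuous := f.continuous
      equivariant := fun h => f.equivariant (α h)
      mapsTo := f.mapsTo }

theorem goodFunctor_res : GoodFunctor (resFunctor α) where
  homotopic := fun ⟨h, hc, h0, h1, hg, hA⟩ => ⟨h, hc, h0, h1, fun k => hg (α k), hA⟩
  relHomeo h := ⟨h.mem_of_mem, h.injOn, h.surj, h.isClosed⟩
  toPair_A _ := rfl
  inclPair P := IsHomeomorph.id (X := P.X.carrier)
  isEmbedding P := IsEmbedding.subtypeVal (p := fun x => x ∈ P.A)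
  range_eq P := Subtype.range_val (s := P.A)
  coproduct X := IsHomeomorph.id (X := Σ i, (X i).carrier)

end Restriction

section Induction

variable {H G : Type u} [Group H] [Group G] (α : H →* G)

namespace Ind

variable {X : Type u} [MulAction H X]

theorem isQuotientMap_mk [TopologicalSpace X] :
    IsQuotientMap (fun s : Σ _ : G, X => Ind.mk α s.1 s.2) := by
  refine isQuotientMap_iff_isClosed.2 ⟨fun p => ?_, fun C => ?_⟩
  · obtain ⟨g, x, rfl⟩ := Ind.exists_mk α p
    exact ⟨⟨g, x⟩, rfl⟩
  · rw [Ind.isClosed_iff, isClosed_sigma_iff]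
    rfl

theorem continuous_prod [TopologicalSpace X] {Z W : Type*} [TopologicalSpace Z]
    [LocallyCompactSpace Z] [TopologicalSpace W] {f : Ind α X × Z → W}
    (h : ∀ g, Continuous fun z : X × Z => f (Ind.mk α g z.1, z.2)) : Continuous f :=
  (isQuotientMap_mk α).continuous_lift_prod_left (continuous_sigma_prod h)

end Ind

theorem mk_mem_ind_A {P : GCWPair H} {g : G} {x : P.X.carrier} :
    Ind.mk α g x ∈ ((indFunctor α).obj P).A ↔ x ∈ P.A := by
  refine ⟨?_, fun hx => ⟨g, x, hx, rfl⟩⟩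
  rintro ⟨g', a, ha, h⟩
  obtain ⟨k, -, rfl⟩ := (Ind.mk_eq_iff α).1 h
  exact (P.smul_mem_A k⁻¹).2 ha

theorem isRelHomeo_ind {P Q : GCWPair H} {F : P ⟶ Q} (hF : IsRelHomeo F) :
    IsRelHomeo ((indFunctor α).map F) where
  mem_of_mem p hp := by
    obtain ⟨g, x, rfl⟩ := Ind.exists_mk α p
    exact (mk_mem_ind_A α).2 (hF.mem_of_mem x ((mk_mem_ind_A α (P := Q)).1 hp))
  injOn p q hp hq h := by
    obtain ⟨g, x, rfl⟩ := Ind.exists_mk α p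
    obtain ⟨g', x', rfl⟩ := Ind.exists_mk α q
    obtain ⟨k, rfl, hk⟩ := (Ind.mk_eq_iff α).1 h
    rw [← F.equivariant] at hk
    have hx : x ∉ P.A := fun h => hp ((mk_mem_ind_A α).2 h)
    have hx' : x' ∉ P.A := fun h => hq ((mk_mem_ind_A α).2 h)
    have : x' = k⁻¹ • x := hF.injOn _ _ hx' (fun h => hx ((P.smul_mem_A k⁻¹).1 h)) hk
    exact (Ind.mk_eq_iff α).2 ⟨k, rfl, this⟩
  surj q hq := by
    obtain ⟨g, y, rfl⟩ := Ind.exists_mk α q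
    obtain ⟨x, rfl⟩ := hF.surj y fun hy => hq ((mk_mem_ind_A α).2 hy)
    exact ⟨Ind.mk α g x, rfl⟩
  isClosed C hC h := by
    refine (Ind.isClosed_iff α C).2 fun g => hF.isClosed _ ?_ ?_
    · refine hC.imp (fun hC y hy => hC ((mk_mem_ind_A α).2 hy)) fun hC => ?_
      exact disjoint_left.2 fun y hy hy' => disjoint_left.1 hC ((mk_mem_ind_A α).2 hy) hy'
    · exact (Ind.isClosed_iff α _).1 h g

theorem goodFunctor_ind : GoodFunctor (indFunctor α) where
  homotopic {P Q f₀ f₁} := fun ⟨h, hc, h0, h1, hg, hA⟩ => by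
    refine ⟨fun z => Ind.map α (fun x => h (x, z.2)) (fun k x => hg k x z.2) z.1, ?_, fun p => ?_,
      fun p => ?_, fun k p t => ?_, ?_⟩
    · refine Ind.continuous_prod α fun g => ?_
      exact (Ind.continuous_mk α g).comp hc
    · obtain ⟨g, x, rfl⟩ := Ind.exists_mk α p
      exact congrArg (Ind.mk α g) (h0 x)
    · obtain ⟨g, x, rfl⟩ := Ind.exists_mk α p
      exact congrArg (Ind.mk α g) (h1 x)
    · obtain ⟨g, x, rfl⟩ := Ind.exists_mk α p
      rfl
    · rintro _ ⟨g, a, ha, rfl⟩ t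
      exact ⟨g, h (a, t), hA a ha t, rfl⟩
  relHomeo := isRelHomeo_ind α
  toPair_A X := by
    refine eq_empty_of_forall_notMem ?_
    rintro _ ⟨_, _, h, _⟩
    exact h.elim
  inclPair P := by
    have : ((indFunctor α).map P.inclPair).toFun = (id : Ind α P.X.carrier → _) := by
      funext p
      obtain ⟨g, x, rfl⟩ := Ind.exists_mk α p
      rfl
    rw [this]
    exact IsHomeomorph.id (X := Ind α P.X.carrier)
  isEmbedding P := by
    refine (IsClosedEmbedding.of_continuous_injective_isClosedMap
      ((indFunctor α).map (P.inclSub ≫ P.inclPair)).continuous ?_ fun C hC => ?_).isEmbedding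
    · intro p q h
      obtain ⟨g, a, rfl⟩ := Ind.exists_mk α p
      obtain ⟨g', a', rfl⟩ := Ind.exists_mk α q
      obtain ⟨k, h1, h2⟩ := (Ind.mk_eq_iff α).1 h
      exact (Ind.mk_eq_iff α).2 ⟨k, h1, Subtype.ext h2⟩
    · refine (Ind.isClosed_iff α _).2 fun g => ?_
      convert P.isClosed_A.isClosedEmbedding_subtypeVal.isClosedMap _
        ((Ind.isClosed_iff α C).1 hC g) using 1
      ext x
      constructor
      · rintro ⟨p, hp, h⟩
        obtain ⟨g', a, rfl⟩ := Ind.exists_mk α p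
        obtain ⟨k, rfl, rfl⟩ := (Ind.mk_eq_iff α).1 h
        refine ⟨(k⁻¹ • a : P.sub.carrier), ?_, rfl⟩
        have : Ind.mk α (g' * α k) (k⁻¹ • a : P.sub.carrier) = Ind.mk α g' a := by
          rw [Ind.mk_mul, smul_inv_smul]
        exact (congrArg (· ∈ C) this).mpr hp
      · rintro ⟨a, ha, rfl⟩
        exact ⟨Ind.mk α g a, ha, rfl⟩
  range_eq P := by
    ext p
    constructor
    · rintro ⟨q, rfl⟩
      obtain ⟨g, a, rfl⟩ := Ind.exists_mk α q
      exact ⟨g, a.1, a.2, rfl⟩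
    · rintro ⟨g, a, ha, rfl⟩
      exact ⟨Ind.mk α g (⟨a, ha⟩ : P.sub.carrier), rfl⟩
  coproduct X := by
    refine ⟨continuous_sigma fun i => ((indFunctor α).map (coproductIncl X i)).continuous, ?_, ?_,
      ?_⟩
    · refine isOpenMap_sigma.2 fun i U hU => (Ind.isOpen_iff α _).2 fun g => ?_
      refine (congrArg (IsOpen (X := Σ i, (X i).carrier)) ?_).mpr (isOpenMap_sigmaMk (i := i) _
        ((Ind.isOpen_iff α U).1 hU g))
      ext s
      constructor
      · rintro ⟨p, hp, h⟩
        obtain ⟨g', x, rfl⟩ := Ind.exists_mk α p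
        obtain ⟨k, rfl, rfl⟩ := (Ind.mk_eq_iff α).1 h
        refine ⟨k⁻¹ • x, ?_, rfl⟩
        have : Ind.mk α (g' * α k) (k⁻¹ • x) = Ind.mk α g' x := by rw [Ind.mk_mul, smul_inv_smul]
        exact (congrArg (· ∈ U) this).mpr hp
      · rintro ⟨x, hx, rfl⟩
        exact ⟨Ind.mk α g x, hx, rfl⟩
    · rintro ⟨i, p⟩ ⟨j, q⟩ h
      obtain ⟨g, x, rfl⟩ := Ind.exists_mk α p
      obtain ⟨g', x', rfl⟩ := Ind.exists_mk α q
      obtain ⟨k, h1, h2⟩ := (Ind.mk_eq_iff α).1 h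
      have h3 : (⟨j, x'⟩ : Σ i, (X i).carrier) = ⟨i, k⁻¹ • x⟩ := h2
      obtain rfl : j = i := congrArg Sigma.fst h3
      simp only [Sigma.mk.injEq, heq_eq_eq, true_and] at h3
      exact congrArg (Sigma.mk j) ((Ind.mk_eq_iff α).2 ⟨k, h1, h3⟩)
    · intro p
      obtain ⟨g, ⟨i, x⟩, rfl⟩ := Ind.exists_mk α p
      exact ⟨⟨i, Ind.mk α g x⟩, rfl⟩

end Induction

section Product

variable {G E : Type u} [Group G] [MulAction G E] (S : CellSystem G E)

/-- Relative homeomorphisms are stable under products with locally compact spaces: a set of the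
second product is encoded by the function that maps a point to its slice. -/
theorem IsRelHomeo.isClosed_prod {P Q : GCWPair G} {F : P ⟶ Q} (hF : IsRelHomeo F) {K : Type*}
    [TopologicalSpace K] [LocallyCompactSpace K] {C : Set (K × Q.X.carrier)}
    (hC : (∀ k, ∀ y ∈ Q.A, (k, y) ∈ C) ∨ ∀ k, ∀ y ∈ Q.A, (k, y) ∉ C)
    (h : IsClosed {z : K × P.X.carrier | (z.1, F.toFun z.2) ∈ C}) : IsClosed C := by
  have h1 : Continuous fun z : P.X.carrier × K => (z.2, F.toFun z.1) ∉ C :=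
    (isClosed_iff_continuous_notMem.1 h).comp continuous_swap
  have h2 : ∀ y, Continuous fun k : K => (k, y) ∉ C := by
    intro y
    by_cases hy : y ∈ Q.A
    · rcases hC with hC | hC
      · simp only [hC _ y hy]
        exact continuous_const
      · simp only [hC _ y hy]
        exact continuous_const
    · obtain ⟨x, rfl⟩ := hF.surj y hy
      exact h1.comp (Continuous.prodMk_right x)
  let f : Q.X.carrier → C(K, Prop) := fun y => ⟨_, h2 y⟩
  have h3 : Continuous fun x => f (F.toFun x) :=
    (ContinuousMap.curry ⟨_, h1⟩).continuous
  have h4 : ∀ y ∈ Q.A, ∀ y' ∈ Q.A, f y = f y' := by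
    intro y hy y' hy'
    ext k
    rcases hC with hC | hC
    · exact iff_of_false (not_not.2 (hC k y hy)) (not_not.2 (hC k y' hy'))
    · exact iff_of_true (hC k y hy) (hC k y' hy')
  have h5 : Continuous f := by
    refine continuous_iff_isClosed.2 fun Z hZ => hF.isClosed _ ?_ (hZ.preimage h3)
    by_cases hA : ∃ y ∈ Q.A, f y ∈ Z
    · obtain ⟨y, hy, hyZ⟩ := hA
      exact Or.inl fun y' hy' => by
        rw [mem_preimage, h4 y' hy' y hy]
        exact hyZ
    · exact Or.inr (disjoint_left.2 fun y hy hyZ => hA ⟨y, hy, hyZ⟩)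
  refine isClosed_iff_continuous_notMem.2 ?_
  exact (ContinuousMap.continuous_uncurry_of_continuous ⟨f, h5⟩).comp continuous_swap

open CellSystem

theorem goodFunctor_prod : GoodFunctor S.prodFunctor where
  homotopic {P Q f₀ f₁} := fun ⟨h, hc, h0, h1, hg, hA⟩ => by
    refine ⟨fun z : S.Product P.X.carrier × unitInterval => (z.1.1, h (z.1.2, z.2)), ?_,
      fun p => Prod.ext rfl (h0 _), fun p => Prod.ext rfl (h1 _),
      fun k p t => Prod.ext rfl (hg k _ t), fun p hp t => hA _ hp t⟩
    refine CellSystem.continuous_prod fun n e => ?_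
    exact (continuous_cellProd e).comp ((continuous_fst.comp continuous_fst).prodMk
      (hc.comp ((continuous_snd.comp continuous_fst).prodMk continuous_snd)))
  relHomeo {P Q F} hF :=
    { mem_of_mem := fun p hp => hF.mem_of_mem p.2 hp
      injOn := fun p q hp hq h => Prod.ext (congrArg (fun z : E × Q.X.carrier => z.1) h)
        (hF.injOn _ _ hp hq (congrArg (fun z : E × Q.X.carrier => z.2) h))
      surj := fun q hq => by
        obtain ⟨x, hx⟩ := hF.surj q.2 hq
        exact ⟨(q.1, x), Prod.ext rfl hx⟩
      isClosed := fun C hC h => by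
        refine CellSystem.isClosed_iff.2 fun n e => hF.isClosed_prod ?_ ?_
        · refine hC.imp (fun hC k y hy => hC hy) fun hC k y hy hy' => ?_
          exact disjoint_left.1 hC (show S.cellProd e (k, y) ∈ _ from hy) hy'
        · exact CellSystem.isClosed_iff.1 h n e }
  toPair_A X := rfl
  inclPair P := IsHomeomorph.id (X := S.Product P.X.carrier)
  isEmbedding P := by
    refine (IsClosedEmbedding.of_continuous_injective_isClosedMap
      (S.prodFunctor.map (P.inclSub ≫ P.inclPair)).continuous ?_ fun C hC => ?_).isEmbedding
    · intro p q h
      exact Prod.ext (congrArg (fun z : E × P.X.carrier => z.1) h)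
        (Subtype.ext (congrArg (fun z : E × P.X.carrier => z.2) h))
    · refine CellSystem.isClosed_iff.2 fun n e => ?_
      have h1 : IsClosedEmbedding (Prod.map id Subtype.val : disc n × P.A → disc n × P.X.carrier) :=
        IsClosedEmbedding.id.prodMap P.isClosed_A.isClosedEmbedding_subtypeVal
      convert h1.isClosedMap _ (CellSystem.isClosed_iff.1 hC n e) using 1
      ext ⟨y, x⟩
      constructor
      · rintro ⟨⟨c, a⟩, hp, h⟩
        have h2 : c = S.map n e y := congrArg (fun z : E × P.X.carrier => z.1) h
        have h3 : a.1 = x := congrArg (fun z : E × P.X.carrier => z.2) h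
        subst h2 h3
        exact ⟨(y, a), hp, rfl⟩
      · rintro ⟨⟨y', a⟩, ha, h⟩
        obtain ⟨rfl, rfl⟩ := Prod.ext_iff.1 h
        exact ⟨S.cellProd e (y', a), ha, rfl⟩
  range_eq P := by
    ext p
    constructor
    · rintro ⟨q, rfl⟩
      exact q.2.2
    · intro hp
      exact ⟨(p.1, ⟨p.2, hp⟩), rfl⟩
  coproduct X := by
    refine ⟨continuous_sigma fun i => (S.prodFunctor.map (coproductIncl X i)).continuous, ?_, ?_,
      ?_⟩
    · refine isOpenMap_sigma.2 fun i U hU => CellSystem.isOpen_iff.2 fun n e => ?_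
      have h0 : IsOpenEmbedding (Sigma.mk (β := fun i => (X i).carrier) i) := .sigmaMk
      have h1 : IsOpenEmbedding (Prod.map id (Sigma.mk (β := fun i => (X i).carrier) i) :
          disc n × (X i).carrier → disc n × Σ i, (X i).carrier) := .prodMap .id h0
      refine (congrArg (IsOpen (X := disc n × Σ i, (X i).carrier)) ?_).mpr
        (h1.isOpenMap _ (CellSystem.isOpen_iff.1 hU n e))
      ext ⟨y, s⟩
      constructor
      · rintro ⟨⟨c, x⟩, hp, h⟩
        have h2 : c = S.map n e y := congrArg (fun z : E × Σ i, (X i).carrier => z.1) h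
        have h3 : ⟨i, x⟩ = s := congrArg (fun z : E × Σ i, (X i).carrier => z.2) h
        subst h2 h3
        exact ⟨(y, x), hp, rfl⟩
      · rintro ⟨⟨y', x⟩, hx, h⟩
        obtain ⟨rfl, rfl⟩ := Prod.ext_iff.1 h
        exact ⟨S.cellProd e (y', x), hx, rfl⟩
    · rintro ⟨i, p⟩ ⟨j, q⟩ h
      have h1 : p.1 = q.1 := congrArg (fun z : E × Σ i, (X i).carrier => z.1) h
      have h2 : (⟨i, p.2⟩ : Σ i, (X i).carrier) = ⟨j, q.2⟩ :=
        congrArg (fun z : E × Σ i, (X i).carrier => z.2) h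
      obtain rfl : i = j := congrArg Sigma.fst h2
      simp only [Sigma.mk.injEq, heq_eq_eq, true_and] at h2
      exact congrArg (Sigma.mk i) (Prod.ext h1 h2)
    · rintro ⟨c, ⟨i, x⟩⟩
      exact ⟨⟨i, c, x⟩, rfl⟩

end Product

/-! ### The maps on homology induced by semi-equivariant maps -/

section SemiMap

variable {H G K : Type u} [Group H] [Group G] [Group K]

/-- A map of pairs `P → Q` which is equivariant along `α : H → G`, i.e. a map `P → α^* Q`. -/
structure SemiMap (α : H →* G) (P : GCWPair H) (Q : GCWPair G) where
  toFun : P.X.carrier → Q.X.carrier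
  continuous : Continuous toFun
  equivariant : ∀ (h : H) x, toFun (h • x) = α h • toFun x
  mapsTo : ∀ x ∈ P.A, toFun x ∈ Q.A

namespace SemiMap

variable {α : H →* G} {β : G →* K} {P P' : GCWPair H} {Q Q' : GCWPair G} {R : GCWPair K}

/-- The map `α_* P → Q` adjoint to a semi-equivariant map. -/
def adj (f : SemiMap α P Q) : (indFunctor α).obj P ⟶ Q where
  toFun := Ind.lift α (fun g x => g • f.toFun x) fun g h x => by
    rw [f.equivariant, smul_smul, mul_assoc, ← map_mul, mul_inv_cancel, map_one, mul_one]
  continuous := Ind.continuous_of α fun g => (continuous_const_smul g).comp f.continuous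
  equivariant k p := by
    obtain ⟨g, x, rfl⟩ := Ind.exists_mk α p
    exact mul_smul k g (f.toFun x)
  mapsTo := by
    rintro _ ⟨g, a, ha, rfl⟩
    exact (Q.smul_mem_A g).2 (f.mapsTo a ha)

/-- The composition of semi-equivariant maps. -/
def comp (f : SemiMap α P Q) (f' : SemiMap β Q R) : SemiMap (β.comp α) P R where
  toFun := f'.toFun ∘ f.toFun
  continuous := f'.continuous.comp f.continuous
  equivariant h x := by
    simp only [Function.comp, f.equivariant, f'.equivariant]
    rfl
  mapsTo x hx := f'.mapsTo _ (f.mapsTo x hx)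

/-- Composition with an equivariant map of the source. -/
def precomp (e : P' ⟶ P) (f : SemiMap α P Q) : SemiMap α P' Q where
  toFun := f.toFun ∘ e.toFun
  continuous := f.continuous.comp e.continuous
  equivariant h x := by simp only [Function.comp, f.equivariant, e.equivariant]
  mapsTo x hx := f.mapsTo _ (e.mapsTo x hx)

/-- Composition with an equivariant map of the target. -/
def postcomp (f : SemiMap α P Q) (e : Q ⟶ Q') : SemiMap α P Q' where
  toFun := e.toFun ∘ f.toFun
  continuous := e.continuous.comp f.continuous
  equivariant h x := by simp only [Function.comp, f.equivariant, e.equivariant]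
  mapsTo x hx := e.mapsTo _ (f.mapsTo x hx)

/-- The restriction of a semi-equivariant map to the subcomplexes. -/
def sub (f : SemiMap α P Q) : SemiMap α P.sub.toPair Q.sub.toPair where
  toFun a := ⟨f.toFun a.1, f.mapsTo a.1 a.2⟩
  continuous := (f.continuous.comp continuous_subtype_val).subtype_mk _
  equivariant h a := Subtype.ext (f.equivariant h a.1)
  mapsTo _ h := h.elim

variable (α)

/-- The unit `x ↦ (1, x)` of the induction. -/
def unit (P : GCWPair H) : SemiMap α P ((indFunctor α).obj P) where
  toFun x := Ind.mk α 1 x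
  continuous := Ind.continuous_mk α 1
  equivariant h x := by
    refine (Ind.mk_mul α 1 h x).symm.trans ?_
    rw [one_mul]
    exact congrArg (Ind.mk α · x) (mul_one (α h)).symm
  mapsTo x hx := ⟨1, x, hx, rfl⟩

/-- The identity of the underlying spaces. -/
def ofRes (Q : GCWPair G) : SemiMap α ((resFunctor α).obj Q) Q where
  toFun x := x
  continuous := continuous_id
  equivariant _ _ := rfl
  mapsTo _ h := h

/-- The map between one-point spaces. -/
def point : SemiMap α (point H) (point G) where
  toFun x := x
  continuous := continuous_id
  equivariant _ _ := rfl
  mapsTo _ h := h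

theorem adj_unit (P : GCWPair H) : (unit α P).adj = 𝟙 _ := by
  ext p
  obtain ⟨g, x, rfl⟩ := Ind.exists_mk α p
  exact congrArg (Ind.mk α · x) (mul_one g)

/-- The action of `g` as a map which is equivariant along the conjugation with `g`. -/
def smul (g : G) (Q : GCWPair G) : SemiMap (MulAut.conj g).toMonoidHom Q Q where
  toFun x := g • x
  continuous := continuous_const_smul g
  equivariant k x := by simp [← mul_smul]
  mapsTo _ hx := (Q.smul_mem_A g).2 hx

end SemiMap

end SemiMap

namespace EquivariantHomologyTheory

variable {Γ : Type u} [Group Γ] {Λ : Type v} [Ring Λ] (ℋ : EquivariantHomologyTheory.{u, v, w} Γ Λ)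
  {H G K : Type u} [Group H] [Group G] [Group K] {ξ : H →* Γ} {μ : G →* Γ} {ν : K →* Γ}
  {α : H →* G} {β : G →* K} (hα : μ.comp α = ξ) (hβ : ν.comp β = μ) (n : ℤ)
  {P P' : GCWPair.{u} H} {Q Q' : GCWPair.{u} G} {R : GCWPair.{u} K}

/-- The map on homology induced by a semi-equivariant map, the composite of the induction
homomorphism and the map induced by the adjoint. -/
def push (f : SemiMap α P Q) : ((ℋ.theory ξ).H n).obj P ⟶ ((ℋ.theory μ).H n).obj Q :=
  (ℋ.ind ξ μ α hα n).app P ≫ ((ℋ.theory μ).H n).map f.adj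

theorem push_congr {α' : H →* G} (h : α = α') (hα' : μ.comp α' = ξ) {f : SemiMap α P Q}
    {f' : SemiMap α' P Q} (hf : ∀ x, f.toFun x = f'.toFun x) :
    ℋ.push hα n f = ℋ.push hα' n f' := by
  subst h
  obtain ⟨f, _, _, _⟩ := f
  obtain ⟨f', _, _, _⟩ := f'
  obtain rfl : f = f' := funext hf
  rfl

theorem push_comp (f : SemiMap α P Q) (f' : SemiMap β Q R) (hβα : ν.comp (β.comp α) = ξ) :
    ℋ.push hα n f ≫ ℋ.push hβ n f' = ℋ.push hβα n (f.comp f') := by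
  unfold push
  have h1 := (ℋ.ind μ ν β hβ n).naturality f.adj
  simp only [Functor.comp_map] at h1
  have h2 : (indFunctor β).map f.adj ≫ f'.adj = indComp α β P ≫ (f.comp f').adj := by
    ext p
    obtain ⟨k, q, rfl⟩ := Ind.exists_mk β p
    obtain ⟨g, x, rfl⟩ := Ind.exists_mk α q
    change k • f'.toFun (g • f.toFun x) = (k * β g) • f'.toFun (f.toFun x)
    rw [f'.equivariant, mul_smul]
  rw [Category.assoc, reassoc_of% h1, ← CategoryTheory.Functor.map_comp, h2,
    CategoryTheory.Functor.map_comp, ℋ.ind_comp ξ μ ν α β hα hβ hβα, Category.assoc, Category.assoc]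

theorem map_push (e : P' ⟶ P) (f : SemiMap α P Q) :
    ((ℋ.theory ξ).H n).map e ≫ ℋ.push hα n f = ℋ.push hα n (f.precomp e) := by
  unfold push
  have h1 := (ℋ.ind ξ μ α hα n).naturality e
  simp only [Functor.comp_map] at h1
  have h2 : (indFunctor α).map e ≫ f.adj = (f.precomp e).adj := by
    ext p
    obtain ⟨g, x, rfl⟩ := Ind.exists_mk α p
    rfl
  rw [reassoc_of% h1, ← CategoryTheory.Functor.map_comp, h2]

theorem push_map (f : SemiMap α P Q) (e : Q ⟶ Q') :
    ℋ.push hα n f ≫ ((ℋ.theory μ).H n).map e = ℋ.push hα n (f.postcomp e) := by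
  unfold push
  have h2 : f.adj ≫ e = (f.postcomp e).adj := by
    ext p
    obtain ⟨g, x, rfl⟩ := Ind.exists_mk α p
    exact e.equivariant g _
  rw [Category.assoc, ← CategoryTheory.Functor.map_comp, h2]

/-- The axiom on conjugations: translation by an element over `1 : Γ` induces the identity. -/
theorem push_smul (g : G) (hg : μ g = 1) (h : μ.comp (MulAut.conj g).toMonoidHom = μ) :
    ℋ.push h n (SemiMap.smul g Q) = 𝟙 _ := by
  unfold push
  rw [ℋ.ind_conj μ g hg h, ← CategoryTheory.Functor.map_comp, ← CategoryTheory.Functor.map_id]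
  congr 1
  ext x
  change (1 : G) • g • g⁻¹ • x = x
  rw [one_smul, smul_inv_smul]

/-- A semi-equivariant map along the identity is an equivariant map. -/
theorem push_id (h : μ.comp (MonoidHom.id G) = μ) (f : SemiMap (MonoidHom.id G) Q Q') (e : Q ⟶ Q')
    (hf : ∀ x, f.toFun x = e.toFun x) : ℋ.push h n f = ((ℋ.theory μ).H n).map e := by
  have h1 : (MulAut.conj (1 : G)).toMonoidHom = MonoidHom.id G := by
    ext
    simp
  have h2 : μ.comp (MulAut.conj (1 : G)).toMonoidHom = μ := by rw [h1, h]
  have h3 := ℋ.push_smul (Q := Q) n (1 : G) (map_one μ) h2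
  rw [← Category.id_comp (((ℋ.theory μ).H n).map e), ← h3, ℋ.push_map]
  refine ℋ.push_congr _ n h1.symm _ fun x => (hf x).trans ?_
  change e.toFun x = e.toFun ((1 : G) • x)
  rw [one_smul]

theorem push_bdry (f : SemiMap α P Q) : ℋ.push hα n f ≫ ((ℋ.theory μ).bdry n).app Q =
    ((ℋ.theory ξ).bdry n).app P ≫ ℋ.push hα (n - 1) f.sub := by
  unfold push
  have h1 := ((ℋ.theory μ).bdry n).naturality f.adj
  have h2 : indSub α P ≫ (subFunctor G).map f.adj = f.sub.adj := by
    ext p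
    obtain ⟨g, x, rfl⟩ := Ind.exists_mk α p
    rfl
  have h3 : ((ℋ.theory μ).H (n - 1)).map (indSub α P) ≫
      ((ℋ.theory μ).H (n - 1)).map ((subFunctor G).map f.adj) =
        ((ℋ.theory μ).H (n - 1)).map f.sub.adj :=
    (CategoryTheory.Functor.map_comp _ _ _).symm.trans (congrArg _ h2)
  rw [Category.assoc, h1, reassoc_of% (ℋ.ind_bdry ξ μ α hα n P)]
  exact congrArg (fun k => ((ℋ.theory ξ).bdry n).app P ≫
    (ℋ.ind ξ μ α hα (n - 1)).app P.sub.toPair ≫ k) h3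

theorem push_unit : ℋ.push hα n (SemiMap.unit α P) = (ℋ.ind ξ μ α hα n).app P := by
  unfold push
  rw [SemiMap.adj_unit, CategoryTheory.Functor.map_id]
  exact Category.comp_id _

/-- The homology theory assigned to a group over `Γ`. -/
abbrev theory' (μ : G →* Γ) : HomologyTheory.{u, v, w} G Λ := (ℋ.theory μ).toHomologyTheory

/-- The morphisms of homology theories given by semi-equivariant maps between functors. -/
def pushHom {J : Type u} [Group J] {Φ : GCWPair.{u} J ⥤ GCWPair.{u} H}
    {Ψ : GCWPair.{u} J ⥤ GCWPair.{u} G}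
    (hΦ : GoodFunctor Φ) (hΨ : GoodFunctor Ψ) (f : ∀ P, SemiMap α (Φ.obj P) (Ψ.obj P))
    (hf : ∀ {P Q : GCWPair J} (k : P ⟶ Q) x,
      (f Q).toFun ((Φ.map k).toFun x) = (Ψ.map k).toFun ((f P).toFun x)) :
    ((ℋ.theory' ξ).pull hΦ).Hom ((ℋ.theory' μ).pull hΨ) where
  app n :=
    { app := fun P => ℋ.push hα n (f P)
      naturality := fun P Q k => by
        refine (ℋ.map_push hα n (Φ.map k) (f Q)).trans ?_
        refine Eq.trans ?_ (ℋ.push_map hα n (f P) (Ψ.map k)).symm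
        exact ℋ.push_congr hα n rfl hα fun x => hf k x }
  bdry n P := by
    have h1 := ℋ.push_bdry hα n (f P)
    have h2 : ℋ.push hα (n - 1) (f P).sub ≫ ((ℋ.theory μ).H (n - 1)).map (hΨ.subInv P) =
        ((ℋ.theory ξ).H (n - 1)).map (hΦ.subInv P) ≫ ℋ.push hα (n - 1) (f P.sub.toPair) := by
      rw [ℋ.push_map, ℋ.map_push]
      refine ℋ.push_congr hα _ rfl hα fun x => ?_
      have h3 : ∀ y, (hΨ.subInv P).toFun ((hΨ.subIso P).toFun y) = y := fun y =>
        congrFun (congrArg GCWPair.Hom.toFun (hΨ.subIso_subInv P)) y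
      obtain ⟨y, rfl⟩ : ∃ y, (hΦ.subIso P).toFun y = x :=
        ⟨(hΦ.subInv P).toFun x, congrFun (congrArg GCWPair.Hom.toFun
          (IsIso.inv_hom_id (hΦ.subIso P))) x⟩
      have h4 : (hΦ.subInv P).toFun ((hΦ.subIso P).toFun y) = y :=
        congrFun (congrArg GCWPair.Hom.toFun (hΦ.subIso_subInv P)) y
      change (hΨ.subInv P).toFun ((f P).sub.toFun ((hΦ.subIso P).toFun y)) =
        (f P.sub.toPair).toFun ((hΦ.subInv P).toFun ((hΦ.subIso P).toFun y))
      rw [h4, ← h3 ((f P.sub.toPair).toFun y)]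
      refine congrArg _ (Subtype.ext ?_)
      exact hf (P.inclSub ≫ P.inclPair) y
    refine (Category.assoc _ _ _).symm.trans ?_
    refine (congrArg (· ≫ ((ℋ.theory μ).H (n - 1)).map (hΨ.subInv P)) h1).trans ?_
    refine (Category.assoc _ _ _).trans ?_
    exact (congrArg (((ℋ.theory ξ).bdry n).app (Φ.obj P) ≫ ·) h2).trans (Category.assoc _ _ _).symm

end EquivariantHomologyTheory

/-! ### Classifying spaces -/

/-- The underlying set of the infinite join of a `G`-set `V`, decomposed into open cubes: the open
`p`-cells are indexed by the sequences of `p + 1` vertices. -/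
structure InfJoin (V : Type u) : Type u where
  dim : ℕ
  vert : Fin (dim + 1) → V
  coord : ball (0 : Fin dim → ℝ) 1

namespace InfJoin

variable {V : Type u}

/-- A vertex of the join. -/
def vertex (v : V) : InfJoin V := ⟨0, fun _ => v, ⟨0, mem_ball_self one_pos⟩⟩

theorem cons_mem_ball {p : ℕ} {s : ℝ} (hs : |s| < 1) {z : Fin p → ℝ}
    (hz : z ∈ ball (0 : Fin p → ℝ) 1) : (Fin.cons s z : Fin (p + 1) → ℝ) ∈
      ball (0 : Fin (p + 1) → ℝ) 1 := by
  rw [mem_openDisc] at hz ⊢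
  exact Fin.cases hs hz

open Classical in
/-- The points of the segment which joins a point `c`, at the parameter `-1`, to a vertex `v`, at the
parameter `1`. -/
noncomputable def cone (v : V) (c : InfJoin V) (s : ℝ) : InfJoin V :=
  if hs : |s| < 1 then ⟨c.dim + 1, Fin.cons v c.vert, ⟨Fin.cons s c.coord.1, cons_mem_ball hs c.coord.2⟩⟩
  else if s < 0 then c else vertex v

theorem cone_of_abs_lt (v : V) (c : InfJoin V) {s : ℝ} (hs : |s| < 1) : cone v c s =
    ⟨c.dim + 1, Fin.cons v c.vert, ⟨Fin.cons s c.coord.1, cons_mem_ball hs c.coord.2⟩⟩ :=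
  dif_pos hs

theorem cone_neg_one (v : V) (c : InfJoin V) : cone v c (-1) = c := by
  rw [cone, dif_neg (by simp), if_pos (by simp)]

theorem cone_one (v : V) (c : InfJoin V) : cone v c 1 = vertex v := by
  rw [cone, dif_neg (by simp), if_neg (by simp)]

/-- The characteristic maps of the join are iterated cones. -/
noncomputable def cellMap : ∀ p : ℕ, (Fin (p + 1) → V) → (Fin p → ℝ) → InfJoin V
  | 0, e, _ => vertex (e 0)
  | p + 1, e, y => cone (e 0) (cellMap p (Fin.tail e) (Fin.tail y)) (y 0)

theorem cellMap_cons {p : ℕ} (v : V) (e : Fin (p + 1) → V) (s : ℝ) (y : Fin p → ℝ) :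
    cellMap (p + 1) (Fin.cons v e) (Fin.cons s y) = cone v (cellMap p e y) s := by
  simp [cellMap]

theorem cellMap_of_mem_ball {p : ℕ} (e : Fin (p + 1) → V) {y : Fin p → ℝ}
    (hy : y ∈ ball (0 : Fin p → ℝ) 1) : cellMap p e y = ⟨p, e, ⟨y, hy⟩⟩ := by
  induction p with
  | zero =>
    obtain rfl : y = 0 := Subsingleton.elim _ _
    have : e = fun _ => e 0 := by
      funext i
      rw [Fin.fin_one_eq_zero i]
    rw [this]
    rfl
  | succ p ih =>
    have h := mem_openDisc.1 hy
    have ht : Fin.tail y ∈ ball (0 : Fin p → ℝ) 1 := mem_openDisc.2 fun i => h _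
    rw [cellMap, ih _ ht, cone_of_abs_lt _ _ (h 0)]
    simp only [Fin.cons_self_tail]

theorem tail_mem_disc {p : ℕ} {y : Fin (p + 1) → ℝ} (hy : y ∈ disc (p + 1)) :
    Fin.tail y ∈ disc p := mem_disc.2 fun _ => mem_disc.1 hy _

theorem cons_mem_disc {p : ℕ} {s : ℝ} (hs : |s| ≤ 1) {y : Fin p → ℝ} (hy : y ∈ disc p) :
    (Fin.cons s y : Fin (p + 1) → ℝ) ∈ disc (p + 1) := by
  rw [mem_disc] at hy ⊢
  exact Fin.cases hs hy

/-- Forgetting the first coordinate of a point of the disc. -/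
def tailMap (p : ℕ) : C(disc (p + 1), disc p) where
  toFun y := ⟨Fin.tail y.1, tail_mem_disc y.2⟩
  continuous_toFun := (continuous_pi fun i =>
    (continuous_apply i.succ).comp continuous_subtype_val).subtype_mk _

/-- The boundary of a cell is covered by finitely many faces: the two faces at which the first
coordinate is `±1`, and the cones over the faces of the cell with one vertex less. -/
theorem exists_faces (p : ℕ) (e : Fin (p + 1) → V) : ∃ L : Set (CellFace cellMap e), L.Finite ∧
    ∀ y : disc p, (y : Fin p → ℝ) ∉ ball (0 : Fin p → ℝ) 1 → ∃ f ∈ L, y ∈ f.carrier := by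
  induction p with
  | zero =>
    refine ⟨∅, finite_empty, fun y hy => (hy ?_).elim⟩
    rw [Subsingleton.elim (y : Fin 0 → ℝ) 0]
    exact mem_ball_self one_pos
  | succ p ih =>
    obtain ⟨L, hL, hcov⟩ := ih (Fin.tail e)
    have hc : Continuous fun y : disc (p + 1) => y.1 0 :=
      (continuous_apply 0).comp continuous_subtype_val
    let lower : CellFace cellMap e :=
      { dim := p
        dim_lt := p.lt_succ_self
        face := Fin.tail e
        carrier := {y | y.1 0 = -1}
        isClosed := isClosed_eq hc continuous_const
        proj := tailMap p
        map_eq := fun y hy => by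
          have hy : y.1 0 = -1 := hy
          rw [cellMap, hy, cone_neg_one]
          rfl }
    let upper : CellFace cellMap e :=
      { dim := 0
        dim_lt := p.succ_pos
        face := fun _ => e 0
        carrier := {y | y.1 0 = 1}
        isClosed := isClosed_eq hc continuous_const
        proj := ContinuousMap.const _ ⟨0, by simp⟩
        map_eq := fun y hy => by
          have hy : y.1 0 = 1 := hy
          change cone (e 0) _ (y.1 0) = vertex (e 0)
          rw [hy, cone_one] }
    let side (f : CellFace cellMap (Fin.tail e)) : CellFace cellMap e :=
      { dim := f.dim + 1
        dim_lt := Nat.succ_lt_succ f.dim_lt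
        face := (Fin.cons (e 0) f.face : Fin (f.dim + 1 + 1) → V)
        carrier := tailMap p ⁻¹' f.carrier
        isClosed := f.isClosed.preimage (tailMap p).continuous
        proj :=
          { toFun := fun y => ⟨Fin.cons (y.1 0) (f.proj (tailMap p y)).1,
              cons_mem_disc (mem_disc.1 y.2 0) (f.proj (tailMap p y)).2⟩
            continuous_toFun := by
              refine Continuous.subtype_mk (continuous_pi (Fin.cases hc fun i => ?_)) _
              exact (continuous_apply i).comp (continuous_subtype_val.comp
                (f.proj.continuous.comp (tailMap p).continuous)) }
        map_eq := fun y hy => by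
          refine Eq.trans ?_ (cellMap_cons _ _ _ _).symm
          exact congrArg (cone (e 0) · (y.1 0)) (f.map_eq _ hy) }
    refine ⟨insert lower (insert upper (side '' L)), ((hL.image side).insert _).insert _,
      fun y hy => ?_⟩
    by_cases h0 : |y.1 0| < 1
    · have ht : (tailMap p y).1 ∉ ball (0 : Fin p → ℝ) 1 := fun ht =>
        hy (mem_openDisc.2 (Fin.cases h0 (mem_openDisc.1 ht)))
      obtain ⟨f, hf, hyf⟩ := hcov _ ht
      exact ⟨side f, Or.inr (Or.inr ⟨f, hf, rfl⟩), hyf⟩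
    · have h1 : |y.1 0| = 1 := le_antisymm (mem_disc.1 y.2 0) (not_lt.1 h0)
      rcases eq_or_eq_neg_of_abs_eq h1 with h | h
      · exact ⟨upper, Or.inr (Or.inl rfl), h⟩
      · exact ⟨lower, Or.inl rfl, h⟩

variable {G : Type u} [Group G] [MulAction G V]

instance : MulAction G (InfJoin V) where
  smul g c := ⟨c.dim, g • c.vert, c.coord⟩
  one_smul c := congrArg (fun e => (⟨c.dim, e, c.coord⟩ : InfJoin V)) (one_smul G c.vert)
  mul_smul g h c :=
    congrArg (fun e => (⟨c.dim, e, c.coord⟩ : InfJoin V)) (mul_smul g h c.vert)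

theorem smul_cone (g : G) (v : V) (c : InfJoin V) (s : ℝ) :
    g • cone v c s = cone (g • v) (g • c) s := by
  by_cases hs : |s| < 1
  · rw [cone_of_abs_lt _ _ hs, cone_of_abs_lt _ _ hs]
    have : g • (Fin.cons v c.vert : Fin (c.dim + 1 + 1) → V) = Fin.cons (g • v) (g • c.vert) := by
      funext i
      exact Fin.cases rfl (fun _ => rfl) i
    exact congrArg (fun e => (⟨c.dim + 1, e, _⟩ : InfJoin V)) this
  · rw [cone, cone, dif_neg hs, dif_neg hs]
    split_ifs <;> rfl

theorem smul_cellMap (g : G) {p : ℕ} (e : Fin (p + 1) → V) (y : Fin p → ℝ) :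
    g • cellMap p e y = cellMap p (g • e) y := by
  induction p with
  | zero => rfl
  | succ p ih =>
    rw [cellMap, smul_cone, ih]
    rfl

variable (G V) in
/-- The cell decomposition of the infinite join. -/
noncomputable def system : CellSystem G (InfJoin V) where
  cell p := Fin (p + 1) → V
  map := cellMap
  map_smul _ g e y _ := (smul_cellMap g e y).symm
  bijective := by
    have : (fun p : (Σ n, (Fin (n + 1) → V) × ball (0 : Fin n → ℝ) 1) =>
        cellMap p.1 p.2.1 p.2.2) = fun p => ⟨p.1, p.2.1, p.2.2⟩ :=
      funext fun p => cellMap_of_mem_ball _ _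
    rw [this]
    refine ⟨fun p q h => ?_, fun c => ⟨⟨c.dim, c.vert, c.coord⟩, rfl⟩⟩
    obtain ⟨p, e, z⟩ := p
    obtain ⟨p', e', z'⟩ := q
    simp only [InfJoin.mk.injEq] at h
    obtain ⟨rfl, h1, h2⟩ := h
    rw [eq_of_heq h1, eq_of_heq h2]
  faces := exists_faces

theorem smul_eq_iff {g : G} {c : InfJoin V} : g • c = c ↔ ∀ i, g • c.vert i = c.vert i := by
  obtain ⟨p, e, z⟩ := c
  constructor
  · intro h i
    have h1 : (⟨p, g • e, z⟩ : InfJoin V) = ⟨p, e, z⟩ := h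
    simp only [InfJoin.mk.injEq, heq_eq_eq, and_true, true_and] at h1
    exact congrFun h1 i
  · intro h
    have : g • e = e := funext h
    exact congrArg (fun e => (⟨p, e, z⟩ : InfJoin V)) this

variable {X : Type u} [TopologicalSpace X] [MulAction G X]

/-- If the subgroup `H` fixes a vertex, then projecting away the join is a homotopy equivalence on
the fixed points. -/
theorem contractibleSpace_fixedPoints {H : Subgroup G} {v : V} (hv : ∀ h ∈ H, h • v = v)
    [ContractibleSpace (MulAction.fixedPoints H X)] :
    ContractibleSpace (MulAction.fixedPoints H ((system V G).Product X)) := by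
  have hfix : ∀ {p : (system V G).Product X}, p ∈ MulAction.fixedPoints H ((system V G).Product X) ↔
      (∀ h ∈ H, h • p.1 = p.1) ∧ p.2 ∈ MulAction.fixedPoints H X := by
    intro p
    constructor
    · intro hp
      exact ⟨fun h hh => congrArg Prod.fst (hp ⟨h, hh⟩), fun h => congrArg Prod.snd (hp h)⟩
    · intro hp h
      exact Prod.ext (hp.1 h h.2) (hp.2 h)
  have hvertex : ∀ h ∈ H, h • vertex v = vertex v := fun h hh => by
    rw [smul_eq_iff]
    exact fun _ => hv h hh
  let f : C(MulAction.fixedPoints H ((system V G).Product X), MulAction.fixedPoints H X) :=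
    { toFun := fun p => ⟨p.1.2, (hfix.1 p.2).2⟩
      continuous_toFun := (CellSystem.continuous_prodSnd.comp continuous_subtype_val).subtype_mk _ }
  have hc : Continuous fun x : X => (show (system V G).Product X from (vertex v, x)) :=
    (CellSystem.continuous_cellProd (S := system V G) (n := 0) (fun _ => v)).comp
      (Continuous.prodMk_right (⟨0, by simp⟩ : disc 0))
  let f' : C(MulAction.fixedPoints H X, MulAction.fixedPoints H ((system V G).Product X)) :=
    { toFun := fun x => ⟨(vertex v, x.1), hfix.2 ⟨hvertex, x.2⟩⟩
      continuous_toFun := (hc.comp continuous_subtype_val).subtype_mk _ }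
  have hcone : Continuous fun z : (system V G).Product X × unitInterval =>
      (show (system V G).Product X from (cone v z.1.1 (1 - 2 * z.2), z.1.2)) := by
    refine CellSystem.continuous_prod fun n e => ?_
    let q : (disc n × X) × unitInterval → disc (n + 1) × X := fun z =>
      (⟨Fin.cons (1 - 2 * (z.2 : ℝ)) z.1.1.1, cons_mem_disc (by
        have h1 := z.2.2.1
        have h2 := z.2.2.2
        rw [abs_le]
        constructor <;> linarith) z.1.1.2⟩, z.1.2)
    have hq : Continuous q := by
      refine Continuous.prodMk (Continuous.subtype_mk (continuous_pi (Fin.cases ?_ fun i => ?_)) _)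
        (continuous_snd.comp continuous_fst)
      · exact continuous_const.sub (continuous_const.mul (continuous_subtype_val.comp continuous_snd))
      · exact (continuous_apply i).comp
          (continuous_subtype_val.comp (continuous_fst.comp continuous_fst))
    refine ((CellSystem.continuous_cellProd (S := system V G) (n := n + 1)
      (Fin.cons v e : Fin (n + 1 + 1) → V)).comp hq).congr fun z => ?_
    exact Prod.ext (cellMap_cons v (show Fin (n + 1) → V from e) (1 - 2 * (z.2 : ℝ)) z.1.1.1) rfl
  let E : ContinuousMap.HomotopyEquiv (MulAction.fixedPoints H ((system V G).Product X))
      (MulAction.fixedPoints H X) :=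
    { toFun := f
      invFun := f'
      left_inv := ⟨
        { toFun := fun z => ⟨(cone v z.2.1.1 (1 - 2 * z.1), z.2.1.2), hfix.2 ⟨fun h hh => by
            rw [smul_cone, hv h hh, (hfix.1 z.2.2).1 h hh], (hfix.1 z.2.2).2⟩⟩
          continuous_toFun := (hcone.comp ((continuous_subtype_val.comp continuous_snd).prodMk
            continuous_fst)).subtype_mk _
          map_zero_left := fun p => Subtype.ext (Prod.ext (by
            change cone v p.1.1 (1 - 2 * 0) = vertex v
            rw [mul_zero, sub_zero, cone_one]) rfl)
          map_one_left := fun p => Subtype.ext (Prod.ext (by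
            change cone v p.1.1 (1 - 2 * 1) = p.1.1
            norm_num [cone_neg_one]) rfl) }⟩
      right_inv := by
        have : f.comp f' = ContinuousMap.id _ := rfl
        rw [this] }
  exact E.contractibleSpace

end InfJoin

section Classifying

variable {G : Type u} [Group G] (ℱ : SubgroupFamily G)

/-- The disjoint union of the orbits `G / L` with `L ∈ ℱ`. -/
abbrev Orbits : Type u := Σ L : ℱ.carrier, G ⧸ L.1

instance : MulAction G (Orbits ℱ) where
  smul g v := ⟨v.1, g • v.2⟩
  one_smul v := congrArg (Sigma.mk v.1) (one_smul G v.2)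
  mul_smul g h v := congrArg (Sigma.mk v.1) (mul_smul g h v.2)

variable {ℱ}

theorem exists_fixed_orbits {H : Subgroup G} (hH : H ∈ ℱ.carrier) :
    ∃ v : Orbits ℱ, ∀ h ∈ H, h • v = v := by
  refine ⟨⟨⟨H, hH⟩, ((1 : G) : G ⧸ H)⟩, fun h hh => congrArg (Sigma.mk _) ?_⟩
  refine QuotientGroup.eq.2 ?_
  simpa using hh

theorem mem_of_fixed_orbits {H : Subgroup G} {v : Orbits ℱ} (hv : ∀ h ∈ H, h • v = v) :
    H ∈ ℱ.carrier := by
  obtain ⟨⟨L, hL⟩, q⟩ := v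
  obtain ⟨g, rfl⟩ := QuotientGroup.mk_surjective q
  refine ℱ.mem_of_le _ (ℱ.conj_mem L hL g) H fun h hh => ?_
  have h1 : (⟨⟨L, hL⟩, ((h * g : G) : G ⧸ L)⟩ : Orbits ℱ) = ⟨⟨L, hL⟩, (g : G ⧸ L)⟩ := hv h hh
  simp only [Sigma.mk.injEq, heq_eq_eq, true_and] at h1
  have h2 := QuotientGroup.eq.1 h1.symm
  refine ⟨g⁻¹ * (h * g), h2, ?_⟩
  simp [mul_assoc]

/-- The product of the infinite join of the orbits `G / L`, `L ∈ ℱ`, with `X` is a classifying space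
for `ℱ` if the fixed point sets of `X` for the subgroups in `ℱ` are contractible. -/
theorem isClassifyingSpace_prod (X : GCWComplex G)
    (hX : ∀ H ∈ ℱ.carrier, ContractibleSpace (MulAction.fixedPoints H X.carrier)) :
    IsClassifyingSpace ℱ ((InfJoin.system (Orbits ℱ) G).prodFunctor.obj X.toPair).X := by
  intro H
  constructor
  · intro hH
    obtain ⟨v, hv⟩ := exists_fixed_orbits hH
    have := hX H hH
    exact InfJoin.contractibleSpace_fixedPoints (X := X.carrier) hv
  · intro hH
    refine eq_empty_of_forall_notMem fun p hp => hH ?_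
    refine mem_of_fixed_orbits (v := p.1.vert 0) fun h hh => ?_
    exact InfJoin.smul_eq_iff.1 (congrArg Prod.fst (hp ⟨h, hh⟩)) 0

theorem fixedPoints_res {K : Type u} [Group K] (φ : K →* G) (X : GCWComplex G) (H : Subgroup K) :
    (MulAction.fixedPoints H ((resFunctor φ).obj X.toPair).X.carrier : Set X.carrier) =
      MulAction.fixedPoints (H.map φ) X.carrier := by
  ext x
  constructor
  · rintro hx ⟨_, h, hh, rfl⟩
    exact hx ⟨h, hh⟩
  · intro hx h
    exact hx ⟨φ h, h, h.2, rfl⟩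

/-- Restrictions of classifying spaces are classifying spaces. -/
theorem IsClassifyingSpace.res {K : Type u} [Group K] (φ : K →* G) {X : GCWComplex G}
    (hX : IsClassifyingSpace ℱ X) :
    IsClassifyingSpace (ℱ.pullback φ) ((resFunctor φ).obj X.toPair).X := by
  intro H
  have h := fixedPoints_res φ X H
  refine ⟨fun hH => ?_, fun hH => ?_⟩
  · have h1 := (hX (H.map φ)).1 hH
    rw [← h] at h1
    exact h1
  · exact h.trans ((hX (H.map φ)).2 hH)

end Classifying

/-! ### Morphisms of homology theories which are bijective on orbits -/

section Identity

variable {G : Type u} [Group G] {Λ : Type v} [Ring Λ]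

theorem goodFunctor_id : GoodFunctor (𝟭 (GCWPair.{u} G)) where
  homotopic h := h
  relHomeo h := h
  toPair_A _ := rfl
  inclPair P := IsHomeomorph.id (X := P.X.carrier)
  isEmbedding P := IsEmbedding.subtypeVal (p := fun x => x ∈ P.A)
  range_eq P := Subtype.range_val (s := P.A)
  coproduct X := IsHomeomorph.id (X := Σ i, (X i).carrier)

/-- The identity morphism of a homology theory. -/
def HomologyTheory.Hom.refl (A : HomologyTheory.{u, v, w} G Λ) : A.Hom A where
  app _ := 𝟙 _
  bdry _ _ := (Category.id_comp _).trans (Category.comp_id _).symm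

/-- A morphism of homology theories which is bijective on the orbits is bijective on all complexes. -/
theorem HomologyTheory.Hom.bijective_of_orbits {A B : HomologyTheory.{u, v, w} G Λ} (a : A.Hom B)
    (h : ∀ (L : Subgroup G) n, Function.Bijective
      ((a.app n).app ((indFunctor L.subtype).obj (point L))).hom) (X : GCWComplex G) (n : ℤ) :
    Function.Bijective ((a.app n).app X.toPair).hom := by
  -- A morphism of homology theories is a system indexed by a point.
  let T : TheorySystem PUnit (fun _ => A) B :=
    { f := fun _ => .refl A
      g := fun _ => a
      g_f := fun _ _ _ => Category.id_comp _
      f_f := fun _ _ _ _ => Category.id_comp _ }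
  have key : ∀ P, T.Good P ↔ ∀ n, Function.Bijective ((a.app n).app P).hom := by
    refine fun P => forall_congr' fun n => ⟨fun hP => ⟨?_, fun y => ?_⟩, fun hP => ⟨fun y => ?_, ?_⟩⟩
    · refine (injective_iff_map_eq_zero _).2 fun x hx => ?_
      obtain ⟨_, _, h0⟩ := hP.inj PUnit.unit x hx
      exact h0
    · obtain ⟨_, x, hx⟩ := hP.surj y
      exact ⟨x, hx⟩
    · obtain ⟨x, hx⟩ := hP.2 y
      exact ⟨PUnit.unit, x, hx⟩
    · exact fun _ x hx => ⟨PUnit.unit, le_rfl, (hP.1 (hx.trans (map_zero _).symm) : x = 0)⟩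
  exact (key _).1 ((T.cellularClass_good fun L => (key _).2 (h L)).toPair X) n

end Identity

/-! ### Induction isomorphisms -/

section

variable {H G K : Type u} [Group H] [Group G] [Group K]

namespace SemiMap

/-- An equivariant map as a map which is equivariant along the identity. -/
def ofHom {P Q : GCWPair G} (e : P ⟶ Q) : SemiMap (MonoidHom.id G) P Q where
  toFun := e.toFun
  continuous := e.continuous
  equivariant := e.equivariant
  mapsTo := e.mapsTo

/-- The map of a point to a fixed point. -/
def const (α : H →* G) {Q : GCWPair G} (x : Q.X.carrier) (hx : ∀ h, α h • x = x) :
    SemiMap α (EquivHomology.point H) Q where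
  toFun _ := x
  continuous := continuous_const
  equivariant h _ := (hx h).symm
  mapsTo _ h := h.elim

end SemiMap

instance isIso_indComp (α : H →* G) (β : G →* K) (P : GCWPair H) : IsIso (indComp α β P) := by
  refine ⟨((SemiMap.unit α P).comp (SemiMap.unit β _)).adj, ?_, ?_⟩
  · ext p
    obtain ⟨k, q, rfl⟩ := Ind.exists_mk β p
    obtain ⟨g, x, rfl⟩ := Ind.exists_mk α q
    change Ind.mk β (k * β g * 1) (Ind.mk α 1 x) = Ind.mk β k (Ind.mk α g x)
    rw [mul_one, Ind.mk_mul, Ind.smul_mk, mul_one]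
  · ext p
    obtain ⟨k, x, rfl⟩ := Ind.exists_mk (β.comp α) p
    change Ind.mk (β.comp α) (k * 1 * β 1) x = Ind.mk (β.comp α) k x
    rw [map_one, mul_one, mul_one]

namespace EquivariantHomologyTheory

variable {Γ : Type u} [Group Γ] {Λ : Type v} [Ring Λ] (ℋ : EquivariantHomologyTheory.{u, v, w} Γ Λ)
  {ξ : H →* Γ} {μ : G →* Γ} {α : H →* G} (hα : μ.comp α = ξ) (n : ℤ)

/-- The induction homomorphism for an injective homomorphism is bijective on all complexes. -/
theorem bijective_ind (hinj : Function.Injective α) (X : GCWComplex H) :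
    Function.Bijective ((ℋ.ind ξ μ α hα n).app X.toPair).hom := by
  let a := ℋ.pushHom hα goodFunctor_id (goodFunctor_ind α) (fun P => SemiMap.unit α P)
    fun _ _ => rfl
  have key : ∀ n P, (a.app n).app P = (ℋ.ind ξ μ α hα n).app P := fun n P => ℋ.push_unit hα n
  have h1 := HomologyTheory.Hom.bijective_of_orbits a (fun L n => by
    rw [key]
    have h2 := ℋ.ind_comp (ξ.comp L.subtype) ξ μ L.subtype α rfl hα
      (by rw [← MonoidHom.comp_assoc, hα]) n (point L)
    have h3 := ℋ.ind_bijective (ξ.comp L.subtype) μ (α.comp L.subtype)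
      (by rw [← MonoidHom.comp_assoc, hα]) (hinj.comp Subtype.val_injective) n
    have h4 := ℋ.ind_bijective (ξ.comp L.subtype) ξ L.subtype rfl Subtype.val_injective n
    have h5 := bijective_map_of_isIso ((ℋ.theory μ).H n) (indComp L.subtype α (point L))
    rw [h2] at h3
    have h6 : Function.Bijective (((ℋ.ind ξ μ α hα n).app
        ((indFunctor L.subtype).obj (point L))).hom ∘
        ((ℋ.ind (ξ.comp L.subtype) ξ L.subtype rfl n).app (point L)).hom) :=
      (Function.Bijective.of_comp_iff' h5 _).1 h3
    exact (Function.Bijective.of_comp_iff _ h4).1 h6) X n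
  rw [key] at h1
  exact h1

/-- A semi-equivariant map along an injective homomorphism induces an isomorphism if its target is
induced from its source. -/
theorem bijective_push (hinj : Function.Injective α) {P : GCWPair.{u} H} (hP : P.A = ∅)
    {Q : GCWPair.{u} G} (f : SemiMap α P Q) [IsIso f.adj] :
    Function.Bijective (ℋ.push hα n f).hom := by
  have h0 : Function.Bijective ((ℋ.ind ξ μ α hα n).app P).hom := by
    have := GCWPair.isIso_inclPair hP
    have h1 := bijective_map_of_isIso ((ℋ.theory ξ).H n) P.inclPair
    have h2 := bijective_map_of_isIso (indFunctor α ⋙ (ℋ.theory μ).H n) P.inclPair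
    have h3 := h2.comp (ℋ.bijective_ind hα n hinj P.X)
    have h4 := (ℋ.ind ξ μ α hα n).naturality P.inclPair
    have h5 : Function.Bijective (((ℋ.theory ξ).H n).map P.inclPair ≫
        (ℋ.ind ξ μ α hα n).app P).hom := by
      rw [h4]
      exact h3
    exact (Function.Bijective.of_comp_iff _ h1).1 h5
  exact (bijective_map_of_isIso ((ℋ.theory μ).H n) f.adj).comp h0

end EquivariantHomologyTheory

end

/-! ### Projections of products and the enlargement of families -/

section Product

variable {K : Type u} [Group K] {E : Type u} [MulAction K E] (S : CellSystem K E)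

/-- The map `res_L (E × {•}) → E × K / L`, `e ↦ (e, L)`. -/
def orbitSlice (L : Subgroup K) :
    SemiMap L.subtype ((resFunctor L.subtype).obj (S.prodFunctor.obj (point K)))
      (S.prodFunctor.obj ((indFunctor L.subtype).obj (point L))) where
  toFun p := (p.1, Ind.mk L.subtype 1 PUnit.unit)
  continuous := CellSystem.continuous_iff.2 fun _ e =>
    (CellSystem.continuous_cellProd e).comp (continuous_fst.prodMk continuous_const)
  equivariant l _ := Prod.ext rfl ((SemiMap.unit L.subtype (point L)).equivariant l PUnit.unit)
  mapsTo _ h := h.elim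

/-- The isomorphism `K ×_L res_L E → E × K / L`, with inverse `(e, g L) ↦ (g, g⁻¹ e)`. -/
theorem isIso_adj_orbitSlice (L : Subgroup K) : IsIso (orbitSlice S L).adj := by
  let X := (indFunctor L.subtype).obj (point L)
  let R := (resFunctor L.subtype).obj (S.prodFunctor.obj (point K))
  have hinv : ∀ (e : E) (g : K) (l : L) (x : PUnit.{u + 1}),
      Ind.mk L.subtype (X := R.X.carrier) (g * l) ((g * l)⁻¹ • e, x) =
        Ind.mk L.subtype (X := R.X.carrier) g (g⁻¹ • e, x) := fun e g l x => by
    refine (Ind.mk_mul (X := R.X.carrier) L.subtype g l _).trans (congrArg _ (Prod.ext ?_ rfl))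
    change (l : K) • (g * l)⁻¹ • e = g⁻¹ • e
    rw [mul_inv_rev, mul_smul, smul_inv_smul]
  let j : S.prodFunctor.obj X ⟶ (indFunctor L.subtype).obj R :=
    { toFun := fun p => Ind.lift L.subtype (fun g (x : PUnit.{u + 1}) =>
        Ind.mk L.subtype (X := R.X.carrier) g (g⁻¹ • p.1, x)) (fun g l x => hinv p.1 g l x) p.2
      continuous := by
        refine CellSystem.continuous_iff.2 fun n e => ?_
        have h1 : ∀ g : K, Continuous fun z : (point L).X.carrier × disc n =>
            Ind.mk L.subtype (X := R.X.carrier) g (g⁻¹ • S.map n e z.2, z.1) := fun g =>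
          (Ind.continuous_mk (X := R.X.carrier) L.subtype g).comp
            ((continuous_const_smul (T := (S.prodFunctor.obj (point K)).X.carrier) g⁻¹).comp
              ((CellSystem.continuous_cellProd (S := S) (X := (point K).X.carrier) e).comp
                continuous_swap))
        have h2 := Ind.continuous_prod (X := (point L).X.carrier) L.subtype
          (f := fun z : Ind L.subtype (point L).X.carrier × disc n =>
            Ind.lift L.subtype (fun g (x : PUnit.{u + 1}) =>
              Ind.mk L.subtype (X := R.X.carrier) g (g⁻¹ • S.map n e z.2, x))
              (fun g l x => hinv (S.map n e z.2) g l x) z.1) h1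
        exact h2.comp continuous_swap
      equivariant := fun k p => by
        obtain ⟨e, q⟩ := p
        obtain ⟨g, x, rfl⟩ := Ind.exists_mk L.subtype q
        refine congrArg (Ind.mk L.subtype (X := R.X.carrier) (k * g)) (Prod.ext ?_ rfl)
        change (k * g)⁻¹ • k • e = g⁻¹ • e
        rw [mul_inv_rev, mul_smul, inv_smul_smul]
      mapsTo := by
        rintro ⟨e, _⟩ ⟨_, _, h, _⟩
        exact h.elim }
  refine ⟨j, ?_, ?_⟩
  · ext p
    obtain ⟨k, ⟨e, x⟩, rfl⟩ := Ind.exists_mk L.subtype p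
    change Ind.mk L.subtype (X := R.X.carrier) (k * 1) ((k * 1)⁻¹ • k • e, PUnit.unit) =
      Ind.mk L.subtype (X := R.X.carrier) k (e, x)
    rw [mul_one, inv_smul_smul]
    rfl
  · ext p
    obtain ⟨e, q⟩ := p
    obtain ⟨k, x, rfl⟩ := Ind.exists_mk L.subtype q
    refine Prod.ext (smul_inv_smul k e) ?_
    exact congrArg (Ind.mk L.subtype (X := (point L).X.carrier) · x) (mul_one k)

variable {Γ : Type u} [Group Γ] {Λ : Type v} [Ring Λ] (ℋ : EquivariantHomologyTheory.{u, v, w} Γ Λ)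

theorem bijective_map_toPoint_iff (F : GCWPair.{u} K ⥤ ModuleCat.{w} Λ) {P : GCWPair K}
    (hP : P.A = ∅) : Function.Bijective (F.map (toPoint P hP)).hom ↔
      Function.Bijective (F.map P.X.pr).hom := by
  have := GCWPair.isIso_inclPair hP
  have h1 : P.X.pr = P.inclPair ≫ toPoint P hP := rfl
  rw [h1, CategoryTheory.Functor.map_comp]
  exact (Function.Bijective.of_comp_iff _ (bijective_map_of_isIso F P.inclPair)).symm

/-- If `E → {•}` is a homology isomorphism for all subgroups, then `E × X → X` is one for all
complexes `X`: this holds for the orbits `K / L`, since `E × K / L` is induced from the restriction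
of `E` to `L`. -/
theorem EquivariantHomologyTheory.bijective_map_prodSnd (ξ : K →* Γ)
    (h : ∀ (L : Subgroup K) n, Function.Bijective (((ℋ.theory (ξ.comp L.subtype)).H n).map
      ((resFunctor L.subtype).obj (S.prodFunctor.obj (point K))).X.pr).hom)
    (X : GCWComplex K) (n : ℤ) :
    Function.Bijective (((ℋ.theory ξ).H n).map (S.prodSnd X.toPair)).hom := by
  have hξ : ξ.comp (MonoidHom.id K) = ξ := rfl
  let a := ℋ.pushHom hξ (goodFunctor_prod S) goodFunctor_id
    (fun P => SemiMap.ofHom (S.prodSnd P)) fun _ _ => rfl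
  have key : ∀ n P, (a.app n).app P = ((ℋ.theory ξ).H n).map (S.prodSnd P) := fun n P =>
    ℋ.push_id n hξ _ _ fun _ => rfl
  have h1 := HomologyTheory.Hom.bijective_of_orbits a (fun L n => by
    rw [key]
    have := isIso_adj_orbitSlice S L
    let R := (resFunctor L.subtype).obj (S.prodFunctor.obj (point K))
    have h2 := ℋ.bijective_push (ξ := ξ.comp L.subtype) (μ := ξ) rfl n Subtype.val_injective
      (P := R) rfl (orbitSlice S L)
    have h3 := ℋ.ind_bijective (ξ.comp L.subtype) ξ L.subtype rfl Subtype.val_injective n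
    have h4 := (bijective_map_toPoint_iff ((ℋ.theory (ξ.comp L.subtype)).H n) (P := R) rfl).2 (h L n)
    have h5 : ℋ.push (ξ := ξ.comp L.subtype) (μ := ξ) rfl n (orbitSlice S L) ≫
        ((ℋ.theory ξ).H n).map (S.prodSnd ((indFunctor L.subtype).obj (point L))) =
        ((ℋ.theory (ξ.comp L.subtype)).H n).map (toPoint R rfl) ≫
          (ℋ.ind (ξ.comp L.subtype) ξ L.subtype rfl n).app (point L) := by
      rw [← ℋ.push_unit, ℋ.push_map, ℋ.map_push]
      exact ℋ.push_congr rfl n rfl rfl fun x => rfl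
    have h6 := h3.comp h4
    have h7 : Function.Bijective (ℋ.push (ξ := ξ.comp L.subtype) (μ := ξ) rfl n (orbitSlice S L) ≫
        ((ℋ.theory ξ).H n).map (S.prodSnd ((indFunctor L.subtype).obj (point L)))).hom := by
      rw [h5]
      exact h6
    exact (Function.Bijective.of_comp_iff _ h2).1 h7) X n
  rw [key] at h1
  exact h1

instance : ContractibleSpace (pointComplex K).carrier :=
  inferInstanceAs (ContractibleSpace PUnit)

theorem contractibleSpace_fixedPoints_point (H : Subgroup K) :
    ContractibleSpace (MulAction.fixedPoints H (pointComplex K).carrier) := by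
  have h : MulAction.fixedPoints H (pointComplex K).carrier = univ :=
    eq_univ_of_forall fun _ _ => rfl
  rw [h]
  exact (Homeomorph.Set.univ _).contractibleSpace

/-- The Isomorphism Conjecture passes from a family `ℱ` to a larger family, provided that it is true
for the restrictions of `ℱ` to all subgroups. -/
theorem EquivariantHomologyTheory.IsomorphismConjecture.of_le {ξ : K →* Γ} {ℱ 𝒢 : SubgroupFamily K}
    (hle : ℱ.carrier ⊆ 𝒢.carrier) (h : ℋ.IsomorphismConjecture ξ ℱ)
    (hL : ∀ L : Subgroup K,
      ℋ.IsomorphismConjecture (ξ.comp L.subtype) (ℱ.pullback L.subtype)) :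
    ℋ.IsomorphismConjecture ξ 𝒢 := by
  intro X hX n
  let S := InfJoin.system (Orbits ℱ) K
  have h1 := ℋ.bijective_map_prodSnd S ξ (fun L n => hL L _ ((isClassifyingSpace_prod
    (pointComplex K) fun H _ => contractibleSpace_fixedPoints_point H).res L.subtype) n) X n
  have h2 := h _ (isClassifyingSpace_prod X fun H hH => (hX H).1 (hle hH)) n
  have h3 := (bijective_map_toPoint_iff ((ℋ.theory ξ).H n) (P := S.prodFunctor.obj X.toPair) rfl).2 h2
  have h4 : toPoint (S.prodFunctor.obj X.toPair) rfl = S.prodSnd X.toPair ≫ X.pr := rfl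
  rw [h4, CategoryTheory.Functor.map_comp] at h3
  exact (Function.Bijective.of_comp_iff _ h1).1 h3

end Product

/-! ### Directed colimits of groups -/

section Pullback

variable {I : Type u} {Gi : I → Type u} [∀ i, Group (Gi i)] {G K : Type u} [Group G] [Group K]
  {ψ : ∀ i, Gi i →* G} (κ : K →* G)

variable (ψ) in
/-- The pullbacks of `Gᵢ → G ← K`. -/
abbrev PullbackGroup (i : I) : Type u :=
  (κ.comp (MonoidHom.fst K (Gi i))).eqLocus ((ψ i).comp (MonoidHom.snd K (Gi i)))

variable (ψ) in
/-- The projection of the pullback of `Gᵢ → G ← K` to `K`. -/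
def pullbackFst (i : I) : PullbackGroup ψ κ i →* K := (MonoidHom.fst K (Gi i)).comp (Subgroup.subtype _)

variable (ψ) in
/-- The projection of the pullback of `Gᵢ → G ← K` to `Gᵢ`. -/
def pullbackSnd (i : I) : PullbackGroup ψ κ i →* Gi i :=
  (MonoidHom.snd K (Gi i)).comp (Subgroup.subtype _)

theorem comp_pullbackSnd (i : I) : (ψ i).comp (pullbackSnd ψ κ i) = κ.comp (pullbackFst ψ κ i) :=
  MonoidHom.ext fun x => Eq.symm x.2

theorem pullbackFst_injective {i : I} (h : Function.Injective (ψ i)) :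
    Function.Injective (pullbackFst ψ κ i) := by
  intro x y hxy
  have h1 : x.1.1 = y.1.1 := hxy
  refine Subtype.ext (Prod.ext h1 (h ?_))
  have hx : κ x.1.1 = ψ i x.1.2 := x.2
  have hy : κ y.1.1 = ψ i y.1.2 := y.2
  rw [← hx, ← hy, h1]

end Pullback

section Colimit

variable {I : Type u} [Preorder I] {Gi : I → Type u} [∀ i, Group (Gi i)]
  {φ : ∀ i j, i ≤ j → Gi i →* Gi j} {G : Type u} [Group G] {ψ : ∀ i, Gi i →* G}

/-- The description by elements of the colimit of a directed system of groups. -/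
structure IsConcreteColimit (φ : ∀ i j, i ≤ j → Gi i →* Gi j) (ψ : ∀ i, Gi i →* G) : Prop where
  map_id : ∀ i, φ i i le_rfl = MonoidHom.id (Gi i)
  map_comp : ∀ i j k (hij : i ≤ j) (hjk : j ≤ k),
    (φ j k hjk).comp (φ i j hij) = φ i k (hij.trans hjk)
  compatible : ∀ i j (hij : i ≤ j), (ψ j).comp (φ i j hij) = ψ i
  surj : ∀ g, ∃ i x, ψ i x = g
  ker : ∀ i x, ψ i x = 1 → ∃ j, ∃ h : i ≤ j, φ i j h x = 1

/-- The universal property compares the colimit with Mathlib's `DirectLimit`, whose elements are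
explicit. -/
theorem IsGroupColimit.isConcreteColimit [IsDirectedOrder I] [Nonempty I]
    (h : IsGroupColimit φ ψ) : IsConcreteColimit φ ψ := by
  have hsys : DirectedSystem Gi fun i j hij => φ i j hij :=
    ⟨fun i x => DFunLike.congr_fun (h.map_id i) x,
      fun i j k hij hjk x => DFunLike.congr_fun (h.map_comp k j i hij hjk) x⟩
  let of : ∀ i, Gi i →* DirectLimit Gi φ := fun i =>
    { toFun := fun x => ⟦⟨i, x⟩⟧
      map_one' := (DirectLimit.one_def (f := φ) i).symm
      map_mul' := fun x y => (DirectLimit.mul_def (f := φ) i x y).symm }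
  have hof : ∀ i j hij, (of j).comp (φ i j hij) = of i := fun i j hij => by
    ext x
    exact (DirectLimit.eq_of_le (f := φ) ⟨i, x⟩ j hij).symm
  obtain ⟨F, hF, -⟩ := h.universal (DirectLimit Gi φ) of hof
  let F' : DirectLimit Gi φ →* G :=
    { toFun := DirectLimit.lift φ (fun i => ψ i) fun i j hij x =>
        (DFunLike.congr_fun (h.compatible i j hij) x).symm
      map_one' := DirectLimit.lift_one (f := φ) ψ _
      map_mul' := DirectLimit.lift_mul (f := φ) ψ _ }
  have hF' : ∀ g, F' (F g) = g := by
    obtain ⟨E, -, hE⟩ := h.universal G ψ h.compatible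
    have h1 := hE (F'.comp F) fun i => by
      rw [MonoidHom.comp_assoc, hF]
      rfl
    have h2 := hE (MonoidHom.id G) fun i => rfl
    exact DFunLike.congr_fun (h1.trans h2.symm)
  refine ⟨h.map_id, h.map_comp, h.compatible, fun g => ?_, fun i x hx => ?_⟩
  · obtain ⟨i, x, hx⟩ := DirectLimit.exists_eq_mk φ (F g)
    exact ⟨i, x, by rw [← hF' g, hx]; rfl⟩
  · have h1 : of i x = of i 1 := by
      rw [map_one, ← hF i, MonoidHom.comp_apply, hx, map_one]
    obtain ⟨j, hij, hij', hj⟩ := Quotient.exact h1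
    exact ⟨j, hij, hj.trans (map_one _)⟩

namespace IsConcreteColimit

variable (h : IsConcreteColimit φ ψ)
include h

theorem map_map {i j k : I} (hij : i ≤ j) (hjk : j ≤ k) (x : Gi i) :
    φ j k hjk (φ i j hij x) = φ i k (hij.trans hjk) x :=
  DFunLike.congr_fun (h.map_comp i j k hij hjk) x

theorem map_eq {i j : I} (hij : i ≤ j) (x : Gi i) : ψ j (φ i j hij x) = ψ i x :=
  DFunLike.congr_fun (h.compatible i j hij) x

theorem exists_eq [IsDirectedOrder I] {i j : I} (x : Gi i) (y : Gi j) (hxy : ψ i x = ψ j y) :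
    ∃ k, ∃ (hi : i ≤ k) (hj : j ≤ k), φ i k hi x = φ j k hj y := by
  obtain ⟨k, hik, hjk⟩ := exists_ge_ge i j
  obtain ⟨l, hkl, hl⟩ := h.ker k (φ i k hik x * (φ j k hjk y)⁻¹)
    (by rw [map_mul, map_inv, h.map_eq, h.map_eq, hxy, mul_inv_cancel])
  rw [map_mul, map_inv, h.map_map, h.map_map, mul_inv_eq_one] at hl
  exact ⟨l, _, _, hl⟩

theorem isGroupColimit [IsDirectedOrder I] : IsGroupColimit φ ψ := by
  refine ⟨h.map_id, h.map_comp, h.compatible, fun K _ f hf => ?_⟩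
  have hf' : ∀ {i j} (hij : i ≤ j) x, f j (φ i j hij x) = f i x := fun hij x =>
    DFunLike.congr_fun (hf _ _ hij) x
  choose s x hx using h.surj
  have key : ∀ i (y : Gi i), f (s (ψ i y)) (x (ψ i y)) = f i y := fun i y => by
    obtain ⟨k, h1, h2, h3⟩ := h.exists_eq (x (ψ i y)) y (hx _)
    rw [← hf' h1, h3, hf' h2]
  refine ⟨MonoidHom.mk' (fun g => f (s g) (x g)) fun a b => ?_, fun i => MonoidHom.ext fun y => key i y,
    fun F hF => MonoidHom.ext fun g => ?_⟩
  · obtain ⟨k, h1, h2⟩ := exists_ge_ge (s a) (s b)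
    have h3 : ψ k (φ _ _ h1 (x a) * φ _ _ h2 (x b)) = a * b := by
      rw [map_mul, h.map_eq, h.map_eq, hx, hx]
    have h4 := key k (φ _ _ h1 (x a) * φ _ _ h2 (x b))
    rw [h3, map_mul, hf', hf'] at h4
    exact h4
  · have h1 := DFunLike.congr_fun (hF (s g)) (x g)
    rw [MonoidHom.comp_apply, hx] at h1
    exact h1

end IsConcreteColimit

theorem IsDirectedUnion.isConcreteColimit {S : I → Subgroup G} (hS : IsDirectedUnion S) :
    IsConcreteColimit (fun _ _ hij => Subgroup.inclusion (hS.mono hij)) fun i => (S i).subtype := by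
  refine ⟨fun _ => rfl, fun _ _ _ _ _ => rfl, fun _ _ _ => rfl, fun g => ?_, fun i x hx => ?_⟩
  · obtain ⟨i, hi⟩ := hS.exists_mem g
    exact ⟨i, ⟨g, hi⟩, rfl⟩
  · exact ⟨i, le_rfl, Subtype.ext hx⟩

/-- The directed system `φ` restricted to the preimages of a subgroup. -/
def comapMap (h : IsConcreteColimit φ ψ) (L : Subgroup G) (i j : I) (hij : i ≤ j) :
    L.comap (ψ i) →* L.comap (ψ j) :=
  ((φ i j hij).comp (L.comap (ψ i)).subtype).codRestrict (L.comap (ψ j)) fun x => by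
    change ψ j (φ i j hij x) ∈ L
    rw [h.map_eq]
    exact x.2

/-- A subgroup of a colimit is the colimit of its preimages. -/
theorem IsConcreteColimit.comap (h : IsConcreteColimit φ ψ) (L : Subgroup G) :
    IsConcreteColimit (comapMap h L) fun i => (ψ i).subgroupComap L where
  map_id i := MonoidHom.ext fun x => Subtype.ext (DFunLike.congr_fun (h.map_id i) x.1)
  map_comp _ _ _ hij hjk := MonoidHom.ext fun x => Subtype.ext (h.map_map hij hjk x.1)
  compatible _ _ hij := MonoidHom.ext fun x => Subtype.ext (h.map_eq hij x.1)
  surj g := by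
    obtain ⟨i, x, hx⟩ := h.surj g
    exact ⟨i, ⟨x, by rw [Subgroup.mem_comap, hx]; exact g.2⟩, Subtype.ext hx⟩
  ker i x hx := by
    obtain ⟨j, hij, hj⟩ := h.ker i x (congrArg Subtype.val hx)
    exact ⟨j, hij, Subtype.ext hj⟩

variable {K : Type u} [Group K] (κ : K →* G)

/-- The directed system of the pullbacks of `Gᵢ → G ← K`. -/
def pullbackMap (h : IsConcreteColimit φ ψ) (i j : I) (hij : i ≤ j) :
    PullbackGroup ψ κ i →* PullbackGroup ψ κ j :=
  (((MonoidHom.id K).prodMap (φ i j hij)).comp (Subgroup.subtype _)).codRestrict _ fun x => by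
    change κ x.1.1 = ψ j (φ i j hij x.1.2)
    rw [h.map_eq]
    exact x.2

/-- Directed colimits of groups are stable under base change. -/
theorem IsConcreteColimit.pullback (h : IsConcreteColimit φ ψ) :
    IsConcreteColimit (pullbackMap κ h) (pullbackFst ψ κ) where
  map_id i := MonoidHom.ext fun x =>
    Subtype.ext (Prod.ext rfl (DFunLike.congr_fun (h.map_id i) x.1.2))
  map_comp _ _ _ hij hjk := MonoidHom.ext fun x =>
    Subtype.ext (Prod.ext rfl (h.map_map hij hjk x.1.2))
  compatible _ _ hij := rfl
  surj k := by
    obtain ⟨i, x, hx⟩ := h.surj (κ k)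
    exact ⟨i, ⟨(k, x), hx.symm⟩, rfl⟩
  ker i x hx := by
    have h1 : x.1.1 = 1 := hx
    have h2 : κ x.1.1 = ψ i x.1.2 := x.2
    rw [h1, map_one] at h2
    obtain ⟨j, hij, hj⟩ := h.ker i x.1.2 h2.symm
    exact ⟨j, hij, Subtype.ext (Prod.ext h1 hj)⟩

end Colimit

/-! ### Continuity by elements -/

namespace EquivariantHomologyTheory

variable {Γ : Type u} [Group Γ] {Λ : Type v} [Ring Λ] (ℋ : EquivariantHomologyTheory.{u, v, w} Γ Λ)

theorem a_id {G : Type u} [Group G] (ξ : G →* Γ) (h : ξ.comp (MonoidHom.id G) = ξ) (n : ℤ) :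
    ℋ.a ξ ξ (MonoidHom.id G) h n = 𝟙 _ := by
  rw [← CategoryTheory.Functor.map_id]
  exact ℋ.push_id n h (SemiMap.point _) (𝟙 _) fun _ => rfl

theorem a_congr {H G : Type u} [Group H] [Group G] {ξ : H →* Γ} {μ : G →* Γ} {α β : H →* G}
    (hαβ : α = β) (hα : μ.comp α = ξ) (hβ : μ.comp β = ξ) (n : ℤ) :
    ℋ.a ξ μ α hα n = ℋ.a ξ μ β hβ n := by
  subst hαβ
  rfl

theorem bijective_a {H G : Type u} [Group H] [Group G] {ξ : H →* Γ} {μ : G →* Γ} {α : H →* G}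
    (hα : μ.comp α = ξ) (n : ℤ) (h : Function.Bijective α) :
    Function.Bijective (ℋ.a ξ μ α hα n).hom := by
  let e := MulEquiv.ofBijective α h
  have he : α.comp e.symm.toMonoidHom = MonoidHom.id G :=
    MonoidHom.ext fun x => e.apply_symm_apply x
  have he' : e.symm.toMonoidHom.comp α = MonoidHom.id H :=
    MonoidHom.ext fun x => e.symm_apply_apply x
  have hβ : ξ.comp e.symm.toMonoidHom = μ := by
    rw [← hα, MonoidHom.comp_assoc, he, MonoidHom.comp_id]
  have h1 := ℋ.a_comp ξ μ ξ α e.symm.toMonoidHom hα hβ (by rw [he', MonoidHom.comp_id]) n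
  have h2 := ℋ.a_comp μ ξ μ e.symm.toMonoidHom α hβ hα (by rw [he, MonoidHom.comp_id]) n
  rw [ℋ.a_congr he' _ (MonoidHom.comp_id _), ℋ.a_id] at h1
  rw [ℋ.a_congr he _ (MonoidHom.comp_id _), ℋ.a_id] at h2
  exact ⟨Function.LeftInverse.injective (g := (ℋ.a μ ξ e.symm.toMonoidHom hβ n).hom)
    (ConcreteCategory.congr_hom h1), Function.RightInverse.surjective (ConcreteCategory.congr_hom h2)⟩

variable {I : Type u} [Preorder I] {Gi : I → Type u} [∀ i, Group (Gi i)]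
  {φ : ∀ i j, i ≤ j → Gi i →* Gi j} {G : Type u} [Group G] {ψ : ∀ i, Gi i →* G}

/-- The system of the homology groups of the one-point spaces. -/
def pointSys (h : IsConcreteColimit φ ψ) (ξ : G →* Γ) (n : ℤ) : IndSystem.{w} I where
  M i := ((ℋ.theory (ξ.comp (ψ i))).H n).obj (point (Gi i))
  N := ((ℋ.theory ξ).H n).obj (point G)
  f {i j} hij := (ℋ.a (ξ.comp (ψ i)) (ξ.comp (ψ j)) (φ i j hij)
    (by rw [MonoidHom.comp_assoc, h.compatible i j hij]) n).hom.toAddMonoidHom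
  g i := (ℋ.a (ξ.comp (ψ i)) ξ (ψ i) rfl n).hom.toAddMonoidHom
  g_f {i j} hij x := by
    have h1 := ℋ.a_comp (ξ.comp (ψ i)) (ξ.comp (ψ j)) ξ (φ i j hij) (ψ j)
      (by rw [MonoidHom.comp_assoc, h.compatible i j hij]) rfl (by rw [h.compatible i j hij]) n
    rw [ℋ.a_congr (h.compatible i j hij) _ rfl] at h1
    exact ConcreteCategory.congr_hom h1 x
  f_f {i j k} hij hjk x := by
    have h1 := ℋ.a_comp (ξ.comp (ψ i)) (ξ.comp (ψ j)) (ξ.comp (ψ k)) (φ i j hij) (φ j k hjk)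
      (by rw [MonoidHom.comp_assoc, h.compatible i j hij])
      (by rw [MonoidHom.comp_assoc, h.compatible j k hjk])
      (by rw [h.map_comp, MonoidHom.comp_assoc, h.compatible]) n
    rw [ℋ.a_congr (h.map_comp i j k hij hjk) _
      (by rw [MonoidHom.comp_assoc, h.compatible])] at h1
    exact ConcreteCategory.congr_hom h1 x

theorem isColimit_pointSys_of_bijective [IsDirectedOrder I] [Nonempty I] [DecidableEq I]
    (h : IsConcreteColimit φ ψ) (ξ : G →* Γ) (n : ℤ)
    (ht : Function.Bijective (ℋ.t ξ φ ψ h.compatible n)) :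
    (ℋ.pointSys h ξ n).IsColimit := by
  have hsys : DirectedSystem (fun i => ((ℋ.theory (ξ.comp (ψ i))).H n).obj (point (Gi i)))
      (fun i j hij => (ℋ.a (ξ.comp (ψ i)) (ξ.comp (ψ j)) (φ i j hij)
        (by rw [MonoidHom.comp_assoc, h.compatible i j hij]) n).hom) :=
    ⟨fun i x => by
      have h1 := ℋ.a_id (ξ.comp (ψ i)) (MonoidHom.comp_id _) n
      rw [← ℋ.a_congr (h.map_id i) (by rw [h.map_id, MonoidHom.comp_id])] at h1
      exact ConcreteCategory.congr_hom h1 x,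
      fun k j i hij hjk x => (ℋ.pointSys h ξ n).f_f hij hjk x⟩
  have hg : ∀ i x, ℋ.t ξ φ ψ h.compatible n (Module.DirectLimit.of Λ I _ _ i x) =
      (ℋ.pointSys h ξ n).g i x := fun i x => Module.DirectLimit.lift_of _ _ _
  constructor
  · intro y
    obtain ⟨z, rfl⟩ := ht.2 y
    obtain ⟨i, x, rfl⟩ := Module.DirectLimit.exists_of z
    exact ⟨i, x, (hg i x).symm⟩
  · intro i x hx
    have h1 := ht.1 (((hg i x).trans hx).trans (map_zero _).symm)
    exact Module.DirectLimit.of.zero_exact h1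

/-- For a continuous theory, the homology of the point commutes with directed colimits with injective
structure maps; for a strongly continuous one, with all directed colimits. In the first case the groups
are replaced by their images. -/
theorem isColimit_pointSys [IsDirectedOrder I] [Nonempty I] (h : IsConcreteColimit φ ψ) (ξ : G →* Γ)
    (hc : ℋ.IsStronglyContinuous ∨ ℋ.IsContinuous ∧ ∀ i, Function.Injective (ψ i)) (n : ℤ) :
    (ℋ.pointSys h ξ n).IsColimit := by
  classical
  rcases hc with hc | ⟨hc, hinj⟩
  · exact ℋ.isColimit_pointSys_of_bijective h ξ n (hc ξ φ ψ h.isGroupColimit n)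
  · have hS : IsDirectedUnion fun i => (ψ i).range := by
      refine ⟨fun i j hij => ?_, fun g => h.surj g⟩
      rintro _ ⟨x, rfl⟩
      exact ⟨φ i j hij x, h.map_eq hij x⟩
    have h' := hS.isConcreteColimit
    have h1 := ℋ.isColimit_pointSys_of_bijective h' ξ n (hc ξ _ hS n)
    let a : (ℋ.pointSys h ξ n).Hom (ℋ.pointSys h' ξ n) :=
      { φ := fun i => (ℋ.a (ξ.comp (ψ i)) (ξ.comp (ψ i).range.subtype) (ψ i).rangeRestrict rfl
          n).hom.toAddMonoidHom
        φN := AddMonoidHom.id _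
        comm_f := fun {i j} hij x => by
          have h2 := ℋ.a_comp (ξ.comp (ψ i)) (ξ.comp (ψ j)) (ξ.comp (ψ j).range.subtype)
            (φ i j hij) (ψ j).rangeRestrict (by rw [MonoidHom.comp_assoc, h.compatible i j hij]) rfl
            (MonoidHom.ext fun x => congrArg ξ (h.map_eq hij x)) n
          have h3 := ℋ.a_comp (ξ.comp (ψ i)) (ξ.comp (ψ i).range.subtype)
            (ξ.comp (ψ j).range.subtype) (ψ i).rangeRestrict
            (Subgroup.inclusion (hS.mono hij)) rfl rfl rfl n
          have h4 : (ψ j).rangeRestrict.comp (φ i j hij) =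
              (Subgroup.inclusion (hS.mono hij)).comp (ψ i).rangeRestrict :=
            MonoidHom.ext fun x => Subtype.ext (h.map_eq hij x)
          exact ConcreteCategory.congr_hom (h2.trans ((ℋ.a_congr h4 _ rfl n).trans h3.symm)) x
        comm_g := fun i x => by
          have h3 := ℋ.a_comp (ξ.comp (ψ i)) (ξ.comp (ψ i).range.subtype) ξ (ψ i).rangeRestrict
            (ψ i).range.subtype rfl rfl rfl n
          exact (ConcreteCategory.congr_hom h3 x).symm }
    refine (IndSystem.IsColimit.iff_of_bijective a (fun i => ?_) Function.bijective_id).2 h1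
    refine ℋ.bijective_a _ n ⟨fun x y hxy => hinj i (congrArg Subtype.val hxy), ?_⟩
    exact (ψ i).rangeRestrict_surjective

end EquivariantHomologyTheory

/-! ### The homology of discrete complexes -/

instance Ind.discreteTopology {H G X : Type u} [Group H] [Group G] [MulAction H X]
    [TopologicalSpace X] [DiscreteTopology X] (α : H →* G) : DiscreteTopology (Ind α X) :=
  discreteTopology_iff_forall_isOpen.2 fun C => (Ind.isOpen_iff α C).2 fun _ => isOpen_discrete _

instance (G : Type u) [Group G] : DiscreteTopology (pointComplex G).carrier :=
  inferInstanceAs (DiscreteTopology PUnit)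

namespace EquivariantHomologyTheory

variable {Γ : Type u} [Group Γ] {Λ : Type v} [Ring Λ] (ℋ : EquivariantHomologyTheory.{u, v, w} Γ Λ)

open DirectSum in
/-- The homology of a discrete complex is generated by the classes which are induced from the points
with the actions of their stabilizers. -/
theorem induction_toPair {H : Type u} [Group H] (ξ : H →* Γ) (n : ℤ) (X : GCWComplex H)
    [DiscreteTopology X.carrier] {C : ((ℋ.theory ξ).H n).obj X.toPair → Prop} (zero : C 0)
    (add : ∀ y z, C y → C z → C (y + z))
    (orbit : ∀ (x : X.carrier) w, C ((ℋ.push (ξ := ξ.comp (MulAction.stabilizer H x).subtype)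
      (μ := ξ) rfl n (SemiMap.const (MulAction.stabilizer H x).subtype (Q := X.toPair) x
        fun h => h.2)).hom w)) (z) : C z := by
  classical
  let J := MulAction.orbitRel.Quotient H X.carrier
  let r : J → X.carrier := Quotient.out
  let S : J → Subgroup H := fun j => MulAction.stabilizer H (r j)
  let P : J → GCWPair H := fun j => (indFunctor (S j).subtype).obj (point (S j))
  let c : ∀ j, SemiMap (S j).subtype (point (S j)) X.toPair := fun j =>
    SemiMap.const (S j).subtype (Q := X.toPair) (r j) fun h => h.2
  let f : ∀ j, (P j).X.toPair ⟶ X.toPair := fun j => (P j).inclPair ≫ (c j).adj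
  have hd : ∀ j, DiscreteTopology (P j).X.carrier := fun j =>
    Ind.discreteTopology (X := (pointComplex (S j)).carrier) _
  have hf : Function.Bijective fun s : Σ j, (P j).X.carrier => (f s.1).toFun s.2 := by
    constructor
    · rintro ⟨j, q⟩ ⟨j', q'⟩ h
      obtain ⟨g, x, rfl⟩ := Ind.exists_mk (S j).subtype q
      obtain ⟨g', x', rfl⟩ := Ind.exists_mk (S j').subtype q'
      have h1 : g • r j = g' • r j' := h
      have h2 : ∀ (k : H) (i : J), (Quotient.mk _ (k • r i) : J) = i := fun k i =>
        (Quotient.sound (MulAction.mem_orbit (r i) k)).trans (Quotient.out_eq i)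
      obtain rfl : j = j' := by rw [← h2 g j, h1, h2]
      refine congrArg (Sigma.mk j) ((Ind.mk_eq_iff _).2 ⟨⟨g⁻¹ * g', ?_⟩, ?_, rfl⟩)
      · rw [MulAction.mem_stabilizer_iff, mul_smul, ← h1, inv_smul_smul]
      · exact (mul_inv_cancel_left g g').symm
    · intro x
      let j : J := Quotient.mk _ x
      obtain ⟨g, hg⟩ : ∃ g : H, g • r j = x :=
        (MulAction.orbitRel H X.carrier).symm (Quotient.mk_out (s := MulAction.orbitRel H X.carrier) x)
      exact ⟨⟨j, Ind.mk _ g PUnit.unit⟩, hg⟩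
  obtain ⟨e, _, he⟩ := isIso_of_isHomeomorph_sigma f
    ((Equiv.ofBijective _ hf).toHomeomorphOfDiscrete.isHomeomorph)
  let D := toModule Λ J (((ℋ.theory ξ).H n).obj (EquivHomology.coproduct fun j => (P j).X).toPair)
    fun j => (((ℋ.theory ξ).H n).map (coproductIncl (fun j => (P j).X) j)).hom
  let Φ := (((ℋ.theory ξ).H n).map e).hom.comp D
  have h1 : Function.Surjective Φ := (bijective_map_of_isIso ((ℋ.theory ξ).H n) e).2.comp
    ((ℋ.theory ξ).disjoint_union (fun j => (P j).X) n).2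
  obtain ⟨y, rfl⟩ := h1 z
  induction y using DirectSum.induction_on with
  | zero =>
    rw [map_zero]
    exact zero
  | of j y =>
    obtain ⟨w, hw⟩ := (ℋ.ind_bijective (ξ.comp (S j).subtype) ξ (S j).subtype rfl
      Subtype.val_injective n).2 ((((ℋ.theory ξ).H n).map (P j).inclPair).hom y)
    have h2 := orbit (r j) w
    have h3 : (ℋ.push (ξ := ξ.comp (S j).subtype) (μ := ξ) rfl n (c j)).hom w =
        (((ℋ.theory ξ).H n).map (f j)).hom y := by
      refine (congrArg (((ℋ.theory ξ).H n).map (c j).adj).hom hw).trans ?_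
      rw [CategoryTheory.Functor.map_comp]
      rfl
    refine (congrArg C ?_).mp h2
    refine h3.trans ?_
    rw [← he j, CategoryTheory.Functor.map_comp]
    refine congrArg (((ℋ.theory ξ).H n).map e).hom ?_
    exact (toModule_lof (M := fun j => ((ℋ.theory ξ).H n).obj (P j).X.toPair)
      (N := ((ℋ.theory ξ).H n).obj (EquivHomology.coproduct fun j => (P j).X).toPair)
      (φ := fun j => (((ℋ.theory ξ).H n).map (coproductIncl (fun j => (P j).X) j)).hom) Λ j y).symm
  | add x y hx hy =>
    rw [map_add]
    exact add _ _ hx hy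

/-- The variant of `induction_toPair` for a pair whose subcomplex is only propositionally empty. -/
theorem induction_discrete {H : Type u} [Group H] (ξ : H →* Γ) (n : ℤ) (P : GCWPair H)
    (hP : P.A = ∅) [DiscreteTopology P.X.carrier] {C : ((ℋ.theory ξ).H n).obj P → Prop}
    (zero : C 0) (add : ∀ y z, C y → C z → C (y + z))
    (orbit : ∀ (x : P.X.carrier) w, C ((ℋ.push (ξ := ξ.comp (MulAction.stabilizer H x).subtype)
      (μ := ξ) rfl n (SemiMap.const (MulAction.stabilizer H x).subtype (Q := P) x
        fun h => h.2)).hom w)) (z) : C z := by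
  have := GCWPair.isIso_inclPair hP
  obtain ⟨z, rfl⟩ := (bijective_map_of_isIso ((ℋ.theory ξ).H n) P.inclPair).2 z
  refine ℋ.induction_toPair ξ n P.X (C := fun z => C ((((ℋ.theory ξ).H n).map P.inclPair).hom z))
    ?_ (fun y z hy hz => ?_) (fun x w => ?_) z
  · rw [map_zero]
    exact zero
  · rw [map_add]
    exact add _ _ hy hz
  · refine (congrArg C ?_).mp (orbit x w)
    have h1 := ℋ.push_map (ξ := ξ.comp (MulAction.stabilizer H x).subtype) (μ := ξ) rfl n
      (SemiMap.const (MulAction.stabilizer H x).subtype (Q := P.X.toPair) x fun h => h.2) P.inclPair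
    exact (ConcreteCategory.congr_hom h1 w).symm

end EquivariantHomologyTheory

/-! ### The homology of restrictions along a directed system of groups -/

section Colimit

/-- The identity of the underlying spaces of restrictions. -/
def SemiMap.resMap {H G K : Type u} [Group H] [Group G] [Group K] {α : H →* G} {β : G →* K}
    {γ : H →* K} (h : β.comp α = γ) (Q : GCWPair K) :
    SemiMap α ((resFunctor γ).obj Q) ((resFunctor β).obj Q) where
  toFun x := x
  continuous := continuous_id
  equivariant k x := congrArg (fun δ : H →* K => δ k • (show Q.X.carrier from x)) h.symm
  mapsTo _ h := h

variable {Γ : Type u} [Group Γ] {Λ : Type v} [Ring Λ] (ℋ : EquivariantHomologyTheory.{u, v, w} Γ Λ)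
  {I : Type u} [Preorder I] {Ki : I → Type u} [∀ i, Group (Ki i)]
  {q : ∀ i j, i ≤ j → Ki i →* Ki j} {K : Type u} [Group K] {p : ∀ i, Ki i →* K}
  (h : IsConcreteColimit q p) (ν : K →* Γ)

include h in
theorem IsConcreteColimit.comp_compatible {i j : I} (hij : i ≤ j) :
    (ν.comp (p j)).comp (q i j hij) = ν.comp (p i) := by
  rw [MonoidHom.comp_assoc, h.compatible i j hij]

/-- For a colimit `K` of groups `Kᵢ`, the system of the homology theories `X ↦ ℋ^{Kᵢ}(res X)` of
`K`-CW-pairs with target `ℋ^K`. -/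
def EquivariantHomologyTheory.resSystem : TheorySystem I
    (fun i => (ℋ.theory' (ν.comp (p i))).pull (goodFunctor_res (p i)))
    ((ℋ.theory' ν).pull goodFunctor_id) where
  f {i j} hij := ℋ.pushHom (α := q i j hij) (h.comp_compatible ν hij)
    (goodFunctor_res (p i)) (goodFunctor_res (p j)) (SemiMap.resMap (h.compatible i j hij))
    fun _ _ => rfl
  g i := ℋ.pushHom (α := p i) rfl (goodFunctor_res (p i)) goodFunctor_id
    (SemiMap.ofRes (p i)) fun _ _ => rfl
  g_f {i j} hij n P := by
    refine (ℋ.push_comp _ rfl n _ _ ?_).trans ?_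
    · rw [h.compatible i j hij]
    · exact ℋ.push_congr _ n (h.compatible i j hij) _ fun _ => rfl
  f_f {i j k} hij hjk n P := by
    refine (ℋ.push_comp _ _ n _ _ ?_).trans ?_
    · rw [h.map_comp i j k hij hjk, h.comp_compatible]
    · exact ℋ.push_congr _ n (h.map_comp i j k hij hjk) _ fun _ => rfl

/-- If the homology of the point is continuous for `L = colim Lᵢ`, where `Lᵢ ≤ Kᵢ` is the preimage of
`L`, then `colim ℋ^{Kᵢ}(res K / L) → ℋ^K(K / L)` is bijective. The target is the homology of the point
for `L` and receives compatible maps `V j` from the homology of the points for the `Lⱼ`, through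
`res K / L`. It is enough that every class of `ℋ^{Kᵢ}(res K / L)` comes from some `V j` at a later
stage. -/
theorem EquivariantHomologyTheory.good_resSystem_orbit [IsDirectedOrder I] [Nonempty I]
    (hc : ∀ (L : Subgroup K) n, (ℋ.pointSys (h.comap L) (ν.comp L.subtype) n).IsColimit)
    (L : Subgroup K) :
    (ℋ.resSystem h ν).Good ((indFunctor L.subtype).obj (point L)) := by
  intro n
  let ι := L.subtype
  let X := (indFunctor ι).obj (point L)
  let x₀ : X.X.carrier := Ind.mk ι 1 PUnit.unit
  let κ : ∀ j, L.comap (p j) →* Ki j := fun j => (L.comap (p j)).subtype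
  have hx₀ : ∀ (g : K) (l : L), (g * l) • x₀ = g • x₀ := fun g l => by
    rw [mul_smul]
    exact congrArg (g • ·) ((SemiMap.unit ι (point L)).equivariant l PUnit.unit).symm
  have hx₁ : ∀ g g' : K, g • x₀ = g' • x₀ → g⁻¹ * g' ∈ L := fun g g' hg => by
    obtain ⟨l, hl, -⟩ := (Ind.mk_eq_iff ι).1 hg
    have h1 : g' * 1 = g * 1 * l := hl
    rw [mul_one, mul_one] at h1
    rw [h1, inv_mul_cancel_left]
    exact l.2
  let v : ∀ j, SemiMap (κ j) (point (L.comap (p j))) ((resFunctor (p j)).obj X) := fun j =>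
    SemiMap.const (κ j) (Q := (resFunctor (p j)).obj X) x₀ fun l => by
      refine Eq.trans ?_ (one_smul K x₀)
      exact (congrArg (fun g : K => g • x₀) (one_mul _)).symm.trans (hx₀ 1 ⟨p j l.1, l.2⟩)
  let V : ∀ j, (ℋ.pointSys (h.comap L) (ν.comp ι) n).M j →+
      ((ℋ.resSystem h ν).sys n X).M j := fun j =>
    (ℋ.push (ξ := (ν.comp (p j)).comp (κ j)) (μ := ν.comp (p j)) rfl n (v j)).hom.toAddMonoidHom
  have hVf : ∀ {j k} (hjk : j ≤ k) u, ((ℋ.resSystem h ν).sys n X).f hjk (V j u) =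
      V k ((ℋ.pointSys (h.comap L) (ν.comp ι) n).f hjk u) := fun {j k} hjk u => by
    have hκ : (q j k hjk).comp (κ j) = (κ k).comp (comapMap h L j k hjk) := rfl
    have h3 : (ν.comp (p k)).comp ((q j k hjk).comp (κ j)) = (ν.comp (p j)).comp (κ j) := by
      rw [← MonoidHom.comp_assoc, h.comp_compatible]
    have h1 := ℋ.push_comp (α := κ j) (β := q j k hjk) rfl (h.comp_compatible ν hjk) n (v j)
      (SemiMap.resMap (h.compatible j k hjk) X) h3
    have h2 := ℋ.push_comp (μ := (ν.comp (p k)).comp (κ k)) (α := comapMap h L j k hjk) (β := κ k)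
      h3 rfl n (SemiMap.point _) (v k) h3
    exact ConcreteCategory.congr_hom
      (h1.trans ((ℋ.push_congr h3 n hκ h3 fun _ => rfl).trans h2.symm)) u
  have hVg : ∀ j u, ((ℋ.resSystem h ν).sys n X).g j (V j u) =
      ((ℋ.ind (ν.comp ι) ν ι rfl n).app (point L)).hom
        ((ℋ.pointSys (h.comap L) (ν.comp ι) n).g j u) := fun j u => by
    have h1 := ℋ.push_comp (ν := ν) (α := κ j) (β := p j) rfl rfl n (v j)
      (SemiMap.ofRes (p j) X) rfl
    have h2 := ℋ.push_comp (α := (p j).subgroupComap L) (μ := ν.comp ι) (β := ι) rfl rfl n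
      (SemiMap.point _) (SemiMap.unit ι (point L)) rfl
    rw [ℋ.push_unit] at h2
    exact ConcreteCategory.congr_hom
      (h1.trans ((ℋ.push_congr _ n rfl rfl fun _ => rfl).trans h2.symm)) u
  have hbij := ℋ.ind_bijective (ν.comp ι) ν ι rfl Subtype.val_injective n
  -- `V j` is induced by the inclusion `v j` of the `Kⱼ`-orbit of the class of `1`. The set `res K / L` may
  -- have other `Kᵢ`-orbits, but each of its points `g L` lies in that orbit as soon as `g` lifts to `Kⱼ`.
  have key : ∀ i (x : ((ℋ.resSystem h ν).sys n X).M i), ∃ j, ∃ hij : i ≤ j, ∃ u,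
      ((ℋ.resSystem h ν).sys n X).f hij x = V j u := by
    intro i x
    have : DiscreteTopology ((resFunctor (p i)).obj X).X.carrier :=
      Ind.discreteTopology (X := (pointComplex L).carrier) ι
    refine ℋ.induction_discrete (ν.comp (p i)) n ((resFunctor (p i)).obj X) (indPoint_A ι)
      (C := fun x => ∃ j, ∃ hij : i ≤ j, ∃ u, ((ℋ.resSystem h ν).sys n X).f hij x = V j u)
      ?_ ?_ ?_ x
    · exact ⟨i, le_rfl, 0, (map_zero (((ℋ.resSystem h ν).sys n X).f (le_refl i))).trans
        (map_zero (V i)).symm⟩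
    · rintro y z ⟨j, hij, u, hu⟩ ⟨k, hik, u', hu'⟩
      obtain ⟨l, hjl, hkl⟩ := exists_ge_ge j k
      refine ⟨l, hij.trans hjl, (ℋ.pointSys (h.comap L) (ν.comp ι) n).f hjl u +
        (ℋ.pointSys (h.comap L) (ν.comp ι) n).f hkl u', ?_⟩
      refine (map_add (((ℋ.resSystem h ν).sys n X).f (hij.trans hjl)) y z).trans ?_
      rw [map_add, ← hVf, ← hVf, ← hu, ← hu']
      exact congrArg₂ (· + ·) (((ℋ.resSystem h ν).sys n X).f_f hij hjl y).symm
        (((ℋ.resSystem h ν).sys n X).f_f hik hkl z).symm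
    · intro x w
      obtain ⟨g, _, hg⟩ := Ind.exists_mk ι x
      have hx : x = g • x₀ := (hg.symm.trans (congrArg (Ind.mk ι · PUnit.unit) (mul_one g).symm))
      obtain ⟨j', k', hk'⟩ := h.surj g
      obtain ⟨j, hij, hj'j⟩ := exists_ge_ge i j'
      let k := q j' j hj'j k'
      have hk : p j k = g := (h.map_eq hj'j k').trans hk'
      let S := MulAction.stabilizer (Ki i) (show ((resFunctor (p i)).obj X).X.carrier from x)
      let α : S →* Ki j := (q i j hij).comp S.subtype
      have hα : (ν.comp (p j)).comp α = (ν.comp (p i)).comp S.subtype := by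
        rw [← MonoidHom.comp_assoc, h.comp_compatible]
      -- The stabilizer of `g L` is conjugate to a subgroup of `Lⱼ`, but the conjugating element `k` need not
      -- lie over `1 : Γ`. Hence the point is mapped to the orbit `Kⱼ / Lⱼ`, at `k`, and the induction
      -- isomorphism is applied to that orbit.
      let Y := (indFunctor (κ j)).obj (point (L.comap (p j)))
      let m : SemiMap α (point S) Y := SemiMap.const α (Q := Y) (Ind.mk (κ j) k PUnit.unit) fun s => by
        refine Eq.symm ((Ind.mk_eq_iff (κ j)).2 ⟨⟨k⁻¹ * (α s * k), ?_⟩, ?_, rfl⟩)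
        · change p j (k⁻¹ * (q i j hij s.1 * k)) ∈ L
          rw [map_mul, map_inv, map_mul, hk, h.map_eq]
          refine hx₁ _ _ ?_
          rw [mul_smul, ← hx]
          exact s.2.symm
        · exact (mul_inv_cancel_left k (α s * k)).symm
      obtain ⟨u, hu⟩ := (ℋ.ind_bijective ((ν.comp (p j)).comp (κ j)) (ν.comp (p j)) (κ j) rfl
        Subtype.val_injective n).2 ((ℋ.push hα n m).hom w)
      refine ⟨j, hij, u, ?_⟩
      have h1 := ℋ.push_comp (ξ := (ν.comp (p i)).comp S.subtype) (α := S.subtype) (β := q i j hij) rfl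
        (h.comp_compatible ν hij) n
        (SemiMap.const S.subtype (Q := (resFunctor (p i)).obj X) x fun s => s.2)
        (SemiMap.resMap (h.compatible i j hij) X) hα
      have h2 := ℋ.push_map hα n m (v j).adj
      have h3 : (ℋ.push hα n (m.postcomp (v j).adj)).hom w = V j u :=
        (ConcreteCategory.congr_hom h2 w).symm.trans
          (congrArg (((ℋ.theory (ν.comp (p j))).H n).map (v j).adj).hom hu.symm)
      refine Eq.trans ?_ h3
      refine ConcreteCategory.congr_hom (h1.trans (ℋ.push_congr _ n rfl _ fun _ => ?_)) w
      change x = p j k • x₀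
      rw [hk, hx]
  constructor
  · intro y
    obtain ⟨z, rfl⟩ := hbij.2 y
    obtain ⟨j, u, rfl⟩ := (hc L n).surj z
    exact ⟨j, V j u, hVg j u⟩
  · intro i x hx
    obtain ⟨j, hij, u, hu⟩ := key i x
    have h1 : ((ℋ.ind (ν.comp ι) ν ι rfl n).app (point L)).hom
        ((ℋ.pointSys (h.comap L) (ν.comp ι) n).g j u) = 0 := by
      rw [← hVg, ← hu]
      exact (((ℋ.resSystem h ν).sys n X).g_f hij x).trans hx
    obtain ⟨k, hjk, hk⟩ := (hc L n).inj j u (hbij.1 (h1.trans (map_zero _).symm))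
    refine ⟨k, hij.trans hjk, ?_⟩
    rw [← ((ℋ.resSystem h ν).sys n X).f_f hij hjk x, hu, hVf, hk, map_zero]

/-- The canonical map `colim ℋ^{Kᵢ}(res X) → ℋ^K(X)` is bijective for all `K`-CW-complexes `X`. -/
theorem EquivariantHomologyTheory.good_resSystem [IsDirectedOrder I] [Nonempty I]
    (hc : ℋ.IsStronglyContinuous ∨ ℋ.IsContinuous ∧ ∀ i, Function.Injective (p i))
    (X : GCWComplex K) : (ℋ.resSystem h ν).Good X.toPair := by
  refine ((ℋ.resSystem h ν).cellularClass_good (ℋ.good_resSystem_orbit h ν fun L n =>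
    ℋ.isColimit_pointSys _ _ (hc.imp_right fun hc => ⟨hc.1, fun i x y hxy => ?_⟩) n)).toPair X
  exact Subtype.ext (hc.2 i (congrArg Subtype.val hxy))

end Colimit

/-! ### The Fibered Isomorphism Conjecture for directed colimits -/

theorem SubgroupFamily.pullback_comp {J K G : Type u} [Group J] [Group K] [Group G] (φ : K →* G)
    (ψ : J →* K) (ℱ : SubgroupFamily G) : (ℱ.pullback φ).pullback ψ = ℱ.pullback (φ.comp ψ) := by
  have h : ∀ H : Subgroup J, H ∈ ((ℱ.pullback φ).pullback ψ).carrier ↔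
      H ∈ (ℱ.pullback (φ.comp ψ)).carrier := fun H => by
    change (H.map ψ).map φ ∈ ℱ.carrier ↔ H.map (φ.comp ψ) ∈ ℱ.carrier
    rw [Subgroup.map_map]
  have h' : ((ℱ.pullback φ).pullback ψ).carrier = (ℱ.pullback (φ.comp ψ)).carrier := Set.ext h
  generalize (ℱ.pullback φ).pullback ψ = A at h'
  generalize ℱ.pullback (φ.comp ψ) = B at h'
  cases A
  cases B
  congr

/-- The image of a subgroup in `𝒞` is a quotient of it. -/
theorem GroupClass.map_mem (𝒞 : GroupClass.{u}) {H G : Type u} [Group H] [Group G] (ψ : H →* G)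
    {L : Subgroup H} (hL : L ∈ (𝒞.family H).carrier) : L.map ψ ∈ (𝒞.family G).carrier := by
  have h1 := 𝒞.quotient (ψ.comp L.subtype).ker hL
  have h2 := 𝒞.of_equiv (QuotientGroup.quotientKerEquivRange (ψ.comp L.subtype)) h1
  have h3 : (ψ.comp L.subtype).range = L.map ψ := by
    rw [MonoidHom.range_comp, Subgroup.range_subtype]
  rw [← h3]
  exact h2

namespace EquivariantHomologyTheory

variable {Γ : Type u} [Group Γ] {Λ : Type v} [Ring Λ] (ℋ : EquivariantHomologyTheory.{u, v, w} Γ Λ)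
  {I : Type u} [Preorder I] [IsDirectedOrder I] [Nonempty I] {Gi : I → Type u} [∀ i, Group (Gi i)]
  {φ : ∀ i j, i ≤ j → Gi i →* Gi j} {G : Type u} [Group G] {ψ : ∀ i, Gi i →* G}

/-- The Isomorphism Conjecture for a family of subgroups of a colimit follows from that for the pulled back
families: on both `E_ℱ(G)` and the point the homology is the colimit of those of the restrictions. -/
theorem isomorphismConjecture_of_colimit (h : IsConcreteColimit φ ψ) (ξ : G →* Γ)
    (hc : ℋ.IsStronglyContinuous ∨ ℋ.IsContinuous ∧ ∀ i, Function.Injective (ψ i))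
    (ℱ : SubgroupFamily G)
    (hi : ∀ i, ℋ.IsomorphismConjecture (ξ.comp (ψ i)) (ℱ.pullback (ψ i))) :
    ℋ.IsomorphismConjecture ξ ℱ := by
  intro E hE n
  let T := ℋ.resSystem h ξ
  refine (T.map n E.pr).bijective_φN (ℋ.good_resSystem h ξ hc E n)
    (ℋ.good_resSystem h ξ hc (pointComplex G) n) fun i => ?_
  let F := (ℋ.theory (ξ.comp (ψ i))).H n
  let R := (resFunctor (ψ i)).obj E.toPair
  have h1 : Function.Bijective (F.map (toPoint R rfl)).hom :=
    (bijective_map_toPoint_iff F (P := R) rfl).2 (hi i _ (hE.res (ψ i)) n)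
  let Q := (resFunctor (ψ i)).obj (point G)
  have : IsIso (toPoint Q rfl) := GCWPair.isIso_of_isHomeomorph _
    (IsHomeomorph.id (X := PUnit)) fun _ h => h.elim
  have h2 : toPoint R rfl = (resFunctor (ψ i)).map E.pr ≫ toPoint Q rfl := rfl
  rw [h2, CategoryTheory.Functor.map_comp] at h1
  exact (Function.Bijective.of_comp_iff' (bijective_map_of_isIso F (toPoint Q rfl)) _).1 h1

/-- For a homomorphism `κ : K → G`, the group `K` is the colimit of the pullbacks `K ×_G Gᵢ`. The
hypothesis on `Gᵢ` concerns the family pulled back from `𝒞(Gᵢ)`, which is enlarged to the one pulled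
back from `𝒞(G)`. -/
theorem fiberedIsomorphismConjecture_of_colimit (𝒞 : GroupClass.{u})
    (h : IsConcreteColimit φ ψ) (ξ : G →* Γ)
    (hc : ℋ.IsStronglyContinuous ∨ ℋ.IsContinuous ∧ ∀ i, Function.Injective (ψ i))
    (hi : ∀ i, ℋ.FiberedIsomorphismConjecture (ξ.comp (ψ i)) (𝒞.family (Gi i))) :
    ℋ.FiberedIsomorphismConjecture ξ (𝒞.family G) := by
  intro K _ κ
  refine ℋ.isomorphismConjecture_of_colimit (h.pullback κ) (ξ.comp κ)
    (hc.imp_right fun hc => ⟨hc.1, fun i => pullbackFst_injective κ (hc.2 i)⟩) _ fun i => ?_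
  have hξ : (ξ.comp (ψ i)).comp (pullbackSnd ψ κ i) = (ξ.comp κ).comp (pullbackFst ψ κ i) := by
    rw [MonoidHom.comp_assoc, comp_pullbackSnd, MonoidHom.comp_assoc]
  rw [← hξ]
  refine IsomorphismConjecture.of_le ℋ (ℱ := (𝒞.family (Gi i)).pullback (pullbackSnd ψ κ i))
    ?_ (hi i _) fun L => ?_
  · intro H hH
    have h1 : ((H.map (pullbackSnd ψ κ i)).map (ψ i)) ∈ (𝒞.family G).carrier := 𝒞.map_mem (ψ i) hH
    rw [Subgroup.map_map, comp_pullbackSnd, ← Subgroup.map_map] at h1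
    exact h1
  · rw [SubgroupFamily.pullback_comp, MonoidHom.comp_assoc]
    exact hi i _

end EquivariantHomologyTheory

end EquivHomology

theorem mainTheorem8 {Γ : Type u} [Group Γ] {Λ : Type v} [Ring Λ]
    (ℋ : EquivHomology.EquivariantHomologyTheory.{u, v, w} Γ Λ)
    (𝒞 : EquivHomology.GroupClass.{u}) {G : Type u} [Group G] (ξ : G →* Γ) :
    (∀ {I : Type u} [Preorder I] [IsDirectedOrder I] [Nonempty I] (S : I → Subgroup G),
      EquivHomology.IsDirectedUnion S → ℋ.IsContinuous →
      (∀ i, ℋ.FiberedIsomorphismConjecture (ξ.comp (S i).subtype) (𝒞.family (S i))) →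
      ℋ.FiberedIsomorphismConjecture ξ (𝒞.family G)) ∧
    (∀ {I : Type u} [Preorder I] [IsDirectedOrder I] [Nonempty I] {Gi : I → Type u}
      [∀ i, Group (Gi i)] (φ : ∀ i j, i ≤ j → Gi i →* Gi j) (ψ : ∀ i, Gi i →* G),
      EquivHomology.IsGroupColimit φ ψ → ℋ.IsStronglyContinuous →
      (∀ i, ℋ.FiberedIsomorphismConjecture (ξ.comp (ψ i)) (𝒞.family (Gi i))) →
      ℋ.FiberedIsomorphismConjecture ξ (𝒞.family G)) :=
  ⟨fun _ hS hc hi => ℋ.fiberedIsomorphismConjecture_of_colimit 𝒞 hS.isConcreteColimit ξ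
      (Or.inr ⟨hc, fun _ => Subtype.val_injective⟩) hi,
    fun _ _ hψ hc hi => ℋ.fiberedIsomorphismConjecture_of_colimit 𝒞 hψ.isConcreteColimit ξ
      (Or.inl hc) hi⟩
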